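/- **Setting.** Let $\breve\Omega\subset\mathbb R^3$ be a bounded open set that is invariant under all rotations about the $z$-axis, with cylindrical coordinates $x=r\cos\theta$, $y=r\sin\theta$. Its half section is $\Omega=\{(r,z): r>0,\ (r,0,z)\in\breve\Omega\}$, and $\Gamma=\{(r,z): r\ge 0,\ (r,0,z)\in\partial\breve\Omega\}$ is the part of $\partial\Omega$ whose rotation is $\partial\breve\Omega$. All functions are complex valued and all derivatives are taken in the sense of distributions. Let $\mathcal R_\theta$ be the matrix of the rotation by $\theta$ about the $z$-axis. *Spaces on $\breve\Omega$.* $(H^1(\breve\Omega))^3$ has the norm $\|\vec v\|^2=\sum_i\bigl(\|v_i\|_{L^2}^2+\|\nabla v_i\|_{L^2}^2\bigr)$ and the semi-norm $|\vec v|^2=\sum_i\|\nabla v_i\|_{L^2}^2$; $(H^1_0(\breve\Omega))^3$ is the closure in it of the smooth fields with compact support in $\breve\Omega$; $(H^{-1}(\breve\Omega))^3$ is the space of bounded anti-linear functionals on $(H^1_0(\breve\Omega))^3$, with the norm dual to $|\cdot|$. *Spaces on $\Omega$.* For $k\in\mathbb Z$ and a triple $\vec v=(v_r,v_\theta,v_z)$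 of functions on $\Omega$ let $$|\vec v|_{\boldsymbol H^1_{(k)}(\Omega)}^2=\int_\Omega\Bigl(\sum_{j\in\{r,\theta,z\}}\bigl(|\partial_r v_j|^2+|\partial_z v_j|^2\bigr)+\tfrac{1+k^2}{r^2}\bigl(|v_r|^2+|v_\theta|^2\bigr)+\tfrac{2ik}{r^2}\bigl(v_\theta\bar v_r-v_r\bar v_\theta\bigr)+\tfrac{k^2}{r^2}|v_z|^2\Bigr)\,r\,dr\,dz,$$ $$\|\vec v\|^2_{\boldsymbol H^1_{(k)}(\Omega)}=\int_\Omega\bigl(|v_r|^2+|v_\theta|^2+|v_z|^2\bigr)\,r\,dr\,dz+|\vec v|^2_{\boldsymbol H^1_{(k)}(\Omega)},$$ and let $\boldsymbol H^1_{(k)}(\Omega)$ be the space where the latter norm is finite. Let $H^1_1(\Omega)$ be the space with norm $\bigl(\int_\Omega(|u|^2+|\partial_r u|^2+|\partial_z u|^2)\,r\,dr\,dz\bigr)^{1/2}$; a function in it is said to vanish on $\Gamma$ if it is a limit in this norm of smooth compactly supported functions on $\mathbb R^2$ whose support does not meet $\Gamma$. Let $\boldsymbol H^1_{(k)\diamond}(\Omega)$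 consist of the triples in $\boldsymbol H^1_{(k)}(\Omega)$ whose components vanish on $\Gamma$, and let $\boldsymbol H^{-1}_{(k)}(\Omega)$ be its anti-linear dual, with the norm dual to $|\cdot|_{\boldsymbol H^1_{(k)}(\Omega)}$. *Fourier coefficients.* For $\vec{\breve v}\in(H^1(\breve\Omega))^3$ put $$\vec v^k(r,z)=\frac1{\sqrt{2\pi}}\int_{-\pi}^{\pi}\mathcal R_{-\theta}\vec{\breve v}(r\cos\theta,r\sin\theta,z)\,e^{-ik\theta}\,d\theta .$$ For $\vec{\breve f}\in(H^{-1}(\breve\Omega))^3$ let $\vec f^k\in\boldsymbol H^{-1}_{(k)}(\Omega)$ be given by $\langle\vec f^k,\vec v\rangle=\bigl\langle\vec{\breve f},\tfrac1{\sqrt{2\pi}}\mathcal R_\theta\vec v(r,z)e^{ik\theta}\bigr\rangle$. *Anisotropic spaces.* For an integer $s\ge 0$, $$\boldsymbol H^{\pm1,s}(\breve\Omega)=\{\vec{\breve v}:\ \mathcal R_\theta\partial_\theta^l\mathcal R_{-\theta}\vec{\breve v}\in(H^{\pm1}(\breve\Omega))^3,\ 0\le l\le s\}.$$ **Lemma.**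 For every integer $s\ge0$ there are constants $c,C>0$, depending only on $s$, such that for every $\breve\Omega$ as above, for both signs, and for all $\vec{\breve v}\in\boldsymbol H^{\pm1,s}(\breve\Omega)$, $$c\,\Bigl(\sum_{l=0}^s\bigl\|\mathcal R_\theta\partial_\theta^l\mathcal R_{-\theta}\vec{\breve v}\bigr\|^2_{(H^{\pm1}(\breve\Omega))^3}\Bigr)^{1/2}\le\Bigl(\sum_{k\in\mathbb Z}(1+k^2)^s\,\|\vec v^k\|^2_{\boldsymbol H^{\pm1}_{(k)}(\Omega)}\Bigr)^{1/2}\le C\,\Bigl(\sum_{l=0}^s\bigl\|\mathcal R_\theta\partial_\theta^l\mathcal R_{-\theta}\vec{\breve v}\bigr\|^2_{(H^{\pm1}(\breve\Omega))^3}\Bigr)^{1/2}.$$ -/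

import Mathlib

open MeasureTheory
open scoped ENNReal NNReal ComplexConjugate Matrix

noncomputable section

namespace Axisym

/-- Points `((x, y), z)` of three-dimensional space, with Lebesgue measure. -/
abbrev Space : Type := (ℝ × ℝ) × ℝ

/-- Points `(r, z)` of the meridian plane, with Lebesgue measure. -/
abbrev Plane : Type := ℝ × ℝ

/-- Vector fields in space, given by their Cartesian components `(v_x, v_y, v_z)`. -/
abbrev Field3 : Type := Space → Fin 3 → ℂ

/-- Triples `(v_r, v_θ, v_z)` of functions on the meridian plane. -/
abbrev Triple : Type := Plane → Fin 3 → ℂ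

/-! ### Rotations, axisymmetric domains and their half sections -/

/-- Rotation of space by the angle `α` about the `z`-axis. -/
def rot (α : ℝ) (p : Space) : Space :=
  ((Real.cos α * p.1.1 - Real.sin α * p.1.2, Real.sin α * p.1.1 + Real.cos α * p.1.2), p.2)

/-- The rotation matrix `R_α`, acting on component vectors. -/
def rotMat (α : ℝ) : Matrix (Fin 3) (Fin 3) ℂ :=
  !![(Real.cos α : ℂ), -(Real.sin α : ℂ), 0;
     (Real.sin α : ℂ), (Real.cos α : ℂ), 0;
     0, 0, 1]

/-- A bounded open set that is invariant under all rotations about the `z`-axis. -/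
structure IsAxisymmetricDomain (D : Set Space) : Prop where
  isOpen : IsOpen D
  isBounded : Bornology.IsBounded D
  rot_mem : ∀ (α : ℝ), ∀ p ∈ D, rot α p ∈ D

/-- The half section (meridian domain) `Ω` of `D`. -/
def halfSection (D : Set Space) : Set Plane :=
  {q | 0 < q.1 ∧ ((q.1, 0), q.2) ∈ D}

/-- The part `Γ` of the boundary of the half section whose rotation is the boundary of `D`. -/
def meridianBoundary (D : Set Space) : Set Plane :=
  {q | 0 ≤ q.1 ∧ ((q.1, 0), q.2) ∈ frontier D}

/-! ### Test functions and weak derivatives -/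

/-- Smooth functions with compact support contained in `U`. -/
structure IsTest {E F : Type*} [NormedAddCommGroup E] [NormedSpace ℝ E]
    [NormedAddCommGroup F] [NormedSpace ℝ F] (U : Set E) (φ : E → F) : Prop where
  smooth : ContDiff ℝ (⊤ : ℕ∞) φ
  compact : HasCompactSupport φ
  support_subset : tsupport φ ⊆ U

/-- `g` is the distributional derivative on `U` of `u` in the direction `e`. -/
structure IsWeakDeriv {E : Type*} [NormedAddCommGroup E] [NormedSpace ℝ E] [MeasureSpace E]
    (U : Set E) (e : E) (u g : E → ℂ) : Prop where
  left_loc : LocallyIntegrableOn u U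
  right_loc : LocallyIntegrableOn g U
  integral_eq : ∀ φ : E → ℂ, IsTest U φ →
    ∫ x in U, g x * φ x = - ∫ x in U, u x * fderiv ℝ φ x e

/-! ### The spaces `(H^1)^3`, `(H^1_0)^3` and `(H^{-1})^3` on `D`

Norms take values in `[0, ∞]`. A norm involving weak derivatives is written as an infimum over the
weak derivatives, which are unique up to null sets; so it is the usual norm if they exist, and `∞`
otherwise. -/

/-- The directions of `∂_x`, `∂_y`, `∂_z`. -/
def dir : Fin 3 → Space := ![((1, 0), 0), ((0, 1), 0), ((0, 0), 1)]

/-- `G i j` is the weak derivative `∂_j v_i` on `D`. -/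
def IsWeakGrad (D : Set Space) (v : Field3) (G : Fin 3 → Fin 3 → Space → ℂ) : Prop :=
  ∀ i j, IsWeakDeriv D (dir j) (fun p => v p i) (G i j)

/-- The norm of `(H^1(D))^3`. -/
def h1Norm (D : Set Space) (v : Field3) : ℝ≥0∞ :=
  ⨅ (G : Fin 3 → Fin 3 → Space → ℂ) (_ : IsWeakGrad D v G),
    ((∑ i, ∫⁻ p in D, ‖v p i‖ₑ ^ 2) + ∑ i, ∑ j, ∫⁻ p in D, ‖G i j p‖ₑ ^ 2) ^ (1 / 2 : ℝ)

/-- The semi-norm `|v|` of `(H^1(D))^3`. -/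
def h1Seminorm (D : Set Space) (v : Field3) : ℝ≥0∞ :=
  ⨅ (G : Fin 3 → Fin 3 → Space → ℂ) (_ : IsWeakGrad D v G),
    (∑ i, ∑ j, ∫⁻ p in D, ‖G i j p‖ₑ ^ 2) ^ (1 / 2 : ℝ)

/-- The space `(H^1(D))^3`. -/
def H1 (D : Set Space) : Set Field3 := {v | h1Norm D v < ⊤}

/-- The space `(H^1_0(D))^3`: the closure of the test fields in `(H^1(D))^3`. -/
def H10 (D : Set Space) : Set Field3 :=
  {v | v ∈ H1 D ∧ ∀ ε : ℝ≥0∞, 0 < ε → ∃ φ : Field3, IsTest D φ ∧ h1Norm D (v - φ) < ε}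

/-- The norm on `(H^{-1}(D))^3`, dual to the semi-norm on `(H^1_0(D))^3`. -/
def hm1Norm (D : Set Space) (f : Field3 → ℂ) : ℝ≥0∞ :=
  ⨆ (v : Field3) (_ : v ∈ H10 D) (_ : h1Seminorm D v ≤ 1), ‖f v‖ₑ

/-- The space `(H^{-1}(D))^3` of bounded anti-linear functionals on `(H^1_0(D))^3`. A functional is
represented by a function of all fields; only its values on `(H^1_0(D))^3` are meaningful. -/
structure IsHm1 (D : Set Space) (f : Field3 → ℂ) : Prop where
  map_add : ∀ u ∈ H10 D, ∀ v ∈ H10 D, f (u + v) = f u + f v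
  map_smul : ∀ (c : ℂ), ∀ v ∈ H10 D, f (c • v) = conj c * f v
  bounded : hm1Norm D f < ⊤

/-! ### The operators `R_θ ∂_θ^l R_{-θ}` -/

/-- `R_θ ∂_θ^l R_{-θ} ψ` for smooth `ψ`. At the point `p` with angle `θ`, the field `R_{-θ} ψ` at
angle `θ + α` is `R_{-θ} R_{-α} ψ (rot α p)`, which is differentiated `l` times at `α = 0` and then
multiplied by `R_θ`. -/
def rotDeriv (l : ℕ) (ψ : Field3) : Field3 := fun p =>
  iteratedDeriv l (fun α : ℝ => rotMat (-α) *ᵥ ψ (rot α p)) 0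

/-- `w = R_θ ∂_θ^l R_{-θ} v` in the sense of distributions on `D`. The formal transpose of the
operator is `(-1)^l R_θ ∂_θ^l R_{-θ}`, because `R_θ` is orthogonal and the volume element
`r dr dθ dz` does not depend on `θ`. -/
structure IsRotDeriv (D : Set Space) (l : ℕ) (v w : Field3) : Prop where
  left_loc : LocallyIntegrableOn v D
  right_loc : LocallyIntegrableOn w D
  integral_eq : ∀ ψ : Field3, IsTest D ψ →
    ∫ p in D, w p ⬝ᵥ ψ p = (-1) ^ l * ∫ p in D, v p ⬝ᵥ rotDeriv l ψ p

/-- `g = R_θ ∂_θ^l R_{-θ} f` in the sense of distributions on `D`, for functionals `f`, `g`. -/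
def IsRotDerivDual (D : Set Space) (l : ℕ) (f g : Field3 → ℂ) : Prop :=
  ∀ ψ : Field3, IsTest D ψ → g ψ = (-1) ^ l * f (rotDeriv l ψ)

/-! ### Anisotropic spaces and their natural norms -/

/-- The anisotropic space `H^{1,s}(D)`. -/
def AnisoH1 (D : Set Space) (s : ℕ) : Set Field3 :=
  {v | v ∈ H1 D ∧ ∀ l ≤ s, ∃ w ∈ H1 D, IsRotDeriv D l v w}

/-- The natural norm of `H^{1,s}(D)`. -/
def naturalNormH1 (D : Set Space) (s : ℕ) (v : Field3) : ℝ≥0∞ :=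
  (∑ l ∈ Finset.range (s + 1),
    (⨅ (w : Field3) (_ : IsRotDeriv D l v w), h1Norm D w) ^ 2) ^ (1 / 2 : ℝ)

/-- The anisotropic space `H^{-1,s}(D)`. -/
def AnisoHm1 (D : Set Space) (s : ℕ) : Set (Field3 → ℂ) :=
  {f | IsHm1 D f ∧ ∀ l ≤ s, ∃ g, IsHm1 D g ∧ IsRotDerivDual D l f g}

/-- The natural norm of `H^{-1,s}(D)`. -/
def naturalNormHm1 (D : Set Space) (s : ℕ) (f : Field3 → ℂ) : ℝ≥0∞ :=
  (∑ l ∈ Finset.range (s + 1),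
    (⨅ (g : Field3 → ℂ) (_ : IsHm1 D g) (_ : IsRotDerivDual D l f g), hm1Norm D g) ^ 2)
      ^ (1 / 2 : ℝ)

/-! ### Weighted spaces on the half section -/

/-- The norm of `H^1_1(Ω)`, with weight `r`. -/
def h11Norm (Ω : Set Plane) (u : Plane → ℂ) : ℝ≥0∞ :=
  ⨅ (a : Plane → ℂ) (b : Plane → ℂ) (_ : IsWeakDeriv Ω (1, 0) u a) (_ : IsWeakDeriv Ω (0, 1) u b),
    (∫⁻ q in Ω, (‖u q‖ₑ ^ 2 + ‖a q‖ₑ ^ 2 + ‖b q‖ₑ ^ 2) * ENNReal.ofReal q.1) ^ (1 / 2 : ℝ)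

/-- Functions in `H^1_1(Ω)` that vanish on `Γ`: limits in `H^1_1(Ω)` of smooth, compactly supported
functions whose support does not meet `Γ`. -/
def H11Diamond (D : Set Space) : Set (Plane → ℂ) :=
  {u | h11Norm (halfSection D) u < ⊤ ∧ ∀ ε : ℝ≥0∞, 0 < ε →
    ∃ φ : Plane → ℂ, IsTest (meridianBoundary D)ᶜ φ ∧ h11Norm (halfSection D) (u - φ) < ε}

/-- The (real, nonnegative) density of the squared semi-norm of `H^1_{(k)}(Ω)`, without the weight
`r`, at a point with distance `r` to the axis, where the triple has value `v = (v_r, v_θ, v_z)` and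
derivatives `a = ∂_r v`, `b = ∂_z v`. -/
def modeDensity (k : ℤ) (r : ℝ) (v a b : Fin 3 → ℂ) : ℝ :=
  ‖a 0‖ ^ 2 + ‖b 0‖ ^ 2 + (1 + (k : ℝ) ^ 2) / r ^ 2 * ‖v 0‖ ^ 2
  + ‖a 1‖ ^ 2 + ‖b 1‖ ^ 2 + (1 + (k : ℝ) ^ 2) / r ^ 2 * ‖v 1‖ ^ 2
  + ‖a 2‖ ^ 2 + ‖b 2‖ ^ 2 + (k : ℝ) ^ 2 / r ^ 2 * ‖v 2‖ ^ 2
  + (2 * Complex.I * k / (r : ℂ) ^ 2 * v 1 * conj (v 0)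
      - 2 * Complex.I * k / (r : ℂ) ^ 2 * v 0 * conj (v 1)).re

/-- `a` and `b` are the weak derivatives `∂_r v` and `∂_z v` of the triple `v` on `Ω`. -/
def IsWeakPartials (Ω : Set Plane) (v a b : Triple) : Prop :=
  ∀ i, IsWeakDeriv Ω (1, 0) (fun q => v q i) (fun q => a q i) ∧
    IsWeakDeriv Ω (0, 1) (fun q => v q i) (fun q => b q i)

/-- The norm of `H^1_{(k)}(Ω)`. -/
def h1kNorm (Ω : Set Plane) (k : ℤ) (v : Triple) : ℝ≥0∞ :=
  ⨅ (a : Triple) (b : Triple) (_ : IsWeakPartials Ω v a b),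
    (∫⁻ q in Ω, ENNReal.ofReal
      (((∑ i, ‖v q i‖ ^ 2) + modeDensity k q.1 (v q) (a q) (b q)) * q.1)) ^ (1 / 2 : ℝ)

/-- The semi-norm of `H^1_{(k)}(Ω)`. -/
def h1kSeminorm (Ω : Set Plane) (k : ℤ) (v : Triple) : ℝ≥0∞ :=
  ⨅ (a : Triple) (b : Triple) (_ : IsWeakPartials Ω v a b),
    (∫⁻ q in Ω, ENNReal.ofReal (modeDensity k q.1 (v q) (a q) (b q) * q.1)) ^ (1 / 2 : ℝ)

/-- The space `H^1_{(k)⋄}(Ω)` of elements of `H^1_{(k)}(Ω)` that vanish on `Γ`. -/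
def H1kDiamond (D : Set Space) (k : ℤ) : Set Triple :=
  {v | h1kNorm (halfSection D) k v < ⊤ ∧ ∀ i, (fun q => v q i) ∈ H11Diamond D}

/-- The norm of `H^{-1}_{(k)}(Ω)`, the dual of `H^1_{(k)⋄}(Ω)` with its semi-norm. -/
def hm1kNorm (D : Set Space) (k : ℤ) (F : Triple → ℂ) : ℝ≥0∞ :=
  ⨆ (v : Triple) (_ : v ∈ H1kDiamond D k) (_ : h1kSeminorm (halfSection D) k v ≤ 1), ‖F v‖ₑ

/-! ### Fourier coefficients and the Fourier-weighted norms -/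

/-- The Fourier coefficient
`v^k (r, z) = (2π)^{-1/2} ∫_{-π}^{π} R_{-θ} v (r cos θ, r sin θ, z) e^{-ikθ} dθ`. -/
def coeff (k : ℤ) (v : Field3) : Triple := fun q i =>
  (Real.sqrt (2 * Real.pi) : ℂ)⁻¹ * ∫ θ in (-Real.pi)..Real.pi,
    (rotMat (-θ) *ᵥ v ((q.1 * Real.cos θ, q.1 * Real.sin θ), q.2)) i
      * Complex.exp (-(Complex.I * k * θ))

/-- The field `(2π)^{-1/2} R_θ v (r, z) e^{ikθ}` whose only Fourier coefficient is `v^k = v`. -/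
def mode (k : ℤ) (v : Triple) : Field3 := fun p =>
  ((Real.sqrt (2 * Real.pi) : ℂ)⁻¹ * Complex.exp (Complex.I * k * ((polarCoord p.1).2 : ℝ))) •
    (rotMat (polarCoord p.1).2 *ᵥ v ((polarCoord p.1).1, p.2))

/-- The Fourier coefficient `f^k` of a functional, acting on `H^1_{(k)⋄}(Ω)`: as
`⟨f, v⟩ = ∑_k ⟨f^k, v^k⟩`, its value at a triple is that of `f` at the corresponding single mode. -/
def coeffDual (k : ℤ) (f : Field3 → ℂ) : Triple → ℂ := fun v => f (mode k v)

/-- The Fourier-weighted norm of `H^{1,s}(D)`. -/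
def fourierNormH1 (D : Set Space) (s : ℕ) (v : Field3) : ℝ≥0∞ :=
  (∑' k : ℤ, ENNReal.ofReal ((1 + (k : ℝ) ^ 2) ^ s)
    * h1kNorm (halfSection D) k (coeff k v) ^ 2) ^ (1 / 2 : ℝ)

/-- The Fourier-weighted norm of `H^{-1,s}(D)`. -/
def fourierNormHm1 (D : Set Space) (s : ℕ) (f : Field3 → ℂ) : ℝ≥0∞ :=
  (∑' k : ℤ, ENNReal.ofReal ((1 + (k : ℝ) ^ 2) ^ s)
    * hm1kNorm D k (coeffDual k f) ^ 2) ^ (1 / 2 : ℝ)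

end Axisym

end

open MeasureTheory
open scoped ENNReal NNReal ComplexConjugate Matrix

noncomputable section

namespace Axisym

set_option linter.unusedSectionVars false

open Set Filter Topology

/-! All rotations about the axis are diagonal in one unitary basis: (v_x + i v_y)/√2, (v_x - i
v_y)/√2 and v_z are multiplied by e^{iα}, e^{-iα} and 1. In this basis the k-th Fourier coefficient
of a field consists of scalar Fourier coefficients of frequencies k+1, k-1 and k, and completing
squares splits the density of H^1_(k) into three uncoupled scalar densities |∂_r w|² + |∂_z w|² +
(m²/r²)|w|² (`modeDensity_eq`). The vector problem becomes three scalar ones.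

For a scalar H^1 function, Parseval's identity on almost every circle applies to the function itself
and to the radial, angular and vertical parts of its gradient. The coefficients of the radial and
vertical parts are the weak derivatives of the coefficient; that of the angular part is im/r times
the coefficient (`scoeff_angularPart`), which produces the term m²/r². Summation gives the exact
identity Σ_k ‖v^k‖² = ‖v‖², for the norm and for the semi-norm (`parseval_norm`,
`parseval_seminorm`).

For H^{-1} this identity is dualised. Fourier coefficients map H^1_0 into H^1_(k)⋄
(`coeff_mem_H1kDiamond`); conversely, a single mode built from an element of H^1_(k)⋄ lies in H^1_0
and has the same norm and semi-norm (`mode_mem_H10`, `h1Norm_mode`, `h1Seminorm_mode`). The converse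
is the delicate point: weak derivatives on the half section do not see the axis, and elements of
H^1_(k)⋄ need not vanish there. Since the axis has zero capacity, logarithmic cut-offs show that
test functions supported away from it are nevertheless dense for the energy of each scalar frequency
(`exists_isTest_fullEnergy_sub_lt`). As distinct modes are orthogonal, Σ_k ‖f^k‖² = ‖f‖² follows
(`parseval_hm1Norm`): one inequality by testing f on finite combinations of modes, the other by
expanding the argument of f in modes.

Finally R_θ ∂_θ^l R_{-θ} multiplies the k-th coefficient by (ik)^l, so the squared norm of the l-th
derivative is Σ_k k^{2l} ‖v^k‖². What remains is to compare Σ_{l ≤ s} k^{2l} with (1 + k²)^s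
(`weighted_equivalence`), which gives c = 1 and C = 2^s for every domain and both signs. -/

/-! ### Cylindrical coordinates -/

/-- The point with cylindrical coordinates `((r, z), θ)`. -/
def cyl (x : Plane × ℝ) : Space := ((x.1.1 * Real.cos x.2, x.1.1 * Real.sin x.2), x.1.2)

/-- Distance to the axis and height of a point. -/
def meridian (p : Space) : Plane := (√(p.1.1 ^ 2 + p.1.2 ^ 2), p.2)

/-- The measure `r dr dz` on `Ω`. -/
def mer (Ω : Set Plane) : Measure Plane :=
  (volume.restrict Ω).withDensity fun q => ENNReal.ofReal q.1

/-- Lebesgue measure on the interval of angles. -/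
def ang : Measure ℝ := volume.restrict (Ioc (-Real.pi) Real.pi)

instance : IsFiniteMeasure ang := by unfold ang; infer_instance

instance (Ω : Set Plane) : SFinite (mer Ω) := by unfold mer; infer_instance

lemma ang_univ : ang univ = ENNReal.ofReal (2 * Real.pi) := by
  rw [ang, Measure.restrict_apply_univ, Real.volume_Ioc]; ring_nf

lemma continuous_cyl : Continuous cyl := by unfold cyl; fun_prop

lemma continuous_meridian : Continuous meridian := by unfold meridian; fun_prop

lemma cyl_eq_rot (q : Plane) (θ : ℝ) : cyl (q, θ) = rot θ ((q.1, 0), q.2) := by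
  ext <;> simp [cyl, rot, mul_comm]

lemma rot_rot (a b : ℝ) (p : Space) : rot a (rot b p) = rot (a + b) p := by
  ext <;> simp [rot, Real.cos_add, Real.sin_add] <;> ring

lemma rot_zero (p : Space) : rot 0 p = p := by simp [rot]

lemma meridian_cyl {q : Plane} (hq : 0 ≤ q.1) (θ : ℝ) : meridian (cyl (q, θ)) = q := by
  ext
  · simp only [meridian, cyl]
    rw [← Real.sqrt_sq hq]
    congr 1
    rw [Real.sqrt_sq hq]
    linear_combination q.1 ^ 2 * Real.sin_sq_add_cos_sq θ
  · rfl

lemma exists_cyl_meridian (p : Space) : ∃ θ ∈ Ioc (-Real.pi) Real.pi, cyl (meridian p, θ) = p := by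
  refine ⟨Complex.arg ⟨p.1.1, p.1.2⟩, Complex.arg_mem_Ioc _, ?_⟩
  have h : √(p.1.1 ^ 2 + p.1.2 ^ 2) = ‖(⟨p.1.1, p.1.2⟩ : ℂ)‖ := by
    rw [Complex.norm_def, Complex.normSq_mk]; ring_nf
  ext
  · simp only [cyl, meridian, h]
    exact Complex.norm_mul_cos_arg _
  · simp only [cyl, meridian, h]
    exact Complex.norm_mul_sin_arg _
  · rfl

section Domain

variable {D : Set Space} (hD : IsAxisymmetricDomain D)

include hD

lemma IsAxisymmetricDomain.rot_mem_iff (α : ℝ) (p : Space) : rot α p ∈ D ↔ p ∈ D := by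
  refine ⟨fun h => ?_, hD.rot_mem α p⟩
  have := hD.rot_mem (-α) _ h
  rwa [rot_rot, neg_add_cancel, rot_zero] at this

lemma IsAxisymmetricDomain.cyl_mem_iff {q : Plane} (hq : 0 < q.1) (θ : ℝ) :
    cyl (q, θ) ∈ D ↔ q ∈ halfSection D := by
  rw [cyl_eq_rot, hD.rot_mem_iff]
  simp [halfSection, hq]

lemma IsAxisymmetricDomain.isOpen_halfSection : IsOpen (halfSection D) := by
  have h1 : IsOpen {q : Plane | 0 < q.1} := isOpen_lt continuous_const continuous_fst
  have h2 : IsOpen ((fun q : Plane => (((q.1, 0), q.2) : Space)) ⁻¹' D) :=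
    hD.isOpen.preimage (by fun_prop)
  exact h1.inter h2

lemma IsAxisymmetricDomain.volume_lt_top : volume D < ⊤ := hD.isBounded.measure_lt_top

/-- Tonelli and polar coordinates in each horizontal plane. By rotation invariance, whether a point
off the axis lies in D depends only on its meridian coordinates, so the domain is a full product of
half section and angles. Every integral over D is later computed through this map. -/
theorem measurePreserving_cyl :
    MeasurePreserving cyl ((mer (halfSection D)).prod ang) (volume.restrict D) := by
  have hmeas : Measurable cyl := continuous_cyl.measurable
  refine ⟨hmeas, Measure.ext fun A hA => ?_⟩
  have hΩ := hD.isOpen_halfSection.measurableSet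
  have hDm := hD.isOpen.measurableSet
  set f : Space → ℝ≥0∞ := (A ∩ D).indicator 1 with hf
  have hfm : Measurable f := measurable_one.indicator (hA.inter hDm)
  have key : ∀ q : Plane, ∀ θ : ℝ, (Ioi (0:ℝ)).indicator (fun r => ENNReal.ofReal r) q.1 * f (cyl (q, θ))
      = (halfSection D).indicator (fun q => ENNReal.ofReal q.1) q *
        (cyl ⁻¹' A).indicator 1 (q, θ) := by
    intro q θ
    by_cases hq : 0 < q.1
    · have := hD.cyl_mem_iff hq θ
      by_cases h1 : q ∈ halfSection D <;> by_cases h2 : cyl (q, θ) ∈ A <;>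
        simp [hf, indicator, hq, this, h1, h2]
    · have h1 : q ∉ halfSection D := fun h => hq h.1
      simp [indicator, hq, h1]
  have hm1 : Measurable fun x : Plane × ℝ => (halfSection D).indicator (fun q : Plane => ENNReal.ofReal q.1) x.1 *
        (cyl ⁻¹' A).indicator 1 x := by
    refine Measurable.mul ?_ ?_
    · exact ((measurable_fst.ennreal_ofReal).indicator hΩ).comp measurable_fst
    · exact measurable_one.indicator (hmeas hA)
  rw [Measure.map_apply hmeas hA, Measure.restrict_apply hA, Measure.prod_apply (hmeas hA)]
  have lhs : ∫⁻ q, ang (Prod.mk q ⁻¹' (cyl ⁻¹' A)) ∂mer (halfSection D) =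
      ∫⁻ q : Plane, ∫⁻ θ, (halfSection D).indicator (fun q => ENNReal.ofReal q.1) q *
        (cyl ⁻¹' A).indicator 1 (q, θ) ∂ang := by
    unfold mer
    rw [lintegral_withDensity_eq_lintegral_mul _ (by fun_prop)
      (measurable_measure_prodMk_left (hmeas hA)), ← lintegral_indicator hΩ]
    refine lintegral_congr fun q => ?_
    rw [lintegral_const_mul (f := fun θ => (cyl ⁻¹' A).indicator 1 (q, θ)) _
      ((measurable_one.indicator (hmeas hA)).comp measurable_prodMk_left)]
    have : ∫⁻ θ, (cyl ⁻¹' A).indicator 1 (q, θ) ∂ang = ang (Prod.mk q ⁻¹' (cyl ⁻¹' A)) := by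
      rw [← lintegral_indicator_one (measurable_prodMk_left (hmeas hA))]; rfl
    rw [this]
    by_cases h1 : q ∈ halfSection D <;> simp [h1]
  rw [lhs, ← lintegral_indicator_one (hA.inter hDm)]
  change _ = ∫⁻ p, f p
  rw [Measure.volume_eq_prod (α := ℝ × ℝ), lintegral_prod_symm _ hfm.aemeasurable,
    Measure.volume_eq_prod (α := ℝ) (β := ℝ)]
  rw [lintegral_prod_symm]
  swap
  · exact (hm1.lintegral_prod_right').aemeasurable
  refine lintegral_congr fun z => ?_
  rw [← Measure.volume_eq_prod, ← lintegral_comp_polarCoord_symm]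
  change _ = ∫⁻ p in Ioi (0:ℝ) ×ˢ Ioo (-Real.pi) Real.pi, _
  rw [Measure.volume_eq_prod, ← Measure.prod_restrict, lintegral_prod]
  swap
  · refine Measurable.aemeasurable ?_
    have h3 : Measurable fun p : ℝ × ℝ => (polarCoord.symm p, z) := by
      have := continuous_polarCoord_symm.measurable
      fun_prop
    exact (measurable_fst.ennreal_ofReal).smul (hfm.comp h3)
  rw [← lintegral_indicator measurableSet_Ioi]
  refine lintegral_congr fun r => ?_
  simp_rw [← key]
  -- Mathlib's polar coordinates use the open interval of angles, `ang` the half-open one; they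
  -- differ by a null set.
  unfold ang
  rw [restrict_Ioo_eq_restrict_Ioc]
  by_cases hr : r ∈ Ioi (0:ℝ)
  · simp only [hr, indicator_of_mem]
    rfl
  · simp [hr]

end Domain

/-! ### Scalar Fourier coefficients -/

/-- The normalising constant `(2π)^{-1/2}`. -/
def nrm : ℂ := (Real.sqrt (2 * Real.pi) : ℂ)⁻¹

/-- The Fourier coefficient of a function of the angle. -/
def angCoeff (m : ℤ) (F : ℝ → ℂ) : ℂ :=
  nrm * ∫ θ, F θ * Complex.exp (-(Complex.I * m * θ)) ∂ang

/-- The Fourier coefficient of a scalar function in space. -/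
def scoeff (m : ℤ) (u : Space → ℂ) (q : Plane) : ℂ := angCoeff m fun θ => u (cyl (q, θ))

lemma nrm_ne_zero : nrm ≠ 0 := by
  simp [nrm, Real.pi_pos.le, Real.pi_ne_zero]

lemma nrm_sq : nrm ^ 2 * (2 * Real.pi : ℝ) = 1 := by
  have h : (0:ℝ) < 2 * Real.pi := by positivity
  rw [nrm, inv_pow, ← Complex.ofReal_pow, Real.sq_sqrt h.le, inv_mul_cancel₀]
  exact_mod_cast h.ne'

lemma norm_nrm_sq : ‖nrm‖ ^ 2 * (2 * Real.pi) = 1 := by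
  have := congrArg norm nrm_sq
  rwa [norm_mul, norm_pow, Complex.norm_real, norm_one, Real.norm_of_nonneg (by positivity)] at this

lemma enorm_nrm_sq : ‖nrm‖ₑ ^ 2 * ang univ = 1 := by
  rw [ang_univ, ← ofReal_norm, ← ENNReal.ofReal_pow (norm_nonneg _),
    ← ENNReal.ofReal_mul (by positivity), norm_nrm_sq, ENNReal.ofReal_one]

lemma norm_exp_I (m : ℤ) (θ : ℝ) : ‖Complex.exp (Complex.I * m * θ)‖ = 1 := by
  rw [mul_assoc, mul_comm]
  exact_mod_cast Complex.norm_exp_ofReal_mul_I (m * θ)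

lemma norm_exp_neg_I (m : ℤ) (θ : ℝ) : ‖Complex.exp (-(Complex.I * m * θ))‖ = 1 := by
  rw [Complex.exp_neg, norm_inv, norm_exp_I, inv_one]

lemma continuous_exp_neg (m : ℤ) :
    Continuous fun θ : ℝ => Complex.exp (-(Complex.I * m * θ)) := by fun_prop

lemma angCoeff_eq_fourierCoeffOn (m : ℤ) (F : ℝ → ℂ) :
    angCoeff m F = nrm⁻¹ * fourierCoeffOn (a := -Real.pi) (b := Real.pi)
      (by linarith [Real.pi_pos]) F m := by
  rw [fourierCoeffOn_eq_integral, intervalIntegral.integral_of_le (by linarith [Real.pi_pos]),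
    Complex.real_smul, ← mul_assoc]
  have h : nrm⁻¹ * ((1 / (Real.pi - -Real.pi) : ℝ) : ℂ) = nrm := by
    have := nrm_sq
    have h2 : ((2 * Real.pi : ℝ) : ℂ) ≠ 0 := by
      exact_mod_cast (by positivity : (2 * Real.pi : ℝ) ≠ 0)
    have h3 : Real.pi - -Real.pi = 2 * Real.pi := by ring
    rw [h3, one_div, Complex.ofReal_inv, inv_mul_eq_iff_eq_mul₀ nrm_ne_zero]
    exact inv_eq_of_mul_eq_one_left (by rw [← pow_two, this])
  rw [h, angCoeff, ang]
  congr 1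
  refine integral_congr_ae (ae_of_all _ fun θ => ?_)
  have hp : (Real.pi : ℂ) ≠ 0 := by exact_mod_cast Real.pi_ne_zero
  simp only [fourier_coe_apply, smul_eq_mul]
  rw [mul_comm]
  congr 2
  push_cast
  field_simp
  ring

/-- Mathlib's Parseval identity is normalised by the mean value over the interval; the factor
(2π)^{-1/2} in `angCoeff` makes the transform unitary, so the factors 2π cancel. -/
lemma tsum_enorm_angCoeff_sq {F : ℝ → ℂ} (hF : AEStronglyMeasurable F ang)
    (hF2 : ∫⁻ θ, ‖F θ‖ₑ ^ 2 ∂ang < ⊤) :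
    ∑' m, ‖angCoeff m F‖ₑ ^ 2 = ∫⁻ θ, ‖F θ‖ₑ ^ 2 ∂ang := by
  have hL2 : MemLp F 2 ang := by
    refine ⟨hF, ?_⟩
    rw [eLpNorm_lt_top_iff_lintegral_rpow_enorm_lt_top (by simp) (by simp)]
    simpa using hF2
  have hab : -Real.pi < Real.pi := by linarith [Real.pi_pos]
  have h := hasSum_sq_fourierCoeffOn hab hL2
  have hnn : ∀ m, 0 ≤ ‖fourierCoeffOn hab F m‖ ^ 2 := fun m => by positivity
  have hint : ENNReal.ofReal (∫ x in (-Real.pi)..Real.pi, ‖F x‖ ^ 2) = ∫⁻ θ, ‖F θ‖ₑ ^ 2 ∂ang := by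
    rw [intervalIntegral.integral_of_le hab.le, ofReal_integral_eq_lintegral_ofReal]
    · refine lintegral_congr fun θ => ?_
      rw [ENNReal.ofReal_pow (norm_nonneg _), ofReal_norm]
    · exact hL2.integrable_norm_pow (by norm_num)
    · exact ae_of_all _ fun θ => by positivity
  have h2 := h.tsum_eq
  have hpos : (0:ℝ) < Real.pi - -Real.pi := by linarith
  calc ∑' m, ‖angCoeff m F‖ₑ ^ 2
      = ∑' m, ENNReal.ofReal (Real.pi - -Real.pi) * ENNReal.ofReal (‖fourierCoeffOn hab F m‖ ^ 2) := by
        congr 1; funext m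
        rw [angCoeff_eq_fourierCoeffOn, ← ENNReal.ofReal_mul hpos.le, ← ofReal_norm,
          ← ENNReal.ofReal_pow (norm_nonneg _), norm_mul, mul_pow]
        congr 2
        rw [norm_inv, inv_pow]
        exact inv_eq_of_mul_eq_one_right (by linear_combination norm_nrm_sq)
    _ = ENNReal.ofReal (Real.pi - -Real.pi) * ENNReal.ofReal (∑' m, ‖fourierCoeffOn hab F m‖ ^ 2) := by
        rw [ENNReal.tsum_mul_left, ENNReal.ofReal_tsum_of_nonneg hnn h.summable]
    _ = _ := by
        rw [h2, ← ENNReal.ofReal_mul hpos.le, smul_eq_mul, mul_inv_cancel_left₀ hpos.ne', hint]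

section Domain

variable {D : Set Space} (hD : IsAxisymmetricDomain D) {u : Space → ℂ}

include hD

lemma aesm_comp_cyl (hu : AEStronglyMeasurable u (volume.restrict D)) :
    AEStronglyMeasurable (fun x => u (cyl x)) ((mer (halfSection D)).prod ang) :=
  hu.comp_measurePreserving (measurePreserving_cyl hD)

lemma aesm_scoeff (hu : AEStronglyMeasurable u (volume.restrict D)) (m : ℤ) :
    AEStronglyMeasurable (scoeff m u) (mer (halfSection D)) := by
  have h1 : AEStronglyMeasurable
      (fun x : Plane × ℝ => u (cyl x) * Complex.exp (-(Complex.I * m * x.2)))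
      ((mer (halfSection D)).prod ang) :=
    (aesm_comp_cyl hD hu).mul ((continuous_exp_neg m).comp continuous_snd).aestronglyMeasurable
  exact h1.integral_prod_right'.const_mul _

lemma lintegral_cyl {f : Space → ℝ≥0∞} (hf : AEMeasurable f (volume.restrict D)) :
    ∫⁻ q, ∫⁻ θ, f (cyl (q, θ)) ∂ang ∂mer (halfSection D) = ∫⁻ p in D, f p := by
  have h := measurePreserving_cyl hD
  rw [← h.map_eq] at hf ⊢
  rw [lintegral_map' hf h.aemeasurable]
  exact (lintegral_prod _ (hf.comp_aemeasurable h.aemeasurable)).symm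

/-- Parseval on almost every circle, integrated over the half section. Tonelli ensures that almost
every circle carries a square integrable restriction. -/
lemma parseval_scoeff (hu : AEStronglyMeasurable u (volume.restrict D))
    (hu2 : ∫⁻ p in D, ‖u p‖ₑ ^ 2 < ⊤) :
    ∑' m, ∫⁻ q, ‖scoeff m u q‖ₑ ^ 2 ∂mer (halfSection D) = ∫⁻ p in D, ‖u p‖ₑ ^ 2 := by
  have hm : AEMeasurable (fun p => ‖u p‖ₑ ^ 2) (volume.restrict D) := hu.enorm.pow_const _
  rw [← lintegral_cyl hD hm] at hu2 ⊢
  rw [← lintegral_tsum fun m => (aesm_scoeff hD hu m).enorm.pow_const _]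
  have h1 : AEMeasurable (fun q => ∫⁻ θ, ‖u (cyl (q, θ))‖ₑ ^ 2 ∂ang) (mer (halfSection D)) :=
    ((aesm_comp_cyl hD hu).enorm.pow_const 2).lintegral_prod_right'
  refine lintegral_congr_ae ?_
  filter_upwards [ae_lt_top' h1 hu2.ne, (aesm_comp_cyl hD hu).prodMk_left] with q hq hq2
  exact tsum_enorm_angCoeff_sq hq2 hq

/-- Boundedness of D gives finite measure, hence L² ⊆ L¹; thus Fourier integrals converge absolutely
on almost every circle. -/
lemma integrable_of_sq (hu : AEStronglyMeasurable u (volume.restrict D))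
    (hu2 : ∫⁻ p in D, ‖u p‖ₑ ^ 2 < ⊤) : Integrable u (volume.restrict D) := by
  have : IsFiniteMeasure (volume.restrict D) := ⟨by simpa using hD.volume_lt_top⟩
  have hL2 : MemLp u 2 (volume.restrict D) := by
    refine ⟨hu, ?_⟩
    rw [eLpNorm_lt_top_iff_lintegral_rpow_enorm_lt_top (by simp) (by simp)]
    simpa using hu2
  exact hL2.integrable (by norm_num)

lemma integrable_comp_cyl (hu : Integrable u (volume.restrict D)) :
    Integrable (fun x => u (cyl x)) ((mer (halfSection D)).prod ang) :=
  (measurePreserving_cyl hD).integrable_comp_of_integrable hu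

lemma ae_integrable_comp_cyl (hu : Integrable u (volume.restrict D)) :
    ∀ᵐ q ∂mer (halfSection D), Integrable (fun θ => u (cyl (q, θ))) ang :=
  (integrable_comp_cyl hD hu).prod_right_ae

lemma integrable_scoeff (hu : Integrable u (volume.restrict D)) (m : ℤ) :
    Integrable (scoeff m u) (mer (halfSection D)) := by
  have h1 : Integrable
      (fun x : Plane × ℝ => u (cyl x) * Complex.exp (-(Complex.I * m * x.2)))
      ((mer (halfSection D)).prod ang) := by
    refine (integrable_comp_cyl hD hu).mul_bdd (c := 1)
      ((continuous_exp_neg m).comp continuous_snd).aestronglyMeasurable (ae_of_all _ fun x => ?_)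
    exact (norm_exp_neg_I m x.2).le
  exact h1.integral_prod_left.const_mul _

lemma integral_cyl {f : Space → ℂ} (hf : Integrable f (volume.restrict D)) :
    ∫ p in D, f p = ∫ q, ∫ θ, f (cyl (q, θ)) ∂ang ∂mer (halfSection D) := by
  have h := measurePreserving_cyl hD
  have h2 := integrable_comp_cyl hD hf
  rw [← integral_prod _ h2, ← h.map_eq, integral_map h.aemeasurable]
  rw [h.map_eq]
  exact hf.1

end Domain

/-! ### The measure r dr dz on the half section -/

lemma ae_mer_iff {Ω : Set Plane} (hΩ : MeasurableSet Ω) (hpos : ∀ q ∈ Ω, 0 < q.1)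
    {P : Plane → Prop} : (∀ᵐ q ∂mer Ω, P q) ↔ ∀ᵐ q ∂volume.restrict Ω, P q := by
  rw [mer, ae_withDensity_iff' (by fun_prop)]
  have : ∀ᵐ q ∂volume.restrict Ω, q ∈ Ω := ae_restrict_mem hΩ
  constructor
  · intro h
    filter_upwards [h, this] with q h1 h2
    exact h1 (by simpa using hpos q h2)
  · intro h
    filter_upwards [h] with q h1 _ using h1

lemma ae_mer_mem {Ω : Set Plane} (hΩ : MeasurableSet Ω) (hpos : ∀ q ∈ Ω, 0 < q.1) :
    ∀ᵐ q ∂mer Ω, q ∈ Ω :=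
  (ae_mer_iff hΩ hpos).2 (ae_restrict_mem hΩ)

lemma integral_mer {Ω : Set Plane} (hΩ : MeasurableSet Ω) (hpos : ∀ q ∈ Ω, 0 < q.1)
    (f : Plane → ℂ) : ∫ q, f q ∂mer Ω = ∫ q in Ω, (q.1 : ℂ) * f q := by
  rw [mer, integral_withDensity_eq_integral_toReal_smul (by fun_prop)
    (ae_of_all _ fun _ => ENNReal.ofReal_lt_top)]
  refine setIntegral_congr_fun hΩ fun q hq => ?_
  simp [ENNReal.toReal_ofReal (hpos q hq).le]

lemma lintegral_mer {Ω : Set Plane} (f : Plane → ℝ≥0∞) :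
    ∫⁻ q, f q ∂mer Ω = ∫⁻ q in Ω, f q * ENNReal.ofReal q.1 := by
  rw [mer, lintegral_withDensity_eq_lintegral_mul_non_measurable _ (by fun_prop)
    (ae_of_all _ fun _ => ENNReal.ofReal_lt_top)]
  simp [mul_comm]

/-- Division by r is harmless locally, because 1/r is continuous on the open set Ω, which does not
touch the axis. -/
lemma locallyIntegrableOn_of_integrable_mer {Ω : Set Plane} (hΩ : IsOpen Ω)
    (hpos : ∀ q ∈ Ω, 0 < q.1) {f : Plane → ℂ} (hf : Integrable f (mer Ω)) :
    LocallyIntegrableOn f Ω := by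
  rw [mer, integrable_withDensity_iff_integrable_smul' (by fun_prop)
    (ae_of_all _ fun _ => ENNReal.ofReal_lt_top)] at hf
  have h1 : LocallyIntegrableOn (fun q : Plane => (ENNReal.ofReal q.1).toReal • f q) Ω :=
    IntegrableOn.locallyIntegrableOn hf
  have h2 : LocallyIntegrableOn (fun q : Plane => ((q.1 : ℂ)⁻¹) *
      (ENNReal.ofReal q.1).toReal • f q) Ω := by
    refine h1.continuousOn_mul ?_ hΩ.isLocallyClosed
    refine ContinuousOn.inv₀ (by fun_prop) fun q hq => ?_
    exact_mod_cast (hpos q hq).ne'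
  refine (LocallyIntegrableOn.congr ?_ h2)
  filter_upwards [ae_restrict_mem hΩ.measurableSet] with q hq
  have h0 := hpos q hq
  rw [ENNReal.toReal_ofReal h0.le, Complex.real_smul, inv_mul_cancel_left₀]
  exact_mod_cast h0.ne'

/-! ### Scalar modes -/

/-- The function `e^{imθ}` in space. -/
def harm (m : ℤ) (p : Space) : ℂ := Complex.exp (Complex.I * m * ((polarCoord p.1).2 : ℝ))

/-- The scalar field `(2π)^{-1/2} w(r, z) e^{imθ}`. -/
def slift (m : ℤ) (w : Plane → ℂ) (p : Space) : ℂ := nrm * harm m p * w (meridian p)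

lemma harm_eq_zpow (m : ℤ) (p : Space) :
    harm m p = (Complex.exp ((Complex.arg ⟨p.1.1, p.1.2⟩ : ℝ) * Complex.I)) ^ m := by
  rw [← Complex.exp_int_mul, harm]
  congr 1
  change Complex.I * m * ((Complex.arg (Complex.equivRealProd.symm p.1) : ℝ) : ℂ) = _
  rw [Complex.equivRealProd_symm_apply]
  rw [Complex.mk_eq_add_mul_I]
  ring

lemma exp_arg_eq (z : ℂ) : Complex.exp ((Complex.arg z : ℝ) * Complex.I) * ‖z‖ = z := by
  rw [mul_comm]; exact Complex.norm_mul_exp_arg_mul_I z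

lemma harm_cyl (m : ℤ) {q : Plane} (hq : 0 < q.1) (θ : ℝ) :
    harm m (cyl (q, θ)) = Complex.exp (Complex.I * m * θ) := by
  have h1 : (⟨(cyl (q, θ)).1.1, (cyl (q, θ)).1.2⟩ : ℂ) = q.1 * Complex.exp (θ * Complex.I) := by
    rw [Complex.exp_mul_I, ← Complex.ofReal_cos, ← Complex.ofReal_sin]
    apply Complex.ext <;> simp [cyl, -Complex.ofReal_cos, -Complex.ofReal_sin]
  have h2 := exp_arg_eq (⟨(cyl (q, θ)).1.1, (cyl (q, θ)).1.2⟩ : ℂ)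
  have h3 : ‖(⟨(cyl (q, θ)).1.1, (cyl (q, θ)).1.2⟩ : ℂ)‖ = q.1 := by
    rw [h1, norm_mul, Complex.norm_exp_ofReal_mul_I, mul_one, Complex.norm_real,
      Real.norm_of_nonneg hq.le]
  rw [h3] at h2
  have hq' : (q.1 : ℂ) ≠ 0 := by exact_mod_cast hq.ne'
  have h4 := mul_right_cancel₀ hq' (h2.trans (h1.trans (mul_comm _ _)))
  rw [harm_eq_zpow, h4, ← Complex.exp_int_mul]
  congr 1
  ring

lemma slift_cyl (m : ℤ) (w : Plane → ℂ) {q : Plane} (hq : 0 < q.1) (θ : ℝ) :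
    slift m w (cyl (q, θ)) = nrm * Complex.exp (Complex.I * m * θ) * w q := by
  rw [slift, harm_cyl m hq, meridian_cyl hq.le]

lemma measurable_harm (m : ℤ) : Measurable (harm m) := by
  have : harm m = fun p => Complex.exp (Complex.I * m * ((Complex.arg (Complex.equivRealProd.symm p.1) : ℝ))) := rfl
  rw [this]
  have h : Continuous fun p : Space => Complex.equivRealProd.symm p.1 := by
    have : (fun p : Space => Complex.equivRealProd.symm p.1) = fun p : Space => (p.1.1 : ℂ) + p.1.2 * Complex.I := by
      funext p; rw [Complex.equivRealProd_symm_apply]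
    rw [this]; fun_prop
  have := Complex.measurable_arg.comp h.measurable
  fun_prop

lemma contDiffAt_zpow_of_ne {E : Type*} [NormedAddCommGroup E] [NormedSpace ℝ E] {f : E → ℂ} {x : E}
    {n : WithTop ℕ∞} (hf : ContDiffAt ℝ n f x) (hx : f x ≠ 0) (m : ℤ) :
    ContDiffAt ℝ n (fun y => f y ^ m) x := by
  cases m with
  | ofNat k => simpa using hf.pow k
  | negSucc k =>
    simp only [zpow_negSucc]
    exact (hf.pow (k + 1)).inv (pow_ne_zero _ hx)

lemma sq_add_sq_ne_zero {p : Space} (hp : 0 < (meridian p).1) : p.1.1 ^ 2 + p.1.2 ^ 2 ≠ 0 := by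
  intro h
  simp [meridian, h] at hp

lemma contDiffAt_meridian {p : Space} (hp : 0 < (meridian p).1) {n : WithTop ℕ∞} :
    ContDiffAt ℝ n meridian p := by
  unfold meridian
  refine ContDiffAt.prodMk (ContDiffAt.sqrt ?_ (sq_add_sq_ne_zero hp)) contDiffAt_snd
  fun_prop

/-- The angle jumps across a half plane, but e^{imθ} = ((x + iy)/r)^m has no branch cut and is
smooth off the axis. -/
lemma contDiffAt_harm (m : ℤ) {p : Space} (hp : 0 < (meridian p).1) {n : WithTop ℕ∞} :
    ContDiffAt ℝ n (harm m) p := by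
  have h0 : ∀ p : Space, (meridian p).1 = ‖(⟨p.1.1, p.1.2⟩ : ℂ)‖ := fun p => by
    rw [Complex.norm_def, Complex.normSq_mk, meridian]; ring_nf
  have h1 : ∀ᶠ p' in 𝓝 p, harm m p' =
      ((p'.1.1 + p'.1.2 * Complex.I) / ((meridian p').1 : ℂ)) ^ m := by
    have : ∀ᶠ p' in 𝓝 p, 0 < (meridian p').1 :=
      (continuous_fst.comp continuous_meridian).continuousAt.eventually (lt_mem_nhds hp)
    filter_upwards [this] with p' hp'
    rw [harm_eq_zpow]
    congr 1
    rw [eq_div_iff (by exact_mod_cast hp'.ne'), h0, exp_arg_eq, Complex.mk_eq_add_mul_I]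
  have h2 : ContDiffAt ℝ n (fun p' : Space => ((p'.1.1 : ℂ) + p'.1.2 * Complex.I) / ((meridian p').1 : ℂ)) p := by
    have hne : ((meridian p).1 : ℂ) ≠ 0 := by exact_mod_cast hp.ne'
    simp only [div_eq_mul_inv]
    refine ContDiffAt.mul ?_ (ContDiffAt.inv ?_ hne)
    · have h3 : ContDiff ℝ n fun x : ℝ => (x : ℂ) := Complex.ofRealCLM.contDiff
      have h4 : ContDiff ℝ n fun p' : Space => (p'.1.1 : ℂ) := h3.comp (by fun_prop)
      have h5 : ContDiff ℝ n fun p' : Space => (p'.1.2 : ℂ) := h3.comp (by fun_prop)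
      exact (h4.add (h5.mul contDiff_const)).contDiffAt
    · have h3 : ContDiff ℝ n fun x : ℝ => (x : ℂ) := Complex.ofRealCLM.contDiff
      exact h3.contDiffAt.comp p (contDiffAt_fst.comp p (contDiffAt_meridian hp))
  refine ContDiffAt.congr_of_eventuallyEq ?_ h1
  refine contDiffAt_zpow_of_ne h2 ?_ m
  rw [div_ne_zero_iff]
  refine ⟨?_, by exact_mod_cast hp.ne'⟩
  rw [← Complex.mk_eq_add_mul_I, ← norm_ne_zero_iff, ← h0]
  exact hp.ne'

/-- Smoothness has to be checked only on a compact subset of U outside which the function vanishes.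
This hides the singularities of `harm` on the axis and of indicators at the boundary. -/
lemma IsTest.of_eventually {E F : Type*} [NormedAddCommGroup E] [NormedSpace ℝ E]
    [NormedAddCommGroup F] [NormedSpace ℝ F] {U K : Set E} {φ : E → F} (hK : IsCompact K)
    (hKU : K ⊆ U) (h0 : ∀ x ∉ K, φ x = 0) (hs : ∀ x ∈ K, ContDiffAt ℝ (⊤ : ℕ∞) φ x) :
    IsTest U φ := by
  have hsub : tsupport φ ⊆ K :=
    closure_minimal (fun x hx => by_contra fun h => hx (h0 x h)) hK.isClosed
  refine ⟨contDiff_iff_contDiffAt.2 fun x => ?_, hK.of_isClosed_subset (isClosed_tsupport _) hsub,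
    hsub.trans hKU⟩
  by_cases hx : x ∈ K
  · exact hs x hx
  · have : φ =ᶠ[𝓝 x] fun _ => 0 := by
      filter_upwards [hK.isClosed.isOpen_compl.mem_nhds hx] with y hy using h0 y hy
    exact contDiffAt_const.congr_of_eventuallyEq this

lemma IsTest.mul_left {E : Type*} [NormedAddCommGroup E] [NormedSpace ℝ E] {U : Set E} {φ h : E → ℂ}
    (hφ : IsTest U φ) (hh : ∀ x ∈ U, ContDiffAt ℝ (⊤ : ℕ∞) h x) : IsTest U fun x => h x * φ x := by
  refine IsTest.of_eventually hφ.compact hφ.support_subset (fun x hx => ?_) fun x hx => ?_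
  · rw [image_eq_zero_of_notMem_tsupport hx, mul_zero]
  · exact (hh x (hφ.support_subset hx)).mul hφ.smooth.contDiffAt

section Domain

variable {D : Set Space} (hD : IsAxisymmetricDomain D)

include hD

/-- The support of χ is a compact subset of {r > 0}; its rotation is compact in D and avoids the
axis, where `harm` is not smooth. -/
lemma isTest_slift {χ : Plane → ℂ} (hχ : IsTest (halfSection D) χ) (m : ℤ) :
    IsTest D (slift m χ) := by
  have hK : IsCompact (cyl '' (tsupport χ ×ˢ Icc (-Real.pi) Real.pi)) :=
    (hχ.compact.isCompact.prod isCompact_Icc).image continuous_cyl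
  refine IsTest.of_eventually hK ?_ ?_ ?_
  · rintro _ ⟨⟨q, θ⟩, ⟨hq, -⟩, rfl⟩
    have := hχ.support_subset hq
    exact (hD.cyl_mem_iff this.1 θ).2 this
  · intro p hp
    obtain ⟨θ, hθ, h⟩ := exists_cyl_meridian p
    have : meridian p ∉ tsupport χ := fun hm => hp ⟨(meridian p, θ), ⟨hm, Ioc_subset_Icc_self hθ⟩, h⟩
    rw [slift, image_eq_zero_of_notMem_tsupport this, mul_zero]
  · rintro _ ⟨⟨q, θ⟩, ⟨hq, -⟩, rfl⟩
    have h0 := (hχ.support_subset hq).1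
    have h1 : 0 < (meridian (cyl (q, θ))).1 := by rwa [meridian_cyl h0.le]
    exact (contDiffAt_const.mul (contDiffAt_harm m h1)).mul
      (hχ.smooth.contDiffAt.comp _ (contDiffAt_meridian h1))

lemma ae_meridian_mem : ∀ᵐ p ∂volume.restrict D, meridian p ∈ halfSection D := by
  have h := measurePreserving_cyl hD
  have hm : MeasurableSet {p | meridian p ∈ halfSection D} :=
    continuous_meridian.measurable hD.isOpen_halfSection.measurableSet
  rw [← h.map_eq, ae_map_iff h.aemeasurable hm]
  have h1 := ae_mer_mem hD.isOpen_halfSection.measurableSet (fun q hq => hq.1)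
  have h2 : ∀ᵐ x ∂(mer (halfSection D)).prod ang, x.1 ∈ halfSection D :=
    Measure.quasiMeasurePreserving_fst.ae h1
  filter_upwards [h2] with x hx
  change meridian (cyl (x.1, x.2)) ∈ _
  rwa [meridian_cyl hx.1.le]

lemma ae_exists_cyl : ∀ᵐ p ∂volume.restrict D, ∃ q ∈ halfSection D, ∃ θ, p = cyl (q, θ) := by
  filter_upwards [ae_meridian_mem hD] with p hp
  obtain ⟨θ, -, h⟩ := exists_cyl_meridian p
  exact ⟨_, hp, θ, h.symm⟩

/-- The pairing is bilinear, without conjugation, hence the sign in -m. This is the device that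
turns a test function on the half section into one on D and extracts a single coefficient. -/
lemma pairing_scoeff {u : Space → ℂ} {g : Plane → ℂ} (m : ℤ)
    (hi : Integrable (fun p => u p * slift (-m) g p) (volume.restrict D)) :
    ∫ p in D, u p * slift (-m) g p = ∫ q, scoeff m u q * g q ∂mer (halfSection D) := by
  rw [integral_cyl hD hi]
  refine integral_congr_ae ?_
  filter_upwards [ae_mer_mem hD.isOpen_halfSection.measurableSet (fun q hq => hq.1)] with q hq
  rw [scoeff, angCoeff, mul_assoc, ← integral_mul_const, ← integral_const_mul]
  refine integral_congr_ae (ae_of_all _ fun θ => ?_)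
  simp only [slift_cyl _ _ hq.1]
  push_cast
  ring_nf

end Domain

/-! ### Derivatives of scalar modes along the cylindrical coordinate lines -/

section Derivatives

variable {g : Space → ℂ} {q : Plane} {θ : ℝ}

/-- Chain rule along the curve of constant angle and height. Along each of the three coordinate
lines the mode has an explicit form, so `harm` itself need not be differentiated. -/
lemma fderiv_radial (m : ℤ) {χ : Plane → ℂ} (hq : 0 < q.1) (hχ : DifferentiableAt ℝ χ q)
    (hg : DifferentiableAt ℝ (slift m χ) (cyl (q, θ))) :
    (Real.cos θ : ℂ) * fderiv ℝ (slift m χ) (cyl (q, θ)) (dir 0)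
      + Real.sin θ * fderiv ℝ (slift m χ) (cyl (q, θ)) (dir 1) =
    nrm * Complex.exp (Complex.I * m * θ) * fderiv ℝ χ q (1, 0) := by
  have hc : HasDerivAt (fun t : ℝ => cyl ((t, q.2), θ)) ((Real.cos θ, Real.sin θ), 0) q.1 := by
    change HasDerivAt (fun t : ℝ => ((t * Real.cos θ, t * Real.sin θ), q.2)) _ _
    refine HasDerivAt.prodMk (HasDerivAt.prodMk ?_ ?_) (hasDerivAt_const _ _)
    · simpa using (hasDerivAt_id q.1).mul_const (Real.cos θ)
    · simpa using (hasDerivAt_id q.1).mul_const (Real.sin θ)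
  have h1 := hg.hasFDerivAt.comp_hasDerivAt q.1 hc
  have hd : HasDerivAt (fun t : ℝ => ((t, q.2) : Plane)) (1, 0) q.1 :=
    HasDerivAt.prodMk (hasDerivAt_id _) (hasDerivAt_const _ _)
  have h2 := (hχ.hasFDerivAt.comp_hasDerivAt q.1 hd).const_mul
    (nrm * Complex.exp (Complex.I * m * θ))
  have he : (slift m χ ∘ fun t : ℝ => cyl ((t, q.2), θ)) =ᶠ[𝓝 q.1]
      fun t => nrm * Complex.exp (Complex.I * m * θ) * (χ ∘ fun t : ℝ => ((t, q.2) : Plane)) t := by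
    filter_upwards [lt_mem_nhds hq] with t ht
    exact slift_cyl m χ (q := (t, q.2)) ht θ
  have h3 := h1.unique (h2.congr_of_eventuallyEq he)
  rw [← h3]
  have hv : (((Real.cos θ, Real.sin θ), 0) : Space) = Real.cos θ • dir 0 + Real.sin θ • dir 1 := by
    simp [dir]
  rw [hv, map_add, map_smul, map_smul, Complex.real_smul, Complex.real_smul]

lemma fderiv_angular (m : ℤ) {χ : Plane → ℂ} (hq : 0 < q.1)
    (hg : DifferentiableAt ℝ (slift m χ) (cyl (q, θ))) :
    (q.1 : ℂ) * (Real.cos θ * fderiv ℝ (slift m χ) (cyl (q, θ)) (dir 1)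
      - Real.sin θ * fderiv ℝ (slift m χ) (cyl (q, θ)) (dir 0)) =
    Complex.I * m * (nrm * Complex.exp (Complex.I * m * θ) * χ q) := by
  have hc : HasDerivAt (fun t : ℝ => cyl (q, t))
      ((q.1 * -Real.sin θ, q.1 * Real.cos θ), 0) θ := by
    change HasDerivAt (fun t : ℝ => ((q.1 * Real.cos t, q.1 * Real.sin t), q.2)) _ _
    exact HasDerivAt.prodMk (HasDerivAt.prodMk ((Real.hasDerivAt_cos θ).const_mul _)
      ((Real.hasDerivAt_sin θ).const_mul _)) (hasDerivAt_const _ _)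
  have h1 := hg.hasFDerivAt.comp_hasDerivAt θ hc
  have h2 : HasDerivAt (fun t : ℝ => nrm * Complex.exp (Complex.I * m * t) * χ q)
      (nrm * (Complex.exp (Complex.I * m * θ) * (Complex.I * m)) * χ q) θ := by
    refine (HasDerivAt.const_mul _ (HasDerivAt.cexp ?_)).mul_const _
    simpa using (hasDerivAt_id θ).ofReal_comp.const_mul (Complex.I * m)
  have he : (slift m χ ∘ fun t : ℝ => cyl (q, t)) =
      fun t : ℝ => nrm * Complex.exp (Complex.I * m * t) * χ q := by
    funext t
    exact slift_cyl m χ hq t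
  rw [he] at h1
  have h3 := h1.unique h2
  have hv : (((q.1 * -Real.sin θ, q.1 * Real.cos θ), 0) : Space) =
      (q.1 * -Real.sin θ) • dir 0 + (q.1 * Real.cos θ) • dir 1 := by
    simp [dir]
  rw [hv, map_add, map_smul, map_smul, Complex.real_smul, Complex.real_smul] at h3
  push_cast at h3 ⊢
  linear_combination h3

lemma fderiv_vertical (m : ℤ) {χ : Plane → ℂ} (hq : 0 < q.1) (hχ : DifferentiableAt ℝ χ q)
    (hg : DifferentiableAt ℝ (slift m χ) (cyl (q, θ))) :
    fderiv ℝ (slift m χ) (cyl (q, θ)) (dir 2) =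
    nrm * Complex.exp (Complex.I * m * θ) * fderiv ℝ χ q (0, 1) := by
  have hc : HasDerivAt (fun t : ℝ => cyl ((q.1, t), θ)) (dir 2) q.2 := by
    change HasDerivAt (fun t : ℝ => (((q.1 * Real.cos θ, q.1 * Real.sin θ) : ℝ × ℝ), t)) _ _
    exact HasDerivAt.prodMk (hasDerivAt_const _ _) (hasDerivAt_id _)
  have h1 : HasDerivAt (slift m χ ∘ fun t : ℝ => cyl ((q.1, t), θ)) _ _ :=
    hg.hasFDerivAt.comp_hasDerivAt q.2 hc
  have hd : HasDerivAt (fun t : ℝ => ((q.1, t) : Plane)) (0, 1) q.2 :=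
    HasDerivAt.prodMk (hasDerivAt_const _ _) (hasDerivAt_id _)
  have h2 := (hχ.hasFDerivAt.comp_hasDerivAt q.2 hd).const_mul
    (nrm * Complex.exp (Complex.I * m * θ))
  have he : (slift m χ ∘ fun t : ℝ => cyl ((q.1, t), θ)) =
      fun t => nrm * Complex.exp (Complex.I * m * θ) * (χ ∘ fun t : ℝ => ((q.1, t) : Plane)) t := by
    funext t
    exact slift_cyl m χ (q := (q.1, t)) hq θ
  rw [he] at h1
  exact h1.unique h2

end Derivatives

/-! ### Weak derivatives -/

section WeakDeriv

variable {E : Type*} [NormedAddCommGroup E] [NormedSpace ℝ E] [MeasureSpace E] [BorelSpace E]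
  {U : Set E} {e : E} {u u' g g' φ : E → ℂ}

lemma IsTest.fderiv_apply (hφ : IsTest U φ) (e : E) : IsTest U fun x => fderiv ℝ φ x e := by
  refine ⟨?_, ?_, ?_⟩
  · exact (hφ.smooth.fderiv_right (m := (⊤ : ℕ∞)) (by simp)).clm_apply contDiff_const
  · exact hφ.compact.fderiv_apply (𝕜 := ℝ) e
  · refine (closure_mono fun x hx => ?_).trans ((closure_mono (support_fderiv_subset ℝ)).trans
      ((closure_closure (s := Function.support φ)).subset.trans hφ.support_subset))
    intro h
    exact hx (by simp [h])

lemma IsTest.add {F : Type*} [NormedAddCommGroup F] [NormedSpace ℝ F] {φ ψ : E → F}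
    (hφ : IsTest U φ) (hψ : IsTest U ψ) : IsTest U (φ + ψ) := by
  refine IsTest.of_eventually (hφ.compact.isCompact.union hψ.compact.isCompact)
    (union_subset hφ.support_subset hψ.support_subset) (fun x hx => ?_)
    fun x _ => hφ.smooth.contDiffAt.add hψ.smooth.contDiffAt
  rw [mem_union, not_or] at hx
  rw [Pi.add_apply, image_eq_zero_of_notMem_tsupport hx.1, image_eq_zero_of_notMem_tsupport hx.2,
    add_zero]

lemma IsTest.integrable_mul (hφ : IsTest U φ) (hg : LocallyIntegrableOn g U) :
    Integrable (fun x => g x * φ x) (volume.restrict U) := by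
  have hK : IntegrableOn g (tsupport φ) :=
    hg.integrableOn_compact_subset hφ.support_subset hφ.compact
  obtain ⟨C, hC⟩ := hφ.compact.exists_bound_of_continuous hφ.smooth.continuous
  have h1 : IntegrableOn (fun x => g x * φ x) (tsupport φ) :=
    Integrable.mul_bdd hK hφ.smooth.continuous.aestronglyMeasurable.restrict
      (ae_of_all _ hC)
  rw [integrableOn_iff_integrable_of_support_subset] at h1
  · exact h1.integrableOn
  · intro x hx
    exact subset_tsupport _ fun h => hx (by simp [h])

lemma IsWeakDeriv.congr (h : IsWeakDeriv U e u g) (hu : u =ᵐ[volume.restrict U] u')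
    (hg : g =ᵐ[volume.restrict U] g') : IsWeakDeriv U e u' g' := by
  refine ⟨h.left_loc.congr hu, h.right_loc.congr hg, fun φ hφ => ?_⟩
  have h1 : ∫ x in U, g x * φ x = ∫ x in U, g' x * φ x :=
    integral_congr_ae (hg.mul (ae_eq_refl φ))
  have h2 : ∫ x in U, u x * fderiv ℝ φ x e = ∫ x in U, u' x * fderiv ℝ φ x e :=
    integral_congr_ae (hu.mul (ae_eq_refl fun x => fderiv ℝ φ x e))
  rw [← h1, ← h2]
  exact h.integral_eq φ hφ

lemma IsWeakDeriv.add (h : IsWeakDeriv U e u g) (h' : IsWeakDeriv U e u' g') :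
    IsWeakDeriv U e (fun x => u x + u' x) (fun x => g x + g' x) := by
  refine ⟨h.left_loc.add h'.left_loc, h.right_loc.add h'.right_loc, fun φ hφ => ?_⟩
  have hd := hφ.fderiv_apply e
  simp_rw [add_mul]
  rw [integral_add (hφ.integrable_mul h.right_loc) (hφ.integrable_mul h'.right_loc),
    integral_add (hd.integrable_mul h.left_loc) (hd.integrable_mul h'.left_loc),
    h.integral_eq φ hφ, h'.integral_eq φ hφ]
  ring

lemma IsWeakDeriv.const_mul (h : IsWeakDeriv U e u g) (c : ℂ) :
    IsWeakDeriv U e (fun x => c * u x) (fun x => c * g x) := by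
  refine ⟨h.left_loc.smul c, h.right_loc.smul c, fun φ hφ => ?_⟩
  simp_rw [mul_assoc]
  rw [integral_const_mul, integral_const_mul, h.integral_eq φ hφ]
  ring

lemma IsWeakDeriv.zero : IsWeakDeriv U e (0 : E → ℂ) 0 :=
  ⟨locallyIntegrableOn_zero, locallyIntegrableOn_zero, fun φ _ => by simp⟩

lemma IsWeakDeriv.sum {ι : Type*} {s : Finset ι} {u g : ι → E → ℂ}
    (h : ∀ i ∈ s, IsWeakDeriv U e (u i) (g i)) :
    IsWeakDeriv U e (fun x => ∑ i ∈ s, u i x) (fun x => ∑ i ∈ s, g i x) := by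
  classical
  induction s using Finset.induction_on with
  | empty =>
    simp only [Finset.sum_empty]
    exact IsWeakDeriv.zero
  | insert a s ha ih =>
    simp only [Finset.sum_insert ha]
    exact (h a (Finset.mem_insert_self _ _)).add (ih fun i hi => h i (Finset.mem_insert_of_mem hi))

/-- Fundamental lemma of the calculus of variations; real test functions suffice and are embedded
into the complex ones. -/
lemma ae_eq_of_forall_integral_mul_eq [FiniteDimensional ℝ E] {f f' : E → ℂ} (hU : IsOpen U)
    (hf : LocallyIntegrableOn f U) (hf' : LocallyIntegrableOn f' U)
    (h : ∀ φ : E → ℂ, IsTest U φ → ∫ x in U, f x * φ x = ∫ x in U, f' x * φ x) :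
    f =ᵐ[volume.restrict U] f' := by
  have := hU.ae_eq_zero_of_integral_contDiff_smul_eq_zero (hf.sub hf') (fun χ h1 h2 h3 => by
    have hφ : IsTest U fun x => (χ x : ℂ) := by
      refine IsTest.of_eventually h2 h3 (fun x hx => ?_) fun x _ => ?_
      · simp [image_eq_zero_of_notMem_tsupport hx]
      · exact (Complex.ofRealCLM.contDiff.comp h1).contDiffAt
    have h4 := h _ hφ
    rw [← sub_eq_zero, ← integral_sub (hφ.integrable_mul hf) (hφ.integrable_mul hf')] at h4
    rw [← setIntegral_eq_integral_of_forall_compl_eq_zero (s := U), ← h4]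
    · refine integral_congr_ae (ae_of_all _ fun x => ?_)
      simp only [Pi.sub_apply, Complex.real_smul]
      ring
    · intro x hx
      rw [image_eq_zero_of_notMem_tsupport fun h => hx (h3 h), zero_smul])
  rw [EventuallyEq, ae_restrict_iff' hU.measurableSet]
  filter_upwards [this] with x hx hxU
  exact sub_eq_zero.1 (hx hxU)

lemma IsWeakDeriv.unique [FiniteDimensional ℝ E] (hU : IsOpen U) (h : IsWeakDeriv U e u g)
    (h' : IsWeakDeriv U e u' g') (hu : u =ᵐ[volume.restrict U] u') :
    g =ᵐ[volume.restrict U] g' :=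
  ae_eq_of_forall_integral_mul_eq hU h.right_loc h'.right_loc fun φ hφ => by
    rw [h.integral_eq φ hφ, (h'.congr hu.symm (ae_eq_refl _)).integral_eq φ hφ]

end WeakDeriv

/-! ### Weak derivatives of Fourier coefficients -/

/-- The component in the direction `e_r` of a gradient. -/
def radialPart (G : Fin 3 → Space → ℂ) (p : Space) : ℂ :=
  (p.1.1 / (meridian p).1 : ℝ) * G 0 p + (p.1.2 / (meridian p).1 : ℝ) * G 1 p

/-- The component in the direction `e_θ` of a gradient. -/
def angularPart (G : Fin 3 → Space → ℂ) (p : Space) : ℂ :=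
  (p.1.1 / (meridian p).1 : ℝ) * G 1 p - (p.1.2 / (meridian p).1 : ℝ) * G 0 p

lemma radialPart_cyl (G : Fin 3 → Space → ℂ) {q : Plane} (hq : 0 < q.1) (θ : ℝ) :
    radialPart G (cyl (q, θ)) =
      Real.cos θ * G 0 (cyl (q, θ)) + Real.sin θ * G 1 (cyl (q, θ)) := by
  rw [radialPart, meridian_cyl hq.le]
  simp only [cyl, mul_div_cancel_left₀ _ hq.ne']

lemma angularPart_cyl (G : Fin 3 → Space → ℂ) {q : Plane} (hq : 0 < q.1) (θ : ℝ) :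
    angularPart G (cyl (q, θ)) =
      Real.cos θ * G 1 (cyl (q, θ)) - Real.sin θ * G 0 (cyl (q, θ)) := by
  rw [angularPart, meridian_cyl hq.le]
  simp only [cyl, mul_div_cancel_left₀ _ hq.ne']

lemma enorm_rotate_sq (c s : ℝ) (h : c ^ 2 + s ^ 2 = 1) (a b : ℂ) :
    ‖(c : ℂ) * a + s * b‖ₑ ^ 2 + ‖(c : ℂ) * b - s * a‖ₑ ^ 2 = ‖a‖ₑ ^ 2 + ‖b‖ₑ ^ 2 := by
  have key : ‖(c : ℂ) * a + s * b‖ ^ 2 + ‖(c : ℂ) * b - s * a‖ ^ 2 = ‖a‖ ^ 2 + ‖b‖ ^ 2 := by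
    simp only [← Complex.normSq_eq_norm_sq, Complex.normSq_apply, Complex.add_re, Complex.add_im,
      Complex.sub_re, Complex.sub_im, Complex.re_ofReal_mul, Complex.im_ofReal_mul]
    linear_combination (a.re ^ 2 + a.im ^ 2 + b.re ^ 2 + b.im ^ 2) * h
  simp only [← ofReal_norm, ← ENNReal.ofReal_pow (norm_nonneg _)]
  rw [← ENNReal.ofReal_add (by positivity) (by positivity), key,
    ENNReal.ofReal_add (by positivity) (by positivity)]

section Domain

variable {D : Set Space} (hD : IsAxisymmetricDomain D) {u : Space → ℂ} {G : Fin 3 → Space → ℂ}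

lemma measurable_unit (f : Space → ℝ) (hf : Continuous f) :
    Measurable fun p : Space => ((f p / (meridian p).1 : ℝ) : ℂ) := by
  have := continuous_meridian.measurable
  have := hf.measurable
  fun_prop

lemma aesm_radialPart (hG : ∀ j, AEStronglyMeasurable (G j) (volume.restrict D)) :
    AEStronglyMeasurable (radialPart G) (volume.restrict D) :=
  ((measurable_unit (fun p => p.1.1) (by fun_prop)).aestronglyMeasurable.mul (hG 0)).add
    ((measurable_unit (fun p => p.1.2) (by fun_prop)).aestronglyMeasurable.mul (hG 1))

lemma aesm_angularPart (hG : ∀ j, AEStronglyMeasurable (G j) (volume.restrict D)) :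
    AEStronglyMeasurable (angularPart G) (volume.restrict D) :=
  ((measurable_unit (fun p => p.1.1) (by fun_prop)).aestronglyMeasurable.mul (hG 1)).sub
    ((measurable_unit (fun p => p.1.2) (by fun_prop)).aestronglyMeasurable.mul (hG 0))

include hD

lemma ae_enorm_radial_angular (G : Fin 3 → Space → ℂ) : ∀ᵐ p ∂volume.restrict D,
    ‖radialPart G p‖ₑ ^ 2 + ‖angularPart G p‖ₑ ^ 2 = ‖G 0 p‖ₑ ^ 2 + ‖G 1 p‖ₑ ^ 2 := by
  filter_upwards [ae_exists_cyl hD] with p hp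
  obtain ⟨q, hq, θ, rfl⟩ := hp
  rw [radialPart_cyl _ hq.1, angularPart_cyl _ hq.1]
  exact enorm_rotate_sq _ _ (Real.cos_sq_add_sin_sq θ) _ _

/-- The quotient is at most 1 in absolute value; on the axis it is 0 by the convention for division
by zero. -/
lemma integrable_mul_bounded_unit {f : Space → ℝ} (hf : Continuous f)
    (h1 : ∀ p, |f p| ≤ (meridian p).1) {g : Space → ℂ} (hg : Integrable g (volume.restrict D)) :
    Integrable (fun p => ((f p / (meridian p).1 : ℝ) : ℂ) * g p) (volume.restrict D) := by
  refine hg.bdd_mul (c := 1) (measurable_unit f hf).aestronglyMeasurable (ae_of_all _ fun p => ?_)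
  rw [Complex.norm_real, Real.norm_eq_abs, abs_div]
  refine div_le_one_of_le₀ ((h1 p).trans (le_abs_self _)) (abs_nonneg _)

lemma integrable_radialPart (hG : ∀ j, Integrable (G j) (volume.restrict D)) :
    Integrable (radialPart G) (volume.restrict D) := by
  refine (integrable_mul_bounded_unit hD (f := fun p => p.1.1) (by fun_prop) (fun p => ?_) (hG 0)).add
    (integrable_mul_bounded_unit hD (f := fun p => p.1.2) (by fun_prop) (fun p => ?_) (hG 1))
  · exact Real.abs_le_sqrt (by nlinarith)
  · exact Real.abs_le_sqrt (by nlinarith)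

lemma integrable_angularPart (hG : ∀ j, Integrable (G j) (volume.restrict D)) :
    Integrable (angularPart G) (volume.restrict D) := by
  refine (integrable_mul_bounded_unit hD (f := fun p => p.1.1) (by fun_prop) (fun p => ?_) (hG 1)).sub
    (integrable_mul_bounded_unit hD (f := fun p => p.1.2) (by fun_prop) (fun p => ?_) (hG 0))
  · exact Real.abs_le_sqrt (by nlinarith)
  · exact Real.abs_le_sqrt (by nlinarith)

lemma locallyIntegrableOn_scoeff (hu : Integrable u (volume.restrict D)) (m : ℤ) :
    LocallyIntegrableOn (scoeff m u) (halfSection D) :=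
  locallyIntegrableOn_of_integrable_mer hD.isOpen_halfSection (fun _ h => h.1)
    (integrable_scoeff hD hu m)

lemma integral_mer_halfSection (f : Plane → ℂ) :
    ∫ q, f q ∂mer (halfSection D) = ∫ q in halfSection D, (q.1 : ℂ) * f q :=
  integral_mer hD.isOpen_halfSection.measurableSet (fun _ h => h.1) f

omit hD in
lemma contDiffAt_inv_fst_pow {q : Plane} (hq : 0 < q.1) (n : ℕ) :
    ContDiffAt ℝ (⊤ : ℕ∞) (fun q : Plane => ((q.1 : ℂ) ^ n)⁻¹) q := by
  refine ContDiffAt.inv (ContDiffAt.pow ?_ n) (pow_ne_zero _ (by exact_mod_cast hq.ne'))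
  exact (Complex.ofRealCLM.contDiff.comp contDiff_fst).contDiffAt

omit hD in
lemma isTest_coord_mul {f : Space → ℝ} (hf : ContDiff ℝ (⊤ : ℕ∞) f) {Ψ : Space → ℂ}
    (hΨ : IsTest D Ψ) : IsTest D fun p => (f p : ℂ) * Ψ p :=
  hΨ.mul_left fun _ _ => (Complex.ofRealCLM.contDiff.comp hf).contDiffAt

omit hD in
lemma fderiv_coord_mul (f : Space →L[ℝ] ℝ) {Ψ : Space → ℂ} {p : Space}
    (hΨ : DifferentiableAt ℝ Ψ p) (e : Space) :
    fderiv ℝ (fun p => (f p : ℂ) * Ψ p) p e = (f e : ℂ) * Ψ p + (f p : ℂ) * fderiv ℝ Ψ p e := by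
  have h1 : HasFDerivAt (fun p => (f p : ℂ)) (Complex.ofRealCLM.comp f) p :=
    Complex.ofRealCLM.hasFDerivAt.comp p f.hasFDerivAt
  rw [(h1.fun_mul hΨ.hasFDerivAt).fderiv]
  simp only [add_apply, smul_apply, smul_eq_mul,
    ContinuousLinearMap.comp_apply, Complex.ofRealCLM_apply]
  ring

theorem isWeakDeriv_scoeff_vertical (h : IsWeakDeriv D (dir 2) u (G 2))
    (hu : Integrable u (volume.restrict D)) (hG : Integrable (G 2) (volume.restrict D)) (m : ℤ) :
    IsWeakDeriv (halfSection D) (0, 1) (scoeff m u) (scoeff m (G 2)) := by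
  refine ⟨locallyIntegrableOn_scoeff hD hu m, locallyIntegrableOn_scoeff hD hG m, fun φ hφ => ?_⟩
  -- The factor 1/r cancels the weight r of the volume element and commutes with ∂_z.
  set χ : Plane → ℂ := fun q => ((q.1 : ℂ) ^ 1)⁻¹ * φ q with hχdef
  have hχ : IsTest (halfSection D) χ := hφ.mul_left fun q hq => contDiffAt_inv_fst_pow hq.1 1
  have hΨ := isTest_slift hD hχ (-m)
  have hdχ : ∀ q : Plane, q ∈ halfSection D → (q.1 : ℂ) * fderiv ℝ χ q (0, 1) = fderiv ℝ φ q (0, 1) := by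
    intro q hq
    have hne : (q.1 : ℂ) ≠ 0 := by exact_mod_cast hq.1.ne'
    have e1 : (fun q : Plane => (q.1 : ℂ) * χ q) =ᶠ[𝓝 q] φ := by
      filter_upwards [hD.isOpen_halfSection.mem_nhds hq] with q' hq'
      have hne' : (q'.1 : ℂ) ≠ 0 := by exact_mod_cast hq'.1.ne'
      simp [hχdef, hne']
    have h1 : HasFDerivAt (fun q : Plane => (q.1 : ℂ))
        (Complex.ofRealCLM.comp (ContinuousLinearMap.fst ℝ ℝ ℝ)) q :=
      Complex.ofRealCLM.hasFDerivAt.comp q hasFDerivAt_fst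
    rw [← e1.fderiv_eq, (h1.fun_mul (hχ.smooth.differentiable (by simp) q).hasFDerivAt).fderiv]
    simp
  have key := h.integral_eq _ hΨ
  have e2 : (fun p => u p * fderiv ℝ (slift (-m) χ) p (dir 2)) =ᵐ[volume.restrict D]
      fun p => u p * slift (-m) (fun q => fderiv ℝ χ q (0, 1)) p := by
    filter_upwards [ae_exists_cyl hD] with p hp
    obtain ⟨q, hq, θ, rfl⟩ := hp
    rw [fderiv_vertical _ hq.1 (hχ.smooth.differentiable (by simp) q)
      (hΨ.smooth.differentiable (by simp) _), slift_cyl _ _ hq.1]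
  rw [integral_congr_ae e2, pairing_scoeff hD m (hΨ.integrable_mul h.right_loc),
    pairing_scoeff hD m (((hΨ.fderiv_apply (dir 2)).integrable_mul h.left_loc).congr e2),
    integral_mer_halfSection hD, integral_mer_halfSection hD] at key
  convert key using 1
  · refine setIntegral_congr_fun hD.isOpen_halfSection.measurableSet fun q hq => ?_
    have hne : (q.1 : ℂ) ≠ 0 := by exact_mod_cast hq.1.ne'
    simp only [hχdef]
    field_simp
  · congr 1
    refine setIntegral_congr_fun hD.isOpen_halfSection.measurableSet fun q hq => ?_
    simp only [← hdχ q hq]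
    ring

/-- The Cartesian derivatives ∂_x and ∂_y are tested with xΨ and yΨ, so that r times the radial part
of the gradient is paired with Ψ. Integration by parts then produces ∂_x(xΨ) + ∂_y(yΨ) = 2Ψ + r ∂_r
Ψ. -/
theorem isWeakDeriv_scoeff_radial (h : ∀ j, IsWeakDeriv D (dir j) u (G j))
    (hu : Integrable u (volume.restrict D)) (hG : ∀ j, Integrable (G j) (volume.restrict D))
    (m : ℤ) :
    IsWeakDeriv (halfSection D) (1, 0) (scoeff m u) (scoeff m (radialPart G)) := by
  refine ⟨locallyIntegrableOn_scoeff hD hu m,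
    locallyIntegrableOn_scoeff hD (integrable_radialPart hD hG) m, fun φ hφ => ?_⟩
  -- One power of 1/r cancels the weight, the other the factor r in x and y. With this choice 2χ + r
  -- ∂_r χ is exactly r⁻¹ ∂_r φ.
  set χ : Plane → ℂ := fun q => ((q.1 : ℂ) ^ 2)⁻¹ * φ q with hχdef
  have hχ : IsTest (halfSection D) χ := hφ.mul_left fun q hq => contDiffAt_inv_fst_pow hq.1 2
  have hΨ := isTest_slift hD hχ (-m)
  set Ψ := slift (-m) χ with hΨdef
  have hdχ : ∀ q : Plane, q ∈ halfSection D →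
      2 * χ q + q.1 * fderiv ℝ χ q (1, 0) = (q.1 : ℂ)⁻¹ * fderiv ℝ φ q (1, 0) := by
    intro q hq
    have hne : (q.1 : ℂ) ≠ 0 := by exact_mod_cast hq.1.ne'
    have e1 : (fun q : Plane => (q.1 : ℂ) * (q.1 * χ q)) =ᶠ[𝓝 q] φ := by
      filter_upwards [hD.isOpen_halfSection.mem_nhds hq] with q' hq'
      have hne' : (q'.1 : ℂ) ≠ 0 := by exact_mod_cast hq'.1.ne'
      simp only [hχdef]
      field_simp
    have h1 : HasFDerivAt (fun q : Plane => (q.1 : ℂ))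
        (Complex.ofRealCLM.comp (ContinuousLinearMap.fst ℝ ℝ ℝ)) q :=
      Complex.ofRealCLM.hasFDerivAt.comp q hasFDerivAt_fst
    rw [← e1.fderiv_eq,
      (h1.fun_mul (h1.fun_mul (hχ.smooth.differentiable (by simp) q).hasFDerivAt)).fderiv]
    simp
    field_simp
    ring
  set X : Space →L[ℝ] ℝ := (ContinuousLinearMap.fst ℝ ℝ ℝ).comp (ContinuousLinearMap.fst ℝ (ℝ × ℝ) ℝ)
  set Y : Space →L[ℝ] ℝ := (ContinuousLinearMap.snd ℝ ℝ ℝ).comp (ContinuousLinearMap.fst ℝ (ℝ × ℝ) ℝ)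
  have tX : IsTest D fun p => (X p : ℂ) * Ψ p := isTest_coord_mul X.contDiff hΨ
  have tY : IsTest D fun p => (Y p : ℂ) * Ψ p := isTest_coord_mul Y.contDiff hΨ
  have kX := (h 0).integral_eq _ tX
  have kY := (h 1).integral_eq _ tY
  have iX := tX.integrable_mul (h 0).right_loc
  have iY := tY.integrable_mul (h 1).right_loc
  have jX := (tX.fderiv_apply (dir 0)).integrable_mul (h 0).left_loc
  have jY := (tY.fderiv_apply (dir 1)).integrable_mul (h 1).left_loc
  have e1 : (fun p => G 0 p * ((X p : ℂ) * Ψ p) + G 1 p * ((Y p : ℂ) * Ψ p))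
      =ᵐ[volume.restrict D] fun p => radialPart G p * slift (-m) (fun q => (q.1 : ℂ) * χ q) p := by
    filter_upwards [ae_exists_cyl hD] with p hp
    obtain ⟨q, hq, θ, rfl⟩ := hp
    rw [hΨdef, radialPart_cyl _ hq.1, slift_cyl _ _ hq.1, slift_cyl _ _ hq.1]
    simp only [X, Y, cyl, ContinuousLinearMap.comp_apply, ContinuousLinearMap.coe_fst',
      ContinuousLinearMap.coe_snd']
    push_cast
    ring
  have e2 : (fun p => u p * fderiv ℝ (fun p => (X p : ℂ) * Ψ p) p (dir 0)
      + u p * fderiv ℝ (fun p => (Y p : ℂ) * Ψ p) p (dir 1))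
      =ᵐ[volume.restrict D] fun p => u p * slift (-m) (fun q => (q.1 : ℂ)⁻¹ * fderiv ℝ φ q (1, 0)) p := by
    filter_upwards [ae_exists_cyl hD] with p hp
    obtain ⟨q, hq, θ, rfl⟩ := hp
    have hd := hΨ.smooth.differentiable (by simp) (cyl (q, θ))
    rw [fderiv_coord_mul X hd, fderiv_coord_mul Y hd, slift_cyl _ _ hq.1]
    have h1 := fderiv_radial (-m) hq.1 (hχ.smooth.differentiable (by simp) q) hd
    have h2 := hdχ q hq
    have h3 : Ψ (cyl (q, θ)) = _ := slift_cyl (-m) χ hq.1 θ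
    have x0 : X (dir 0) = 1 := rfl
    have y0 : Y (dir 1) = 1 := rfl
    have x1 : X (cyl (q, θ)) = q.1 * Real.cos θ := rfl
    have y1 : Y (cyl (q, θ)) = q.1 * Real.sin θ := rfl
    rw [x0, y0, x1, y1, h3]
    rw [← hΨdef] at h1
    push_cast at h1 h2 ⊢
    linear_combination u (cyl (q, θ)) * q.1 * h1 +
      u (cyl (q, θ)) * nrm * Complex.exp (Complex.I * -m * θ) * h2
  have key : ∫ p in D, (G 0 p * ((X p : ℂ) * Ψ p) + G 1 p * ((Y p : ℂ) * Ψ p)) =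
      - ∫ p in D, (u p * fderiv ℝ (fun p => (X p : ℂ) * Ψ p) p (dir 0)
      + u p * fderiv ℝ (fun p => (Y p : ℂ) * Ψ p) p (dir 1)) := by
    rw [integral_add iX iY, integral_add jX jY, kX, kY]
    ring
  rw [integral_congr_ae e1, integral_congr_ae e2, pairing_scoeff hD m ((iX.add iY).congr e1),
    pairing_scoeff hD m ((jX.add jY).congr e2),
    integral_mer_halfSection hD, integral_mer_halfSection hD] at key
  convert key using 1
  · refine setIntegral_congr_fun hD.isOpen_halfSection.measurableSet fun q hq => ?_
    have hne : (q.1 : ℂ) ≠ 0 := by exact_mod_cast hq.1.ne'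
    simp only [hχdef]
    field_simp
  · congr 1
    refine setIntegral_congr_fun hD.isOpen_halfSection.measurableSet fun q hq => ?_
    have hne : (q.1 : ℂ) ≠ 0 := by exact_mod_cast hq.1.ne'
    field_simp

/-- Here the test functions enter through x∂_y - y∂_x. This vector field is divergence free, so no
term of order zero appears, and it acts on a mode of frequency -m as multiplication by -im. The
derivative thereby becomes an algebraic factor. -/
theorem scoeff_angularPart (h : ∀ j, IsWeakDeriv D (dir j) u (G j))
    (hu : Integrable u (volume.restrict D)) (hG : ∀ j, Integrable (G j) (volume.restrict D))
    (m : ℤ) : ∀ᵐ q ∂volume.restrict (halfSection D),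
      scoeff m (angularPart G) q = Complex.I * m / q.1 * scoeff m u q := by
  have hΩ := hD.isOpen_halfSection
  have l1 := locallyIntegrableOn_scoeff hD (integrable_angularPart hD hG) m
  have l2 := locallyIntegrableOn_scoeff hD hu m
  have hc : ContinuousOn (fun q : Plane => Complex.I * m * (q.1 : ℂ)⁻¹) (halfSection D) := by
    refine continuousOn_const.mul (ContinuousOn.inv₀ (by fun_prop) fun q hq => ?_)
    exact_mod_cast hq.1.ne'
  have l3 := l2.continuousOn_mul hc hΩ.isLocallyClosed
  refine ae_eq_of_forall_integral_mul_eq hΩ l1 (by simpa only [div_eq_mul_inv] using l3) fun φ hφ => ?_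
  set χ : Plane → ℂ := fun q => ((q.1 : ℂ) ^ 2)⁻¹ * φ q with hχdef
  have hχ : IsTest (halfSection D) χ := hφ.mul_left fun q hq => contDiffAt_inv_fst_pow hq.1 2
  have hΨ := isTest_slift hD hχ (-m)
  set Ψ := slift (-m) χ with hΨdef
  set X : Space →L[ℝ] ℝ := (ContinuousLinearMap.fst ℝ ℝ ℝ).comp (ContinuousLinearMap.fst ℝ (ℝ × ℝ) ℝ)
  set Y : Space →L[ℝ] ℝ := (ContinuousLinearMap.snd ℝ ℝ ℝ).comp (ContinuousLinearMap.fst ℝ (ℝ × ℝ) ℝ)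
  have tX : IsTest D fun p => (X p : ℂ) * Ψ p := isTest_coord_mul X.contDiff hΨ
  have tY : IsTest D fun p => (Y p : ℂ) * Ψ p := isTest_coord_mul Y.contDiff hΨ
  have kX := (h 1).integral_eq _ tX
  have kY := (h 0).integral_eq _ tY
  have iX := tX.integrable_mul (h 1).right_loc
  have iY := tY.integrable_mul (h 0).right_loc
  have jX := (tX.fderiv_apply (dir 1)).integrable_mul (h 0).left_loc
  have jY := (tY.fderiv_apply (dir 0)).integrable_mul (h 0).left_loc
  have e1 : (fun p => G 1 p * ((X p : ℂ) * Ψ p) - G 0 p * ((Y p : ℂ) * Ψ p))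
      =ᵐ[volume.restrict D] fun p => angularPart G p * slift (-m) (fun q => (q.1 : ℂ) * χ q) p := by
    filter_upwards [ae_exists_cyl hD] with p hp
    obtain ⟨q, hq, θ, rfl⟩ := hp
    rw [hΨdef, angularPart_cyl _ hq.1, slift_cyl _ _ hq.1, slift_cyl _ _ hq.1]
    simp only [X, Y, cyl, ContinuousLinearMap.comp_apply, ContinuousLinearMap.coe_fst',
      ContinuousLinearMap.coe_snd']
    push_cast
    ring
  have e2 : (fun p => u p * fderiv ℝ (fun p => (X p : ℂ) * Ψ p) p (dir 1)
      - u p * fderiv ℝ (fun p => (Y p : ℂ) * Ψ p) p (dir 0))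
      =ᵐ[volume.restrict D] fun p => u p * slift (-m) (fun q => -(Complex.I * m) * χ q) p := by
    filter_upwards [ae_exists_cyl hD] with p hp
    obtain ⟨q, hq, θ, rfl⟩ := hp
    have hd := hΨ.smooth.differentiable (by simp) (cyl (q, θ))
    rw [fderiv_coord_mul X hd, fderiv_coord_mul Y hd, slift_cyl _ _ hq.1]
    have h1 := fderiv_angular (-m) hq.1 hd
    have x0 : X (dir 1) = 0 := rfl
    have y0 : Y (dir 0) = 0 := rfl
    have x1 : X (cyl (q, θ)) = q.1 * Real.cos θ := rfl
    have y1 : Y (cyl (q, θ)) = q.1 * Real.sin θ := rfl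
    rw [x0, y0, x1, y1]
    rw [← hΨdef] at h1
    push_cast at h1 ⊢
    linear_combination u (cyl (q, θ)) * h1
  have key : ∫ p in D, (G 1 p * ((X p : ℂ) * Ψ p) - G 0 p * ((Y p : ℂ) * Ψ p)) =
      - ∫ p in D, (u p * fderiv ℝ (fun p => (X p : ℂ) * Ψ p) p (dir 1)
      - u p * fderiv ℝ (fun p => (Y p : ℂ) * Ψ p) p (dir 0)) := by
    rw [integral_sub iX iY, integral_sub jX jY, kX, kY]
    ring
  rw [integral_congr_ae e1, integral_congr_ae e2, pairing_scoeff hD m ((iX.sub iY).congr e1),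
    pairing_scoeff hD m ((jX.sub jY).congr e2),
    integral_mer_halfSection hD, integral_mer_halfSection hD, ← integral_neg] at key
  convert key using 1
  · refine setIntegral_congr_fun hΩ.measurableSet fun q hq => ?_
    have hne : (q.1 : ℂ) ≠ 0 := by exact_mod_cast hq.1.ne'
    simp only [hχdef]
    field_simp
  · refine setIntegral_congr_fun hΩ.measurableSet fun q hq => ?_
    have hne : (q.1 : ℂ) ≠ 0 := by exact_mod_cast hq.1.ne'
    simp only [hχdef]
    field_simp

end Domain

/-! ### Diagonalisation of the rotations -/

/-- The constant `1 / √2`. -/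
def rtwo : ℂ := ((√2)⁻¹ : ℝ)

/-- The unitary matrix that diagonalises all rotations about the axis. -/
def diagMat : Matrix (Fin 3) (Fin 3) ℂ :=
  !![rtwo, rtwo * Complex.I, 0; rtwo, -(rtwo * Complex.I), 0; 0, 0, 1]

/-- The inverse of `diagMat`. -/
def diagInv : Matrix (Fin 3) (Fin 3) ℂ :=
  !![rtwo, rtwo, 0; -(rtwo * Complex.I), rtwo * Complex.I, 0; 0, 0, 1]

/-- Shift of the angular frequency in the components of the eigenbasis. -/
def shift : Fin 3 → ℤ := ![1, -1, 0]

/-- The `j`-th component in the eigenbasis of a field or triple. -/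
def eigComp {X : Type*} (j : Fin 3) (v : X → Fin 3 → ℂ) : X → ℂ := fun x => (diagMat *ᵥ v x) j

/-- The field with the given components in the eigenbasis. -/
def ofEigComp {X : Type*} (w : Fin 3 → X → ℂ) : X → Fin 3 → ℂ := fun x => diagInv *ᵥ fun j => w j x

lemma exists_rtwo_eq : ∃ s : ℝ, s ^ 2 = 1 / 2 ∧ rtwo = s :=
  ⟨(√2)⁻¹, by rw [inv_pow, Real.sq_sqrt (by norm_num)]; norm_num, rfl⟩

lemma rtwo_sq : rtwo ^ 2 = 1 / 2 := by
  rw [rtwo, ← Complex.ofReal_pow, inv_pow, Real.sq_sqrt (by norm_num)]; norm_num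

lemma diagMat_mul_diagInv : diagMat * diagInv = 1 := by
  have h := rtwo_sq
  have h2 := Complex.I_sq
  ext i j
  fin_cases i <;> fin_cases j <;>
    simp [diagMat, diagInv, Matrix.mul_apply, Fin.sum_univ_three] <;>
    first
      | linear_combination (2 : ℂ) * h - (rtwo ^ 2) * h2
      | linear_combination (rtwo ^ 2) * h2

lemma diagInv_mul_diagMat : diagInv * diagMat = 1 :=
  mul_eq_one_comm.1 diagMat_mul_diagInv

lemma eigComp_ofEigComp {X : Type*} (w : Fin 3 → X → ℂ) (j : Fin 3) : eigComp j (ofEigComp w) = w j := by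
  funext x
  simp [eigComp, ofEigComp, Matrix.mulVec_mulVec, diagMat_mul_diagInv]

lemma ofEigComp_eigComp {X : Type*} (v : X → Fin 3 → ℂ) : ofEigComp (fun j => eigComp j v) = v := by
  funext x
  have : (fun j => eigComp j v x) = diagMat *ᵥ v x := rfl
  simp only [ofEigComp, this, Matrix.mulVec_mulVec, diagInv_mul_diagMat, Matrix.one_mulVec]

lemma eigComp_apply {X : Type*} (j : Fin 3) (v : X → Fin 3 → ℂ) (x : X) :
    eigComp j v x = ∑ i, diagMat j i * v x i := rfl

lemma ofEigComp_apply {X : Type*} (w : Fin 3 → X → ℂ) (x : X) (i : Fin 3) :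
    ofEigComp w x i = ∑ j, diagInv i j * w j x := rfl

lemma eigComp_add {X : Type*} (j : Fin 3) (v w : X → Fin 3 → ℂ) :
    eigComp j (v + w) = eigComp j v + eigComp j w := by
  funext x; simp [eigComp, Matrix.mulVec_add]

lemma eigComp_sub {X : Type*} (j : Fin 3) (v w : X → Fin 3 → ℂ) :
    eigComp j (v - w) = eigComp j v - eigComp j w := by
  funext x; simp [eigComp, Matrix.mulVec_sub]

lemma eigComp_smul {X : Type*} (j : Fin 3) (c : ℂ) (v : X → Fin 3 → ℂ) :
    eigComp j (c • v) = c • eigComp j v := by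
  funext x; simp [eigComp, Matrix.mulVec_smul]

lemma sum_norm_diagMat (x : Fin 3 → ℂ) : ∑ j, ‖(diagMat *ᵥ x) j‖ ^ 2 = ∑ i, ‖x i‖ ^ 2 := by
  obtain ⟨s, h, hs⟩ := exists_rtwo_eq
  simp only [Fin.sum_univ_three, Matrix.mulVec, dotProduct, diagMat, hs]
  simp only [← Complex.normSq_eq_norm_sq, Complex.normSq_apply]
  simp
  linear_combination (2 * ((x 0).re ^ 2 + (x 0).im ^ 2 + (x 1).re ^ 2 + (x 1).im ^ 2)) * h

lemma ofReal_norm_sq (z : ℂ) : ENNReal.ofReal (‖z‖ ^ 2) = ‖z‖ₑ ^ 2 := by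
  rw [ENNReal.ofReal_pow (norm_nonneg _), ofReal_norm]

lemma sum_enorm_eigComp {X : Type*} (v : X → Fin 3 → ℂ) (x : X) :
    ∑ j, ‖eigComp j v x‖ₑ ^ 2 = ∑ i, ‖v x i‖ₑ ^ 2 := by
  simp only [← ofReal_norm_sq]
  rw [← ENNReal.ofReal_sum_of_nonneg (fun _ _ => by positivity),
    ← ENNReal.ofReal_sum_of_nonneg (fun _ _ => by positivity)]
  congr 1
  exact sum_norm_diagMat (v x)

/-- The rows of `diagMat` are left eigenvectors common to all rotations; `shift` records the
exponents of the eigenvalues e^{iα}, e^{-iα}, 1. -/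
lemma diagMat_mulVec_rotMat (α : ℝ) (x : Fin 3 → ℂ) (j : Fin 3) :
    (diagMat *ᵥ (rotMat α *ᵥ x)) j = Complex.exp (Complex.I * shift j * α) * (diagMat *ᵥ x) j := by
  have h1 : Complex.exp (Complex.I * α) = Complex.cos α + Complex.sin α * Complex.I := by
    rw [mul_comm, Complex.exp_mul_I]
  have h2 : Complex.exp (-(Complex.I * α)) = Complex.cos α - Complex.sin α * Complex.I := by
    rw [mul_comm, ← neg_mul, Complex.exp_mul_I, Complex.cos_neg, Complex.sin_neg]; ring
  have hI := Complex.I_sq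
  fin_cases j <;>
    simp [diagMat, rotMat, shift, Matrix.mulVec, dotProduct, Fin.sum_univ_three, h1, h2]
  · linear_combination (-rtwo * Complex.sin α * x 1) * hI
  · linear_combination (-rtwo * Complex.sin α * x 1) * hI

/-- Completing squares: up to the factor 1/r², the terms of order zero in v_r and v_θ, cross terms
included, equal ½(k+1)²|v_r + i v_θ|² + ½(k-1)²|v_r - i v_θ|². This decouples the components and
shows that the density is nonnegative. -/
lemma modeDensity_eq (k : ℤ) (r : ℝ) (v a b : Fin 3 → ℂ) :
    modeDensity k r v a b = ∑ j, (‖(diagMat *ᵥ a) j‖ ^ 2 + ‖(diagMat *ᵥ b) j‖ ^ 2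
      + ((k + shift j : ℤ) : ℝ) ^ 2 / r ^ 2 * ‖(diagMat *ᵥ v) j‖ ^ 2) := by
  rw [Finset.sum_add_distrib, Finset.sum_add_distrib, sum_norm_diagMat, sum_norm_diagMat]
  obtain ⟨s, h, hs⟩ := exists_rtwo_eq
  have hre : (2 * Complex.I * k / (r : ℂ) ^ 2 * v 1 * conj (v 0)
      - 2 * Complex.I * k / (r : ℂ) ^ 2 * v 0 * conj (v 1)).re =
      (k / r ^ 2) * (4 * ((v 1).re * (v 0).im - (v 1).im * (v 0).re)) := by
    have e : (2 * Complex.I * k / (r : ℂ) ^ 2 * v 1 * conj (v 0)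
      - 2 * Complex.I * k / (r : ℂ) ^ 2 * v 0 * conj (v 1)) =
      ((k / r ^ 2 : ℝ) : ℂ) * (2 * Complex.I * (v 1 * conj (v 0) - v 0 * conj (v 1))) := by
      push_cast; ring
    rw [e, Complex.re_ofReal_mul]
    simp
    ring
  rw [modeDensity, hre]
  simp only [Fin.sum_univ_three, Matrix.mulVec, dotProduct, diagMat, hs, shift]
  simp only [← Complex.normSq_eq_norm_sq, Complex.normSq_apply]
  simp
  simp only [div_eq_mul_inv]
  set t := (r ^ 2)⁻¹
  linear_combination (-2 * t * ((k + 1) ^ 2 * 2⁻¹ * (((v 0).re - (v 1).im) ^ 2 + ((v 0).im + (v 1).re) ^ 2)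
    + (k - 1) ^ 2 * 2⁻¹ * (((v 0).re + (v 1).im) ^ 2 + ((v 0).im - (v 1).re) ^ 2))) * h

/-! ### Evaluation of the norms -/

lemma rpow_half_sq (x : ℝ≥0∞) : (x ^ (1 / 2 : ℝ)) ^ 2 = x := by
  rw [← ENNReal.rpow_natCast, ← ENNReal.rpow_mul]; norm_num

lemma sq_rpow_half (x : ℝ≥0∞) : (x ^ 2) ^ (1 / 2 : ℝ) = x := by
  rw [← ENNReal.rpow_natCast, ← ENNReal.rpow_mul]; norm_num

lemma lintegral_enorm_sq_congr {X : Type*} [MeasurableSpace X] {μ : Measure X} {f g : X → ℂ}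
    (h : f =ᵐ[μ] g) : ∫⁻ x, ‖f x‖ₑ ^ 2 ∂μ = ∫⁻ x, ‖g x‖ₑ ^ 2 ∂μ := by
  refine lintegral_congr_ae ?_
  filter_upwards [h] with x hx
  rw [hx]

/-- Weak derivatives are unique up to null sets, so every competitor in the infimum has the same
value and any one of them may be used. -/
lemma h1Norm_sq_eq {D : Set Space} (hD : IsOpen D) {v : Field3} {G : Fin 3 → Fin 3 → Space → ℂ}
    (h : IsWeakGrad D v G) : h1Norm D v ^ 2 =
      (∑ i, ∫⁻ p in D, ‖v p i‖ₑ ^ 2) + ∑ i, ∑ j, ∫⁻ p in D, ‖G i j p‖ₑ ^ 2 := by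
  rw [h1Norm, ← rpow_half_sq (_ + _)]
  congr 1
  refine le_antisymm (iInf₂_le G h) (le_iInf₂ fun G' h' => le_of_eq ?_)
  congr 2
  refine Finset.sum_congr rfl fun i _ => Finset.sum_congr rfl fun j _ =>
    lintegral_enorm_sq_congr ((h i j).unique hD (h' i j) (ae_eq_refl _))

lemma h1Seminorm_sq_eq {D : Set Space} (hD : IsOpen D) {v : Field3}
    {G : Fin 3 → Fin 3 → Space → ℂ} (h : IsWeakGrad D v G) :
    h1Seminorm D v ^ 2 = ∑ i, ∑ j, ∫⁻ p in D, ‖G i j p‖ₑ ^ 2 := by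
  rw [h1Seminorm, ← rpow_half_sq (Finset.sum _ _)]
  congr 1
  refine le_antisymm (iInf₂_le G h) (le_iInf₂ fun G' h' => le_of_eq ?_)
  congr 1
  refine Finset.sum_congr rfl fun i _ => Finset.sum_congr rfl fun j _ =>
    lintegral_enorm_sq_congr ((h i j).unique hD (h' i j) (ae_eq_refl _))

lemma h11Norm_sq_eq {Ω : Set Plane} (hΩ : IsOpen Ω) {u a b : Plane → ℂ}
    (ha : IsWeakDeriv Ω (1, 0) u a) (hb : IsWeakDeriv Ω (0, 1) u b) :
    h11Norm Ω u ^ 2 = ∫⁻ q, (‖u q‖ₑ ^ 2 + ‖a q‖ₑ ^ 2 + ‖b q‖ₑ ^ 2) ∂mer Ω := by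
  rw [h11Norm, ← rpow_half_sq (lintegral _ _), lintegral_mer]
  congr 1
  refine le_antisymm (iInf₂_le_of_le a b (iInf₂_le ha hb))
    (le_iInf₂ fun a' b' => le_iInf₂ fun ha' hb' => le_of_eq ?_)
  congr 1
  refine lintegral_congr_ae ?_
  filter_upwards [ha.unique hΩ ha' (ae_eq_refl _), hb.unique hΩ hb' (ae_eq_refl _)] with q h1 h2
  rw [h1, h2]

/-- The squared norm without the part of order zero of the scalar mode of frequency `m`. -/
def modeEnergy (Ω : Set Plane) (m : ℤ) (w a b : Plane → ℂ) : ℝ≥0∞ :=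
  ∫⁻ q, (‖a q‖ₑ ^ 2 + ‖b q‖ₑ ^ 2 + ENNReal.ofReal ((m : ℝ) ^ 2 / q.1 ^ 2) * ‖w q‖ₑ ^ 2) ∂mer Ω

lemma modeEnergy_congr {Ω : Set Plane} {m : ℤ} {w w' a a' b b' : Plane → ℂ}
    (hw : w =ᵐ[mer Ω] w') (ha : a =ᵐ[mer Ω] a') (hb : b =ᵐ[mer Ω] b') :
    modeEnergy Ω m w a b = modeEnergy Ω m w' a' b' := by
  refine lintegral_congr_ae ?_
  filter_upwards [hw, ha, hb] with q h1 h2 h3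
  rw [h1, h2, h3]

lemma ofReal_modeDensity (k : ℤ) (v a b : Triple) (q : Plane) :
    ENNReal.ofReal (modeDensity k q.1 (v q) (a q) (b q)) =
      ∑ j, (‖eigComp j a q‖ₑ ^ 2 + ‖eigComp j b q‖ₑ ^ 2 +
        ENNReal.ofReal (((k + shift j : ℤ) : ℝ) ^ 2 / q.1 ^ 2) * ‖eigComp j v q‖ₑ ^ 2) := by
  rw [modeDensity_eq, ENNReal.ofReal_sum_of_nonneg (fun _ _ => by positivity)]
  refine Finset.sum_congr rfl fun j _ => ?_
  rw [ENNReal.ofReal_add (by positivity) (by positivity), ENNReal.ofReal_add (by positivity)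
    (by positivity), ENNReal.ofReal_mul (by positivity), ofReal_norm_sq, ofReal_norm_sq,
    ofReal_norm_sq]
  rfl

lemma modeDensity_nonneg (k : ℤ) (r : ℝ) (v a b : Fin 3 → ℂ) : 0 ≤ modeDensity k r v a b := by
  rw [modeDensity_eq]
  positivity

section Partials

variable {Ω : Set Plane} (hΩ : IsOpen Ω) (hpos : ∀ q ∈ Ω, 0 < q.1) {k : ℤ} {v a b : Triple}

include hΩ hpos

lemma IsWeakDeriv.aesm_mer {e : Plane} {u g : Plane → ℂ} (h : IsWeakDeriv Ω e u g) :
    AEStronglyMeasurable u (mer Ω) ∧ AEStronglyMeasurable g (mer Ω) :=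
  ⟨h.left_loc.aestronglyMeasurable.mono_ac (withDensity_absolutelyContinuous _ _),
    h.right_loc.aestronglyMeasurable.mono_ac (withDensity_absolutelyContinuous _ _)⟩

omit hΩ hpos in
lemma aesm_eigComp {X : Type*} [MeasurableSpace X] {μ : Measure X} {v : X → Fin 3 → ℂ}
    (h : ∀ i, AEStronglyMeasurable (fun x => v x i) μ) (j : Fin 3) :
    AEStronglyMeasurable (eigComp j v) μ := by
  have : eigComp j v = fun x => ∑ i, diagMat j i * v x i := rfl
  rw [this]
  exact Finset.aestronglyMeasurable_fun_sum _ fun i _ => (h i).const_mul _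

lemma IsWeakPartials.aesm (h : IsWeakPartials Ω v a b) :
    (∀ i, AEStronglyMeasurable (fun x => v x i) (mer Ω)) ∧
    (∀ i, AEStronglyMeasurable (fun x => a x i) (mer Ω)) ∧
    (∀ i, AEStronglyMeasurable (fun x => b x i) (mer Ω)) :=
  ⟨fun i => ((h i).1.aesm_mer hΩ hpos).1, fun i => ((h i).1.aesm_mer hΩ hpos).2,
    fun i => ((h i).2.aesm_mer hΩ hpos).2⟩

omit hpos in
lemma IsWeakPartials.unique {v' a' b' : Triple} (h : IsWeakPartials Ω v a b)
    (h' : IsWeakPartials Ω v' a' b') (hv : v =ᵐ[volume.restrict Ω] v') :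
    a =ᵐ[volume.restrict Ω] a' ∧ b =ᵐ[volume.restrict Ω] b' := by
  have hvi : ∀ i, (fun q => v q i) =ᵐ[volume.restrict Ω] fun q => v' q i := fun i => by
    filter_upwards [hv] with q hq
    rw [hq]
  have h1 := fun i => (h i).1.unique hΩ (h' i).1 (hvi i)
  have h2 := fun i => (h i).2.unique hΩ (h' i).2 (hvi i)
  constructor
  · filter_upwards [ae_all_iff.2 h1] with q hq using funext hq
  · filter_upwards [ae_all_iff.2 h2] with q hq using funext hq

lemma measurable_weight (m : ℤ) :
    Measurable fun q : Plane => ENNReal.ofReal ((m : ℝ) ^ 2 / q.1 ^ 2) := by fun_prop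

lemma lintegral_modeDensity (h : IsWeakPartials Ω v a b) :
    ∫⁻ q in Ω, ENNReal.ofReal (modeDensity k q.1 (v q) (a q) (b q) * q.1) =
      ∑ j, modeEnergy Ω (k + shift j) (eigComp j v) (eigComp j a) (eigComp j b) := by
  obtain ⟨hv, ha, hb⟩ := h.aesm hΩ hpos
  simp_rw [ENNReal.ofReal_mul (modeDensity_nonneg _ _ _ _ _), ofReal_modeDensity]
  rw [← lintegral_mer, lintegral_finsetSum']
  · rfl
  · intro j _
    exact (((aesm_eigComp ha j).enorm.pow_const 2).add ((aesm_eigComp hb j).enorm.pow_const 2)).add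
      ((measurable_weight hΩ hpos _).aemeasurable.mul ((aesm_eigComp hv j).enorm.pow_const 2))

lemma h1kSeminorm_sq_eq (h : IsWeakPartials Ω v a b) :
    h1kSeminorm Ω k v ^ 2 =
      ∑ j, modeEnergy Ω (k + shift j) (eigComp j v) (eigComp j a) (eigComp j b) := by
  rw [h1kSeminorm, ← rpow_half_sq (Finset.sum _ _), ← lintegral_modeDensity hΩ hpos h]
  congr 1
  refine le_antisymm (iInf₂_le_of_le a b (iInf_le _ h))
    (le_iInf₂ fun a' b' => le_iInf fun h' => le_of_eq ?_)
  congr 1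
  refine lintegral_congr_ae ?_
  obtain ⟨h1, h2⟩ := h.unique hΩ h' (ae_eq_refl _)
  filter_upwards [h1, h2] with q h1 h2
  rw [h1, h2]

lemma h1kNorm_sq_eq (h : IsWeakPartials Ω v a b) :
    h1kNorm Ω k v ^ 2 = (∑ j, ∫⁻ q, ‖eigComp j v q‖ₑ ^ 2 ∂mer Ω) +
      ∑ j, modeEnergy Ω (k + shift j) (eigComp j v) (eigComp j a) (eigComp j b) := by
  obtain ⟨hv, ha, hb⟩ := h.aesm hΩ hpos
  have key : ∫⁻ q in Ω, ENNReal.ofReal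
      (((∑ i, ‖v q i‖ ^ 2) + modeDensity k q.1 (v q) (a q) (b q)) * q.1) =
      (∑ j, ∫⁻ q, ‖eigComp j v q‖ₑ ^ 2 ∂mer Ω) +
      ∑ j, modeEnergy Ω (k + shift j) (eigComp j v) (eigComp j a) (eigComp j b) := by
    rw [← lintegral_modeDensity hΩ hpos h, ← lintegral_finsetSum'
      (f := fun j q => ‖eigComp j v q‖ₑ ^ 2) _ fun j _ => (aesm_eigComp hv j).enorm.pow_const 2,
      lintegral_mer, ← lintegral_add_left']
    · refine setLIntegral_congr_fun hΩ.measurableSet fun q hq => ?_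
      have h0 : 0 ≤ ∑ i, ‖v q i‖ ^ 2 := Finset.sum_nonneg fun _ _ => by positivity
      have h1 := modeDensity_nonneg k q.1 (v q) (a q) (b q)
      simp only [sum_enorm_eigComp]
      rw [ENNReal.ofReal_mul (add_nonneg h0 h1), ENNReal.ofReal_add h0 h1, add_mul,
        ENNReal.ofReal_mul h1, ENNReal.ofReal_sum_of_nonneg (fun _ _ => by positivity)]
      simp only [ofReal_norm_sq]
    · refine AEMeasurable.mul ?_ measurable_fst.ennreal_ofReal.aemeasurable
      refine Finset.aemeasurable_fun_sum _ fun j _ => AEMeasurable.pow_const ?_ 2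
      refine (aesm_eigComp (μ := volume.restrict Ω) (fun i => ?_) j).enorm
      exact (h i).1.left_loc.aestronglyMeasurable
  rw [h1kNorm, ← rpow_half_sq (_ + _), ← key]
  congr 1
  refine le_antisymm (iInf₂_le_of_le a b (iInf_le _ h))
    (le_iInf₂ fun a' b' => le_iInf fun h' => le_of_eq ?_)
  congr 1
  refine lintegral_congr_ae ?_
  obtain ⟨h1, h2⟩ := h.unique hΩ h' (ae_eq_refl _)
  filter_upwards [h1, h2] with q h1 h2
  rw [h1, h2]

omit hΩ hpos in
lemma isWeakPartials_ofEigComp {w a b : Fin 3 → Plane → ℂ}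
    (h1 : ∀ j, IsWeakDeriv Ω (1, 0) (w j) (a j)) (h2 : ∀ j, IsWeakDeriv Ω (0, 1) (w j) (b j)) :
    IsWeakPartials Ω (ofEigComp w) (ofEigComp a) (ofEigComp b) := fun i =>
  ⟨IsWeakDeriv.sum (s := Finset.univ) (u := fun j q => diagInv i j * w j q)
      (g := fun j q => diagInv i j * a j q) fun j _ => (h1 j).const_mul _,
    IsWeakDeriv.sum (s := Finset.univ) (u := fun j q => diagInv i j * w j q)
      (g := fun j q => diagInv i j * b j q) fun j _ => (h2 j).const_mul _⟩

omit hΩ hpos in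
lemma IsWeakPartials.congr {v' : Triple} (h : IsWeakPartials Ω v a b)
    (hv : v =ᵐ[volume.restrict Ω] v') : IsWeakPartials Ω v' a b := fun i => by
  have : (fun q => v q i) =ᵐ[volume.restrict Ω] fun q => v' q i := by
    filter_upwards [hv] with q hq
    rw [hq]
  exact ⟨(h i).1.congr this (ae_eq_refl _), (h i).2.congr this (ae_eq_refl _)⟩

end Partials

/-! ### Parseval's identity for vector fields -/

section Domain

variable {D : Set Space} (hD : IsAxisymmetricDomain D)

include hD

/-- Parseval for the radial, angular and vertical parts of the gradient separately. The coefficients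
of the angular part supply the weight m²/r², and the pointwise rotation from (∂_x, ∂_y) to the
radial and angular directions is an isometry. -/
theorem tsum_modeEnergy_scoeff {u : Space → ℂ} {G : Fin 3 → Space → ℂ}
    (h : ∀ j, IsWeakDeriv D (dir j) u (G j)) (hu2 : ∫⁻ p in D, ‖u p‖ₑ ^ 2 < ⊤)
    (hG2 : ∀ j, ∫⁻ p in D, ‖G j p‖ₑ ^ 2 < ⊤) :
    ∑' m, modeEnergy (halfSection D) m (scoeff m u) (scoeff m (radialPart G)) (scoeff m (G 2)) =
      ∑ j, ∫⁻ p in D, ‖G j p‖ₑ ^ 2 := by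
  have hum : AEStronglyMeasurable u (volume.restrict D) := (h 0).left_loc.aestronglyMeasurable
  have hGm : ∀ j, AEStronglyMeasurable (G j) (volume.restrict D) := fun j =>
    (h j).right_loc.aestronglyMeasurable
  have hui := integrable_of_sq hD hum hu2
  have hGi := fun j => integrable_of_sq hD (hGm j) (hG2 j)
  have hrm := aesm_radialPart hGm
  have ham := aesm_angularPart hGm
  have hsum : (∫⁻ p in D, ‖radialPart G p‖ₑ ^ 2) + ∫⁻ p in D, ‖angularPart G p‖ₑ ^ 2 =
      (∫⁻ p in D, ‖G 0 p‖ₑ ^ 2) + ∫⁻ p in D, ‖G 1 p‖ₑ ^ 2 := by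
    rw [← lintegral_add_left' (hrm.enorm.pow_const 2),
      ← lintegral_add_left' ((hGm 0).enorm.pow_const 2)]
    exact lintegral_congr_ae (ae_enorm_radial_angular hD G)
  have hfin : (∫⁻ p in D, ‖radialPart G p‖ₑ ^ 2) + ∫⁻ p in D, ‖angularPart G p‖ₑ ^ 2 < ⊤ := by
    rw [hsum]; exact ENNReal.add_lt_top.2 ⟨hG2 0, hG2 1⟩
  have hr2 := (ENNReal.add_lt_top.1 hfin).1
  have ha2 := (ENNReal.add_lt_top.1 hfin).2
  have hE : ∀ m, modeEnergy (halfSection D) m (scoeff m u) (scoeff m (radialPart G)) (scoeff m (G 2))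
      = (∫⁻ q, ‖scoeff m (radialPart G) q‖ₑ ^ 2 ∂mer (halfSection D)) +
        (∫⁻ q, ‖scoeff m (G 2) q‖ₑ ^ 2 ∂mer (halfSection D)) +
        ∫⁻ q, ‖scoeff m (angularPart G) q‖ₑ ^ 2 ∂mer (halfSection D) := by
    intro m
    have m1 := (aesm_scoeff hD hrm m).enorm.pow_const 2
    have m2 := (aesm_scoeff hD (hGm 2) m).enorm.pow_const 2
    have m12 : AEMeasurable (fun q => ‖scoeff m (radialPart G) q‖ₑ ^ 2 + ‖scoeff m (G 2) q‖ₑ ^ 2)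
      (mer (halfSection D)) := m1.add m2
    rw [← lintegral_add_left' m1, ← lintegral_add_left' m12, modeEnergy]
    refine lintegral_congr_ae ?_
    have hae := (ae_mer_iff hD.isOpen_halfSection.measurableSet (fun _ h => h.1)).2
      (scoeff_angularPart hD h hui hGi m)
    filter_upwards [hae, ae_mer_mem hD.isOpen_halfSection.measurableSet (fun _ h => h.1)] with q hq hq2
    rw [hq, enorm_mul, mul_pow]
    congr 2
    rw [← ofReal_norm_sq]
    congr 1
    rw [norm_div, norm_mul, Complex.norm_I, one_mul, Complex.norm_intCast, Complex.norm_real,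
      div_pow, Real.norm_eq_abs, sq_abs, sq_abs]
  simp_rw [hE]
  rw [ENNReal.tsum_add, ENNReal.tsum_add, parseval_scoeff hD hrm hr2,
    parseval_scoeff hD ham ha2, parseval_scoeff hD (hGm 2) (hG2 2), Fin.sum_univ_three, ← hsum]
  ring

/-- In the eigenbasis, the factor R_{-θ} in `coeff` is multiplication by e^{-i shift(j) θ}, which
merges with e^{-ikθ}. -/
lemma eigComp_coeff_of_integrable {v : Field3} {q : Plane}
    (hv : ∀ i, Integrable (fun θ => v (cyl (q, θ)) i) ang) (k : ℤ) (j : Fin 3) :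
    eigComp j (coeff k v) q = scoeff (k + shift j) (eigComp j v) q := by
  have hint : ∀ i, Integrable (fun θ : ℝ => (rotMat (-θ) *ᵥ v (cyl (q, θ))) i
      * Complex.exp (-(Complex.I * k * θ))) ang := by
    intro i
    have hR : ∀ i i', ∃ C, ∀ θ : ℝ, ‖rotMat (-θ) i i'‖ ≤ C := by
      intro i i'
      refine ⟨1, fun θ => ?_⟩
      fin_cases i <;> fin_cases i' <;>
        simp [rotMat, Real.abs_cos_le_one,
          Real.abs_sin_le_one, -Complex.ofReal_cos, -Complex.ofReal_sin]
    have hRm : ∀ i i', Continuous fun θ : ℝ => rotMat (-θ) i i' := by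
      intro i i'
      fin_cases i <;> fin_cases i' <;> simp [rotMat] <;> fun_prop
    have h1 : Integrable (fun θ : ℝ => (rotMat (-θ) *ᵥ v (cyl (q, θ))) i) ang := by
      have : (fun θ : ℝ => (rotMat (-θ) *ᵥ v (cyl (q, θ))) i) =
          fun θ => ∑ i', rotMat (-θ) i i' * v (cyl (q, θ)) i' := rfl
      rw [this]
      refine integrable_finsetSum _ fun i' _ => ?_
      obtain ⟨C, hC⟩ := hR i i'
      exact (hv i').bdd_mul (hRm i i').aestronglyMeasurable (ae_of_all _ hC)
    exact h1.mul_bdd (c := 1) (continuous_exp_neg k).aestronglyMeasurable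
      (ae_of_all _ fun θ => (norm_exp_neg_I k θ).le)
  have hc : ∀ i, coeff k v q i = nrm * ∫ θ, (rotMat (-θ) *ᵥ v (cyl (q, θ))) i
      * Complex.exp (-(Complex.I * k * θ)) ∂ang := by
    intro i
    rw [coeff, intervalIntegral.integral_of_le (by linarith [Real.pi_pos])]
    rfl
  rw [eigComp_apply, scoeff, angCoeff]
  simp_rw [hc]
  calc ∑ i, diagMat j i * (nrm * ∫ θ, (rotMat (-θ) *ᵥ v (cyl (q, θ))) i
      * Complex.exp (-(Complex.I * k * θ)) ∂ang)
      = nrm * ∑ i, ∫ θ, diagMat j i * ((rotMat (-θ) *ᵥ v (cyl (q, θ))) i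
      * Complex.exp (-(Complex.I * k * θ))) ∂ang := by
        rw [Finset.mul_sum]
        refine Finset.sum_congr rfl fun i _ => ?_
        rw [integral_const_mul]
        ring
    _ = nrm * ∫ θ, ∑ i, diagMat j i * ((rotMat (-θ) *ᵥ v (cyl (q, θ))) i
      * Complex.exp (-(Complex.I * k * θ))) ∂ang := by
        rw [integral_finsetSum _ fun i _ => (hint i).const_mul _]
    _ = _ := by
        congr 1
        refine integral_congr_ae (ae_of_all _ fun θ => ?_)
        have h1 : ∑ i, diagMat j i * ((rotMat (-θ) *ᵥ v (cyl (q, θ))) i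
            * Complex.exp (-(Complex.I * k * θ))) =
            (diagMat *ᵥ (rotMat (-θ) *ᵥ v (cyl (q, θ)))) j * Complex.exp (-(Complex.I * k * θ)) := by
          rw [Matrix.mulVec, dotProduct, Finset.sum_mul]
          simp_rw [mul_assoc]
        simp only
        rw [h1, diagMat_mulVec_rotMat, eigComp, mul_right_comm, mul_comm, ← Complex.exp_add]
        congr 2
        push_cast
        ring

lemma eigComp_coeff {v : Field3} (hv : ∀ i, Integrable (fun p => v p i) (volume.restrict D))
    (k : ℤ) (j : Fin 3) :
    eigComp j (coeff k v) =ᵐ[mer (halfSection D)] scoeff (k + shift j) (eigComp j v) := by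
  filter_upwards [ae_all_iff.2 fun i => ae_integrable_comp_cyl hD (hv i)] with q hq
  exact eigComp_coeff_of_integrable hD hq k j

/-- The gradients of the components in the eigenbasis. -/
def eigGrad (G : Fin 3 → Fin 3 → Space → ℂ) (j : Fin 3) (d : Fin 3) : Space → ℂ :=
  eigComp j fun p i => G i d p

omit hD in
lemma IsWeakGrad.eigComp {v : Field3} {G : Fin 3 → Fin 3 → Space → ℂ} (h : IsWeakGrad D v G)
    (j d : Fin 3) : IsWeakDeriv D (dir d) (eigComp j v) (eigGrad G j d) :=
  IsWeakDeriv.sum (s := Finset.univ) (u := fun i q => diagMat j i * v q i)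
    (g := fun i q => diagMat j i * G i d q) fun i _ => (h i d).const_mul _

omit hD in
lemma mem_H1_iff {v : Field3} (hO : IsOpen D) : v ∈ H1 D ↔ ∃ G, IsWeakGrad D v G ∧
    (∀ i, ∫⁻ p in D, ‖v p i‖ₑ ^ 2 < ⊤) ∧ ∀ i j, ∫⁻ p in D, ‖G i j p‖ₑ ^ 2 < ⊤ := by
  have key : ∀ G : Fin 3 → Fin 3 → Space → ℂ,
      ((∑ i, ∫⁻ p in D, ‖v p i‖ₑ ^ 2) + ∑ i, ∑ j, ∫⁻ p in D, ‖G i j p‖ₑ ^ 2 < ⊤ ↔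
      (∀ i, ∫⁻ p in D, ‖v p i‖ₑ ^ 2 < ⊤) ∧ ∀ i j, ∫⁻ p in D, ‖G i j p‖ₑ ^ 2 < ⊤) := by
    intro G
    simp [ENNReal.add_lt_top, ENNReal.sum_lt_top]
  constructor
  · intro hv
    have hv' : h1Norm D v < ⊤ := hv
    obtain ⟨G, hG⟩ := iInf_lt_iff.1 hv'
    obtain ⟨hG, h2⟩ := iInf_lt_iff.1 hG
    refine ⟨G, hG, (key G).1 ?_⟩
    rw [ENNReal.rpow_lt_top_iff_of_pos (by norm_num)] at h2
    exact h2
  · rintro ⟨G, hG, h⟩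
    have h2 := (key G).2 h
    rw [← h1Norm_sq_eq hO hG] at h2
    change h1Norm D v < ⊤
    exact (ENNReal.pow_lt_top_iff.1 h2).resolve_right (by norm_num)

omit hD in
lemma lintegral_sum_eigComp {X : Type*} [MeasurableSpace X] {μ : Measure X} {v : X → Fin 3 → ℂ}
    (h : ∀ i, AEStronglyMeasurable (fun x => v x i) μ) :
    ∑ j, ∫⁻ x, ‖eigComp j v x‖ₑ ^ 2 ∂μ = ∑ i, ∫⁻ x, ‖v x i‖ₑ ^ 2 ∂μ := by
  rw [← lintegral_finsetSum' _ fun j _ => (aesm_eigComp h j).enorm.pow_const 2,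
    ← lintegral_finsetSum' _ fun i _ => (h i).enorm.pow_const 2]
  simp_rw [sum_enorm_eigComp]

omit hD in
lemma lintegral_eigComp_lt_top {X : Type*} [MeasurableSpace X] {μ : Measure X} {v : X → Fin 3 → ℂ}
    (h : ∀ i, AEStronglyMeasurable (fun x => v x i) μ) (h2 : ∀ i, ∫⁻ x, ‖v x i‖ₑ ^ 2 ∂μ < ⊤)
    (j : Fin 3) : ∫⁻ x, ‖eigComp j v x‖ₑ ^ 2 ∂μ < ⊤ := by
  refine lt_of_le_of_lt ?_ (ENNReal.sum_lt_top.2 fun i _ => h2 i :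
    ∑ i, ∫⁻ x, ‖v x i‖ₑ ^ 2 ∂μ < ⊤)
  rw [← lintegral_sum_eigComp h]
  exact Finset.single_le_sum (f := fun j => ∫⁻ x, ‖eigComp j v x‖ₑ ^ 2 ∂μ)
    (fun _ _ => zero_le) (Finset.mem_univ j)

omit hD in
lemma IsWeakGrad.aesm {v : Field3} {G : Fin 3 → Fin 3 → Space → ℂ} (h : IsWeakGrad D v G) :
    (∀ i, AEStronglyMeasurable (fun p => v p i) (volume.restrict D)) ∧
    ∀ i j, AEStronglyMeasurable (G i j) (volume.restrict D) :=
  ⟨fun i => (h i 0).left_loc.aestronglyMeasurable, fun i j => (h i j).right_loc.aestronglyMeasurable⟩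

section Grad

variable {v : Field3} {G : Fin 3 → Fin 3 → Space → ℂ} (h : IsWeakGrad D v G)
  (hv2 : ∀ i, ∫⁻ p in D, ‖v p i‖ₑ ^ 2 < ⊤) (hG2 : ∀ i j, ∫⁻ p in D, ‖G i j p‖ₑ ^ 2 < ⊤)

include h hv2 hG2

theorem isWeakPartials_coeff (k : ℤ) : IsWeakPartials (halfSection D) (coeff k v)
    (ofEigComp fun j => scoeff (k + shift j) (radialPart (eigGrad G j)))
    (ofEigComp fun j => scoeff (k + shift j) (eigGrad G j 2)) := by
  obtain ⟨hvm, hGm⟩ := h.aesm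
  have hvi : ∀ i, Integrable (fun p => v p i) (volume.restrict D) := fun i =>
    integrable_of_sq hD (hvm i) (hv2 i)
  have hei : ∀ j, Integrable (eigComp j v) (volume.restrict D) := fun j =>
    integrable_of_sq hD (aesm_eigComp hvm j) (lintegral_eigComp_lt_top hvm hv2 j)
  have hgi : ∀ j d, Integrable (eigGrad G j d) (volume.restrict D) := fun j d =>
    integrable_of_sq hD (aesm_eigComp (fun i => hGm i d) j)
      (lintegral_eigComp_lt_top (fun i => hGm i d) (fun i => hG2 i d) j)
  have h1 := isWeakPartials_ofEigComp
    (fun j => isWeakDeriv_scoeff_radial hD (h.eigComp j) (hei j) (hgi j) (k + shift j))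
    (fun j => isWeakDeriv_scoeff_vertical hD (h.eigComp j 2) (hei j) (hgi j 2) (k + shift j))
  refine h1.congr ?_
  have h2 := fun j => eigComp_coeff hD hvi k j
  simp_rw [EventuallyEq, ae_mer_iff hD.isOpen_halfSection.measurableSet (fun _ h => h.1)] at h2
  filter_upwards [ae_all_iff.2 h2] with q hq
  rw [← ofEigComp_eigComp (coeff k v)]
  simp only [ofEigComp, hq]

lemma h1kSeminorm_coeff_sq (k : ℤ) : h1kSeminorm (halfSection D) k (coeff k v) ^ 2 =
    ∑ j, modeEnergy (halfSection D) (k + shift j) (scoeff (k + shift j) (eigComp j v))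
      (scoeff (k + shift j) (radialPart (eigGrad G j))) (scoeff (k + shift j) (eigGrad G j 2)) := by
  obtain ⟨hvm, hGm⟩ := h.aesm
  have hvi : ∀ i, Integrable (fun p => v p i) (volume.restrict D) := fun i =>
    integrable_of_sq hD (hvm i) (hv2 i)
  rw [h1kSeminorm_sq_eq hD.isOpen_halfSection (fun _ h => h.1) (isWeakPartials_coeff hD h hv2 hG2 k)]
  refine Finset.sum_congr rfl fun j _ => ?_
  rw [eigComp_ofEigComp, eigComp_ofEigComp]
  exact modeEnergy_congr (eigComp_coeff hD hvi k j) (ae_eq_refl _) (ae_eq_refl _)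

lemma h1kNorm_coeff_sq (k : ℤ) : h1kNorm (halfSection D) k (coeff k v) ^ 2 =
    (∑ j, ∫⁻ q, ‖scoeff (k + shift j) (eigComp j v) q‖ₑ ^ 2 ∂mer (halfSection D)) +
      h1kSeminorm (halfSection D) k (coeff k v) ^ 2 := by
  obtain ⟨hvm, hGm⟩ := h.aesm
  have hvi : ∀ i, Integrable (fun p => v p i) (volume.restrict D) := fun i =>
    integrable_of_sq hD (hvm i) (hv2 i)
  have hp := isWeakPartials_coeff hD h hv2 hG2 k
  rw [h1kNorm_sq_eq hD.isOpen_halfSection (fun _ h => h.1) hp,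
    h1kSeminorm_sq_eq hD.isOpen_halfSection (fun _ h => h.1) hp]
  congr 1
  exact Finset.sum_congr rfl fun j _ => lintegral_enorm_sq_congr (eigComp_coeff hD hvi k j)

omit hD h hv2 hG2 in
-- For each j the translation k ↦ k + shift j permutes ℤ, so the shifts disappear after summation
-- over all k.
lemma tsum_shift (f : Fin 3 → ℤ → ℝ≥0∞) :
    ∑' k : ℤ, ∑ j, f j (k + shift j) = ∑ j, ∑' m, f j m := by
  rw [Summable.tsum_finsetSum fun _ _ => ENNReal.summable]
  refine Finset.sum_congr rfl fun j _ => ?_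
  exact (Equiv.addRight (shift j)).tsum_eq (f j)

/-- Sum of the three scalar identities of `tsum_modeEnergy_scoeff`; unitarity of `diagMat` returns
from the eigenbasis to Cartesian components. -/
lemma parseval_seminorm_of_grad :
    ∑' k, h1kSeminorm (halfSection D) k (coeff k v) ^ 2 = h1Seminorm D v ^ 2 := by
  obtain ⟨hvm, hGm⟩ := h.aesm
  simp_rw [h1kSeminorm_coeff_sq hD h hv2 hG2]
  rw [tsum_shift fun j m => modeEnergy (halfSection D) m (scoeff m (eigComp j v))
      (scoeff m (radialPart (eigGrad G j))) (scoeff m (eigGrad G j 2)),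
    h1Seminorm_sq_eq hD.isOpen h]
  have : ∀ j, ∑' m, modeEnergy (halfSection D) m (scoeff m (eigComp j v))
      (scoeff m (radialPart (eigGrad G j))) (scoeff m (eigGrad G j 2)) =
      ∑ d, ∫⁻ p in D, ‖eigGrad G j d p‖ₑ ^ 2 := fun j =>
    tsum_modeEnergy_scoeff hD (h.eigComp j) (lintegral_eigComp_lt_top hvm hv2 j)
      fun d => lintegral_eigComp_lt_top (fun i => hGm i d) (fun i => hG2 i d) j
  simp_rw [this]
  rw [Finset.sum_comm, Finset.sum_comm (f := fun i j => ∫⁻ p in D, ‖G i j p‖ₑ ^ 2)]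
  exact Finset.sum_congr rfl fun d _ => lintegral_sum_eigComp (fun i => hGm i d)

lemma parseval_norm_of_grad :
    ∑' k, h1kNorm (halfSection D) k (coeff k v) ^ 2 = h1Norm D v ^ 2 := by
  obtain ⟨hvm, hGm⟩ := h.aesm
  simp_rw [h1kNorm_coeff_sq hD h hv2 hG2]
  rw [ENNReal.tsum_add, parseval_seminorm_of_grad hD h hv2 hG2,
    tsum_shift fun j m => ∫⁻ q, ‖scoeff m (eigComp j v) q‖ₑ ^ 2 ∂mer (halfSection D),
    h1Norm_sq_eq hD.isOpen h, h1Seminorm_sq_eq hD.isOpen h]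
  congr 1
  rw [← lintegral_sum_eigComp hvm]
  exact Finset.sum_congr rfl fun j _ => parseval_scoeff hD (aesm_eigComp hvm j)
    (lintegral_eigComp_lt_top hvm hv2 j)

end Grad

variable {v : Field3}

theorem parseval_seminorm (hv : v ∈ H1 D) :
    ∑' k, h1kSeminorm (halfSection D) k (coeff k v) ^ 2 = h1Seminorm D v ^ 2 := by
  obtain ⟨G, h, h1, h2⟩ := (mem_H1_iff hD.isOpen).1 hv
  exact parseval_seminorm_of_grad hD h h1 h2

theorem parseval_norm (hv : v ∈ H1 D) :
    ∑' k, h1kNorm (halfSection D) k (coeff k v) ^ 2 = h1Norm D v ^ 2 := by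
  obtain ⟨G, h, h1, h2⟩ := (mem_H1_iff hD.isOpen).1 hv
  exact parseval_norm_of_grad hD h h1 h2

lemma exists_isWeakPartials_coeff (hv : v ∈ H1 D) (k : ℤ) :
    ∃ a b, IsWeakPartials (halfSection D) (coeff k v) a b := by
  obtain ⟨G, h, h1, h2⟩ := (mem_H1_iff hD.isOpen).1 hv
  exact ⟨_, _, isWeakPartials_coeff hD h h1 h2 k⟩

lemma integrable_of_mem_H1 (hv : v ∈ H1 D) (i : Fin 3) :
    Integrable (fun p => v p i) (volume.restrict D) := by
  obtain ⟨G, h, h1, -⟩ := (mem_H1_iff hD.isOpen).1 hv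
  exact integrable_of_sq hD (h.aesm.1 i) (h1 i)

end Domain

/-! ### Rotational derivatives of modes -/

lemma iteratedDeriv_exp_smul (c : ℂ) (x : Fin 3 → ℂ) (l : ℕ) :
    iteratedDeriv l (fun α : ℝ => Complex.exp (c * α) • x) = fun α : ℝ => (c ^ l * Complex.exp (c * α)) • x := by
  induction l with
  | zero => simp
  | succ n ih =>
    rw [iteratedDeriv_succ, ih]
    funext α
    have h : HasDerivAt (fun α : ℝ => c ^ n * Complex.exp (c * α)) (c ^ n * (Complex.exp (c * α) * c)) α := by
      refine HasDerivAt.const_mul _ (HasDerivAt.cexp ?_)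
      simpa using (hasDerivAt_id α).ofReal_comp.const_mul c
    rw [(h.smul_const x).deriv]
    congr 1
    ring

/-- For a field of a single angular frequency the curve differentiated in `rotDeriv` is an
exponential, so each derivative at α = 0 brings down the factor c. -/
lemma rotDeriv_eq_of_equivariant {ψ : Field3} {c : ℂ} {p : Space}
    (h : ∀ α : ℝ, rotMat (-α) *ᵥ ψ (rot α p) = Complex.exp (c * α) • ψ p) (l : ℕ) :
    rotDeriv l ψ p = c ^ l • ψ p := by
  rw [rotDeriv]
  simp_rw [h]
  rw [iteratedDeriv_exp_smul]
  simp

lemma slift_rot (m : ℤ) (w : Plane → ℂ) {p : Space} (hp : 0 < (meridian p).1) (α : ℝ) :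
    slift m w (rot α p) = Complex.exp (Complex.I * m * α) * slift m w p := by
  obtain ⟨θ, -, h⟩ := exists_cyl_meridian p
  set q := meridian p
  rw [← h, cyl_eq_rot, rot_rot, ← cyl_eq_rot, ← cyl_eq_rot, slift_cyl _ _ hp, slift_cyl _ _ hp]
  push_cast
  rw [mul_add, Complex.exp_add]
  ring

lemma meridian_rot (α : ℝ) (p : Space) : meridian (rot α p) = meridian p := by
  ext
  · simp only [meridian, rot]
    congr 1
    linear_combination (p.1.1 ^ 2 + p.1.2 ^ 2) * Real.sin_sq_add_cos_sq α
  · rfl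

/-- Points of the axis are fixed by all rotations, so there equivariance needs the vanishing of w,
which makes both sides 0. -/
lemma slift_rot_of_zero (m : ℤ) {w : Plane → ℂ} (hw : ∀ q : Plane, q.1 = 0 → w q = 0) (p : Space)
    (α : ℝ) : slift m w (rot α p) = Complex.exp (Complex.I * m * α) * slift m w p := by
  rcases (Real.sqrt_nonneg _ : 0 ≤ (meridian p).1).lt_or_eq with hp | hp
  · exact slift_rot m w hp α
  · rw [slift, slift, meridian_rot, hw _ hp.symm, mul_zero, mul_zero, mul_zero]

lemma isTest_smul_const {D : Set Space} {Ψ : Space → ℂ} (hΨ : IsTest D Ψ) (x : Fin 3 → ℂ) :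
    IsTest D fun p => Ψ p • x := by
  refine IsTest.of_eventually hΨ.compact hΨ.support_subset (fun p hp => ?_) fun p _ => ?_
  · rw [image_eq_zero_of_notMem_tsupport hp, zero_smul]
  · exact (hΨ.smooth.smul contDiff_const).contDiffAt

section Domain

variable {D : Set Space} (hD : IsAxisymmetricDomain D) {v w : Field3}

include hD

/-- The distributional identity is tested with a single mode in a constant eigendirection. On such a
field the transposed operator is the scalar (-ik)^l, which together with the sign (-1)^l gives
(ik)^l. -/
lemma scoeff_rotDeriv {l : ℕ} (h : IsRotDeriv D l v w)
    (hv : ∀ i, Integrable (fun p => v p i) (volume.restrict D))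
    (hw : ∀ i, Integrable (fun p => w p i) (volume.restrict D)) (k : ℤ) (j : Fin 3) :
    scoeff (k + shift j) (eigComp j w) =ᵐ[volume.restrict (halfSection D)]
      fun q => (Complex.I * k) ^ l * scoeff (k + shift j) (eigComp j v) q := by
  have hΩ := hD.isOpen_halfSection
  have hint : ∀ {v : Field3}, (∀ i, Integrable (fun p => v p i) (volume.restrict D)) →
      Integrable (eigComp j v) (volume.restrict D) := fun {v} hv =>
    integrable_finsetSum (f := fun i p => diagMat j i * v p i) Finset.univ
      fun i _ => (hv i).const_mul _
  refine ae_eq_of_forall_integral_mul_eq hΩ (locallyIntegrableOn_scoeff hD (hint hw) _)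
    ((locallyIntegrableOn_scoeff hD (hint hv) (k + shift j)).smul ((Complex.I * k) ^ l)) fun φ hφ => ?_
  set χ : Plane → ℂ := fun q => ((q.1 : ℂ) ^ 1)⁻¹ * φ q with hχdef
  have hχ : IsTest (halfSection D) χ := hφ.mul_left fun q hq => contDiffAt_inv_fst_pow hq.1 1
  have hΨ := isTest_slift hD hχ (-(k + shift j))
  set Ψ := slift (-(k + shift j)) χ with hΨdef
  -- Pairing with the j-th row of `diagMat` extracts the j-th eigencomponent. Since the transpose of
  -- a rotation is its inverse, this row is also a right eigenvector of every rotation.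
  set e : Fin 3 → ℂ := fun i => diagMat j i with he
  have hψ := isTest_smul_const hΨ e
  have hrot : rotDeriv l (fun p => Ψ p • e) = fun p => (-(Complex.I * k)) ^ l • Ψ p • e := by
    funext p
    refine rotDeriv_eq_of_equivariant (ψ := fun p => Ψ p • e) (fun α => ?_) l
    have h0 : ∀ q : Plane, q.1 = 0 → χ q = 0 := fun q hq => by simp [hχdef, hq]
    have h1 : rotMat (-α) *ᵥ e = Complex.exp (Complex.I * shift j * α) • e := by
      funext i
      have h2 := diagMat_mulVec_rotMat α (Pi.single i 1) j
      have h3 : (rotMat (-α))ᵀ = rotMat α := by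
        ext a b; fin_cases a <;> fin_cases b <;> simp [rotMat]
      rw [Matrix.mulVec_mulVec, Matrix.mulVec_single_one, Matrix.mulVec_single_one] at h2
      rw [← Matrix.vecMul_transpose, h3, Pi.smul_apply, smul_eq_mul]
      exact h2
    rw [hΨdef, slift_rot_of_zero _ h0, Matrix.mulVec_smul, h1, smul_smul, smul_smul, mul_right_comm,
      ← Complex.exp_add]
    congr 3
    push_cast
    ring
  have key := h.integral_eq _ hψ
  rw [hrot] at key
  have hdot : ∀ (v : Field3) (c : ℂ) (p : Space),
      v p ⬝ᵥ (c • Ψ p • e) = c * (eigComp j v p * Ψ p) := by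
    intro v c p
    rw [dotProduct_smul, dotProduct_smul, smul_eq_mul, smul_eq_mul, dotProduct_comm]
    rw [mul_comm (eigComp j v p), eigComp_apply]
    rfl
  have e1 : (fun p => w p ⬝ᵥ Ψ p • e) = fun p => eigComp j w p * Ψ p := by
    funext p
    simpa using hdot w 1 p
  simp_rw [e1, hdot] at key
  rw [integral_const_mul, hΨdef, pairing_scoeff hD _ (hΨ.integrable_mul
    (IntegrableOn.locallyIntegrableOn (hint hw))), pairing_scoeff hD _ (hΨ.integrable_mul
    (IntegrableOn.locallyIntegrableOn (hint hv))), integral_mer_halfSection hD,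
    integral_mer_halfSection hD, ← mul_assoc, ← mul_pow, neg_one_mul, neg_neg,
    ← integral_const_mul] at key
  convert key using 1
  · refine setIntegral_congr_fun hΩ.measurableSet fun q hq => ?_
    have hne : (q.1 : ℂ) ≠ 0 := by exact_mod_cast hq.1.ne'
    simp only [hχdef]
    field_simp
  · refine setIntegral_congr_fun hΩ.measurableSet fun q hq => ?_
    have hne : (q.1 : ℂ) ≠ 0 := by exact_mod_cast hq.1.ne'
    simp only [hχdef]
    field_simp

end Domain

/-! ### Homogeneity and almost everywhere invariance of the mode norms -/

lemma modeEnergy_const_mul {Ω : Set Plane} (m : ℤ) (c : ℂ) (w a b : Plane → ℂ) :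
    modeEnergy Ω m (c • w) (c • a) (c • b) = ‖c‖ₑ ^ 2 * modeEnergy Ω m w a b := by
  rw [modeEnergy, modeEnergy, ← lintegral_const_mul' _ _ (by simp)]
  refine lintegral_congr fun q => ?_
  simp only [Pi.smul_apply, smul_eq_mul, enorm_mul, mul_pow]
  ring

lemma IsWeakPartials.const_smul {Ω : Set Plane} {v a b : Triple} (h : IsWeakPartials Ω v a b)
    (c : ℂ) : IsWeakPartials Ω (c • v) (c • a) (c • b) := fun i =>
  ⟨(h i).1.const_mul c, (h i).2.const_mul c⟩

section Plane

variable {Ω : Set Plane} (hΩ : IsOpen Ω) (hpos : ∀ q ∈ Ω, 0 < q.1) {k : ℤ} {v a b : Triple}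

include hΩ hpos

lemma h1kSeminorm_const_smul (h : IsWeakPartials Ω v a b) (c : ℂ) :
    h1kSeminorm Ω k (c • v) ^ 2 = ‖c‖ₑ ^ 2 * h1kSeminorm Ω k v ^ 2 := by
  rw [h1kSeminorm_sq_eq hΩ hpos h, h1kSeminorm_sq_eq hΩ hpos (h.const_smul c), Finset.mul_sum]
  simp_rw [eigComp_smul, modeEnergy_const_mul]

lemma h1kNorm_const_smul (h : IsWeakPartials Ω v a b) (c : ℂ) :
    h1kNorm Ω k (c • v) ^ 2 = ‖c‖ₑ ^ 2 * h1kNorm Ω k v ^ 2 := by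
  rw [h1kNorm_sq_eq hΩ hpos h, h1kNorm_sq_eq hΩ hpos (h.const_smul c), mul_add, Finset.mul_sum,
    Finset.mul_sum]
  simp_rw [eigComp_smul, modeEnergy_const_mul]
  congr 1
  refine Finset.sum_congr rfl fun j _ => ?_
  rw [← lintegral_const_mul' _ _ (by simp)]
  refine lintegral_congr fun q => ?_
  rw [Pi.smul_apply, smul_eq_mul, enorm_mul, mul_pow]

omit hpos in
lemma h1kNorm_congr {v' : Triple} (hv : v =ᵐ[volume.restrict Ω] v') :
    h1kNorm Ω k v = h1kNorm Ω k v' := by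
  have key : ∀ {v v' : Triple}, v =ᵐ[volume.restrict Ω] v' → h1kNorm Ω k v ≤ h1kNorm Ω k v' := by
    intro v v' hv
    refine le_iInf₂ fun a b => le_iInf fun h => (iInf₂_le_of_le a b (iInf_le _ (h.congr hv.symm))).trans
      (le_of_eq ?_)
    congr 1
    refine lintegral_congr_ae ?_
    filter_upwards [hv] with q hq
    rw [hq]
  exact le_antisymm (key hv) (key hv.symm)

omit hpos in
lemma h1kSeminorm_congr {v' : Triple} (hv : v =ᵐ[volume.restrict Ω] v') :
    h1kSeminorm Ω k v = h1kSeminorm Ω k v' := by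
  have key : ∀ {v v' : Triple}, v =ᵐ[volume.restrict Ω] v' →
      h1kSeminorm Ω k v ≤ h1kSeminorm Ω k v' := by
    intro v v' hv
    refine le_iInf₂ fun a b => le_iInf fun h => (iInf₂_le_of_le a b (iInf_le _ (h.congr hv.symm))).trans
      (le_of_eq ?_)
    congr 1
    refine lintegral_congr_ae ?_
    filter_upwards [hv] with q hq
    rw [hq]
  exact le_antisymm (key hv) (key hv.symm)

omit hΩ hpos in
lemma exists_isWeakPartials_of_h1kNorm_lt_top (h : h1kNorm Ω k v < ⊤) :
    ∃ a b, IsWeakPartials Ω v a b := by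
  obtain ⟨a, h⟩ := iInf_lt_iff.1 h
  obtain ⟨b, h⟩ := iInf_lt_iff.1 h
  obtain ⟨h, -⟩ := iInf_lt_iff.1 h
  exact ⟨a, b, h⟩

end Plane

/-! ### Equivalence of the weights -/

lemma sum_pow_le_one_add_pow (x : ℝ) (hx : 0 ≤ x) (s : ℕ) :
    ∑ l ∈ Finset.range (s + 1), x ^ l ≤ (1 + x) ^ s := by
  rw [add_comm 1 x, add_pow]
  refine Finset.sum_le_sum fun l hl => ?_
  rw [one_pow, mul_one]
  have : (1:ℝ) ≤ (s.choose l : ℝ) := by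
    exact_mod_cast Nat.choose_pos (Nat.lt_succ_iff.1 (Finset.mem_range.1 hl))
  exact le_mul_of_one_le_right (by positivity) this

lemma one_add_pow_le_sum_pow (x : ℝ) (hx : 0 ≤ x) (s : ℕ) :
    (1 + x) ^ s ≤ 2 ^ s * ∑ l ∈ Finset.range (s + 1), x ^ l := by
  rw [add_comm 1 x, add_pow, Finset.mul_sum]
  refine Finset.sum_le_sum fun l _ => ?_
  rw [one_pow, mul_one, mul_comm]
  have : (s.choose l : ℝ) ≤ 2 ^ s := by exact_mod_cast Nat.choose_le_two_pow s l
  gcongr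

lemma le_of_sq_le_sq {a b : ℝ≥0∞} (h : a ^ 2 ≤ b ^ 2) : a ≤ b := by
  rw [← sq_rpow_half a, ← sq_rpow_half b]
  exact ENNReal.rpow_le_rpow h (by norm_num)

/-- The hypothesis on X is all that the analysis has to provide. The binomial coefficients of (1 +
k²)^s lie between 1 and 2^s, which gives both bounds termwise in k. -/
theorem weighted_equivalence (s : ℕ) (N : ℤ → ℝ≥0∞) (X : ℕ → ℝ≥0∞)
    (hX : ∀ l ≤ s, X l ^ 2 = ∑' k : ℤ, ENNReal.ofReal (((k : ℝ) ^ 2) ^ l) * N k ^ 2) :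
    ((1 : ℝ≥0) : ℝ≥0∞) * (∑ l ∈ Finset.range (s + 1), X l ^ 2) ^ (1 / 2 : ℝ) ≤
      (∑' k : ℤ, ENNReal.ofReal ((1 + (k : ℝ) ^ 2) ^ s) * N k ^ 2) ^ (1 / 2 : ℝ) ∧
    (∑' k : ℤ, ENNReal.ofReal ((1 + (k : ℝ) ^ 2) ^ s) * N k ^ 2) ^ (1 / 2 : ℝ) ≤
      ((2 ^ s : ℝ≥0) : ℝ≥0∞) * (∑ l ∈ Finset.range (s + 1), X l ^ 2) ^ (1 / 2 : ℝ) := by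
  have hsum : ∑ l ∈ Finset.range (s + 1), X l ^ 2 =
      ∑' k : ℤ, ENNReal.ofReal (∑ l ∈ Finset.range (s + 1), ((k : ℝ) ^ 2) ^ l) * N k ^ 2 := by
    rw [Finset.sum_congr rfl fun l hl => hX l (Nat.lt_succ_iff.1 (Finset.mem_range.1 hl)),
      ← Summable.tsum_finsetSum fun _ _ => ENNReal.summable]
    congr 1; funext k
    rw [ENNReal.ofReal_sum_of_nonneg (fun _ _ => by positivity), Finset.sum_mul]
  rw [hsum]
  constructor
  · rw [ENNReal.coe_one, one_mul]
    refine ENNReal.rpow_le_rpow (ENNReal.tsum_le_tsum fun k => ?_) (by norm_num)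
    gcongr
    exact sum_pow_le_one_add_pow _ (by positivity) s
  · refine le_of_sq_le_sq ?_
    rw [mul_pow, rpow_half_sq, rpow_half_sq, ← ENNReal.tsum_mul_left]
    refine ENNReal.tsum_le_tsum fun k => ?_
    rw [← mul_assoc]
    gcongr
    have h1 : (((2 ^ s : ℝ≥0) : ℝ≥0∞)) ^ 2 = ENNReal.ofReal ((2 ^ s) ^ 2) := by
      rw [ENNReal.ofReal_pow (by positivity), ENNReal.ofReal_pow (by positivity)]
      simp
    rw [h1, ← ENNReal.ofReal_mul (by positivity)]
    -- The binomial bound needs only the square root of 2^s as constant; the larger 2^s is kept,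
    -- since 2^s ≤ (2^s)².
    refine ENNReal.ofReal_le_ofReal ((one_add_pow_le_sum_pow _ (by positivity) s).trans ?_)
    have h2 : (1:ℝ) ≤ 2 ^ s := one_le_pow₀ (by norm_num)
    have h3 : (0:ℝ) ≤ ∑ l ∈ Finset.range (s + 1), ((k : ℝ) ^ 2) ^ l := by positivity
    gcongr
    nlinarith

lemma enorm_I_mul_pow_sq (k : ℤ) (l : ℕ) :
    ‖(Complex.I * k) ^ l‖ₑ ^ 2 = ENNReal.ofReal (((k : ℝ) ^ 2) ^ l) := by
  rw [← ofReal_norm_sq, norm_pow, norm_mul, Complex.norm_I, one_mul, Complex.norm_intCast, ← pow_mul,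
    mul_comm, pow_mul, sq_abs]

section Domain

variable {D : Set Space} (hD : IsAxisymmetricDomain D) {v w : Field3}

include hD

lemma coeff_rotDeriv {l : ℕ} (h : IsRotDeriv D l v w) (hv : v ∈ H1 D) (hw : w ∈ H1 D) (k : ℤ) :
    coeff k w =ᵐ[volume.restrict (halfSection D)] (Complex.I * k) ^ l • coeff k v := by
  have hvi := integrable_of_mem_H1 hD hv
  have hwi := integrable_of_mem_H1 hD hw
  have h1 := fun j => eigComp_coeff hD hvi k j
  have h2 := fun j => eigComp_coeff hD hwi k j
  have h3 := fun j => scoeff_rotDeriv hD h hvi hwi k j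
  simp_rw [EventuallyEq, ae_mer_iff hD.isOpen_halfSection.measurableSet (fun _ h => h.1)] at h1 h2
  filter_upwards [ae_all_iff.2 h1, ae_all_iff.2 h2, ae_all_iff.2 h3] with q g1 g2 g3
  rw [← ofEigComp_eigComp (coeff k w), ← ofEigComp_eigComp ((Complex.I * k) ^ l • coeff k v)]
  simp only [ofEigComp, eigComp_smul, Pi.smul_apply, smul_eq_mul, g1, g2, g3]

lemma h1Norm_rotDeriv {l : ℕ} (h : IsRotDeriv D l v w) (hv : v ∈ H1 D) (hw : w ∈ H1 D) :
    h1Norm D w ^ 2 = ∑' k : ℤ, ENNReal.ofReal (((k : ℝ) ^ 2) ^ l) *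
      h1kNorm (halfSection D) k (coeff k v) ^ 2 := by
  rw [← parseval_norm hD hw]
  congr 1; funext k
  obtain ⟨a, b, hab⟩ := exists_isWeakPartials_coeff hD hv k
  rw [h1kNorm_congr hD.isOpen_halfSection (coeff_rotDeriv hD h hv hw k),
    h1kNorm_const_smul hD.isOpen_halfSection (fun _ h => h.1) hab, enorm_I_mul_pow_sq]

theorem fourierNormH1_equivalence (s : ℕ) (hv : v ∈ AnisoH1 D s) :
    ((1 : ℝ≥0) : ℝ≥0∞) * naturalNormH1 D s v ≤ fourierNormH1 D s v ∧
      fourierNormH1 D s v ≤ ((2 ^ s : ℝ≥0) : ℝ≥0∞) * naturalNormH1 D s v := by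
  refine weighted_equivalence s (fun k => h1kNorm (halfSection D) k (coeff k v)) _ fun l hl => ?_
  obtain ⟨w, hw, h⟩ := hv.2 l hl
  rw [← h1Norm_rotDeriv hD h hv.1 hw]
  congr 1
  -- The infimum is attained at w: competitors in H^1 have the same norm, as it is determined by the
  -- coefficients of v, and all others have norm ∞.
  refine le_antisymm (iInf₂_le w h) (le_iInf₂ fun w' h' => ?_)
  by_cases hw' : w' ∈ H1 D
  · refine le_of_sq_le_sq (le_of_eq ?_)
    rw [h1Norm_rotDeriv hD h hv.1 hw, h1Norm_rotDeriv hD h' hv.1 hw']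
  · have : h1Norm D w' = ⊤ := not_lt_top_iff.1 hw'
    rw [this]
    exact le_top

end Domain

/-! ### Closedness of weak derivatives -/

lemma enorm_integral_mul_le {X : Type*} [MeasurableSpace X] {μ : Measure X} {f g : X → ℂ}
    (hf : AEStronglyMeasurable f μ) (hg : AEStronglyMeasurable g μ) :
    ‖∫ x, f x * g x ∂μ‖ₑ ≤ (∫⁻ x, ‖f x‖ₑ ^ 2 ∂μ) ^ (1 / 2 : ℝ) * (∫⁻ x, ‖g x‖ₑ ^ 2 ∂μ) ^ (1 / 2 : ℝ) := by
  refine (enorm_integral_le_lintegral_enorm _).trans ?_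
  have h := ENNReal.lintegral_mul_le_Lp_mul_Lq μ Real.HolderConjugate.two_two hf.enorm hg.enorm
  simp only [Pi.mul_apply, ENNReal.rpow_ofNat] at h
  simpa only [enorm_mul] using h

lemma IsTest.lintegral_sq_lt_top {E : Type*} [NormedAddCommGroup E] [NormedSpace ℝ E]
    [MeasureSpace E] [BorelSpace E] [IsFiniteMeasureOnCompacts (volume : Measure E)] {U : Set E}
    {φ : E → ℂ} (hφ : IsTest U φ) : ∫⁻ x in U, ‖φ x‖ₑ ^ 2 < ⊤ := by
  have h := (hφ.smooth.continuous.memLp_of_hasCompactSupport (p := 2) (μ := volume) hφ.compact).2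
  rw [eLpNorm_lt_top_iff_lintegral_rpow_enorm_lt_top (by simp) (by simp)] at h
  refine lt_of_le_of_lt (setLIntegral_le_lintegral _ _) ?_
  simpa using h

/-- For a fixed test function, Cauchy–Schwarz bounds the defect in the integration by parts by √ε
times a constant independent of the approximants; then ε → 0. -/
theorem isWeakDeriv_of_approx {E : Type*} [NormedAddCommGroup E] [NormedSpace ℝ E]
    [MeasureSpace E] [BorelSpace E] [IsFiniteMeasureOnCompacts (volume : Measure E)]
    [SecondCountableTopology E] {U : Set E} {e : E} {u g : E → ℂ}
    (hu : LocallyIntegrableOn u U) (hg : LocallyIntegrableOn g U)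
    (h : ∀ ε : ℝ≥0∞, 0 < ε → ∃ u' g', IsWeakDeriv U e u' g' ∧
      ∫⁻ x in U, ‖u x - u' x‖ₑ ^ 2 ≤ ε ∧ ∫⁻ x in U, ‖g x - g' x‖ₑ ^ 2 ≤ ε) :
    IsWeakDeriv U e u g := by
  refine ⟨hu, hg, fun φ hφ => ?_⟩
  have hd := hφ.fderiv_apply e
  set A := (∫⁻ x in U, ‖φ x‖ₑ ^ 2) ^ (1 / 2 : ℝ) with hA
  set B := (∫⁻ x in U, ‖fderiv ℝ φ x e‖ₑ ^ 2) ^ (1 / 2 : ℝ) with hB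
  have hAB : A + B < ⊤ := ENNReal.add_lt_top.2
    ⟨ENNReal.rpow_lt_top_of_nonneg (by norm_num) hφ.lintegral_sq_lt_top.ne,
      ENNReal.rpow_lt_top_of_nonneg (by norm_num) hd.lintegral_sq_lt_top.ne⟩
  have key : ∀ ε : ℝ≥0∞, 0 < ε → ‖(∫ x in U, g x * φ x) + ∫ x in U, u x * fderiv ℝ φ x e‖ₑ ≤
      ε ^ (1 / 2 : ℝ) * (A + B) := by
    intro ε hε
    obtain ⟨u', g', h', h1, h2⟩ := h ε hε
    have e1 : (∫ x in U, g x * φ x) + ∫ x in U, u x * fderiv ℝ φ x e =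
        (∫ x in U, (g x - g' x) * φ x) + ∫ x in U, (u x - u' x) * fderiv ℝ φ x e := by
      simp_rw [sub_mul]
      rw [integral_sub (hφ.integrable_mul hg) (hφ.integrable_mul h'.right_loc),
        integral_sub (hd.integrable_mul hu) (hd.integrable_mul h'.left_loc), h'.integral_eq φ hφ]
      ring
    rw [e1, mul_add]
    refine (enorm_add_le _ _).trans (add_le_add ?_ ?_)
    · refine (enorm_integral_mul_le (hg.aestronglyMeasurable.sub h'.right_loc.aestronglyMeasurable)
        hφ.smooth.continuous.aestronglyMeasurable).trans ?_
      gcongr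
      exact h2
    · refine (enorm_integral_mul_le (hu.aestronglyMeasurable.sub h'.left_loc.aestronglyMeasurable)
        hd.smooth.continuous.aestronglyMeasurable).trans ?_
      gcongr
      exact h1
  have hlim : Tendsto (fun ε : ℝ≥0∞ => ε ^ (1 / 2 : ℝ) * (A + B)) (𝓝[>] 0) (𝓝 0) := by
    have h1 : Tendsto (fun ε : ℝ≥0∞ => ε ^ (1 / 2 : ℝ)) (𝓝[>] 0) (𝓝 0) := by
      have := (ENNReal.continuous_rpow_const (y := (1 / 2 : ℝ))).tendsto 0
      rw [ENNReal.zero_rpow_of_pos (by norm_num)] at this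
      exact this.mono_left nhdsWithin_le_nhds
    have := ENNReal.Tendsto.mul_const h1 (Or.inr hAB.ne)
    rwa [zero_mul] at this
  have h0 : ‖(∫ x in U, g x * φ x) + ∫ x in U, u x * fderiv ℝ φ x e‖ₑ ≤ 0 :=
    ge_of_tendsto hlim (by filter_upwards [self_mem_nhdsWithin] with ε hε using key ε hε)
  exact eq_neg_of_add_eq_zero_left (by simpa using h0)

/-! ### Energies of scalar modes -/

lemma enorm_add_sq_le (x y : ℂ) : ‖x + y‖ₑ ^ 2 ≤ 2 * ‖x‖ₑ ^ 2 + 2 * ‖y‖ₑ ^ 2 := by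
  have h : ‖x + y‖ ^ 2 ≤ 2 * ‖x‖ ^ 2 + 2 * ‖y‖ ^ 2 := by
    have h1 := norm_add_le x y
    nlinarith [sq_nonneg (‖x‖ - ‖y‖), norm_nonneg (x + y), norm_nonneg x, norm_nonneg y]
  have h2 := ENNReal.ofReal_le_ofReal h
  rwa [ENNReal.ofReal_add (by positivity) (by positivity), ENNReal.ofReal_mul (by norm_num),
    ENNReal.ofReal_mul (by norm_num), ofReal_norm_sq, ofReal_norm_sq, ofReal_norm_sq,
    ENNReal.ofReal_ofNat] at h2

lemma enorm_sub_sq_le (x y : ℂ) : ‖x - y‖ₑ ^ 2 ≤ 2 * ‖x‖ₑ ^ 2 + 2 * ‖y‖ₑ ^ 2 := by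
  rw [sub_eq_add_neg, ← enorm_neg y]
  exact enorm_add_sq_le _ _

lemma enorm_ofReal_mul_sq (c : ℝ) (x : ℂ) : ‖(c : ℂ) * x‖ₑ ^ 2 = ENNReal.ofReal (c ^ 2) * ‖x‖ₑ ^ 2 := by
  rw [enorm_mul, mul_pow, ← ofReal_norm_sq, Complex.norm_real, Real.norm_eq_abs, sq_abs]

/-- The weight of the angular part of the energy. -/
def wt (m : ℤ) (q : Plane) : ℝ≥0∞ := ENNReal.ofReal ((m : ℝ) ^ 2 / q.1 ^ 2)

/-- The squared norm of the scalar mode of frequency `m`. -/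
def fullEnergy (Ω : Set Plane) (m : ℤ) (w a b : Plane → ℂ) : ℝ≥0∞ :=
  ∫⁻ q, (‖w q‖ₑ ^ 2 + (‖a q‖ₑ ^ 2 + ‖b q‖ₑ ^ 2 + wt m q * ‖w q‖ₑ ^ 2)) ∂mer Ω

lemma measurable_wt (m : ℤ) : Measurable (wt m) := by unfold wt; fun_prop

lemma wt_zero (q : Plane) : wt 0 q = 0 := by simp [wt]

/-- Triples of measurable functions on `Ω`. -/
structure MeasTriple (Ω : Set Plane) (w a b : Plane → ℂ) : Prop where
  fst : AEStronglyMeasurable w (mer Ω)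
  snd : AEStronglyMeasurable a (mer Ω)
  trd : AEStronglyMeasurable b (mer Ω)

lemma MeasTriple.aemeasurable {Ω : Set Plane} {w a b : Plane → ℂ} (h : MeasTriple Ω w a b) (m : ℤ) :
    AEMeasurable (fun q => ‖w q‖ₑ ^ 2 + (‖a q‖ₑ ^ 2 + ‖b q‖ₑ ^ 2 + wt m q * ‖w q‖ₑ ^ 2)) (mer Ω) :=
  (h.fst.enorm.pow_const 2).add (((h.snd.enorm.pow_const 2).add (h.trd.enorm.pow_const 2)).add
    ((measurable_wt m).aemeasurable.mul (h.fst.enorm.pow_const 2)))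

lemma fullEnergy_eq {Ω : Set Plane} {m : ℤ} {w a b : Plane → ℂ}
    (hw : AEStronglyMeasurable w (mer Ω)) :
    fullEnergy Ω m w a b = (∫⁻ q, ‖w q‖ₑ ^ 2 ∂mer Ω) + modeEnergy Ω m w a b := by
  rw [fullEnergy, lintegral_add_left' (hw.enorm.pow_const 2)]
  rfl

lemma fullEnergy_add_le {Ω : Set Plane} {m : ℤ} {w a b w' a' b' : Plane → ℂ}
    (h : MeasTriple Ω w a b) :
    fullEnergy Ω m (w + w') (a + a') (b + b') ≤
      2 * fullEnergy Ω m w a b + 2 * fullEnergy Ω m w' a' b' := by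
  rw [fullEnergy, fullEnergy, fullEnergy, ← lintegral_const_mul' _ _ (by simp),
    ← lintegral_const_mul' _ _ (by simp), ← lintegral_add_left' ((h.aemeasurable m).const_mul 2)]
  refine lintegral_mono fun q => ?_
  have h1 := enorm_add_sq_le (w q) (w' q)
  have h2 := enorm_add_sq_le (a q) (a' q)
  have h3 := enorm_add_sq_le (b q) (b' q)
  simp only [Pi.add_apply]
  calc _ ≤ (2 * ‖w q‖ₑ ^ 2 + 2 * ‖w' q‖ₑ ^ 2) + ((2 * ‖a q‖ₑ ^ 2 + 2 * ‖a' q‖ₑ ^ 2) +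
        (2 * ‖b q‖ₑ ^ 2 + 2 * ‖b' q‖ₑ ^ 2) + wt m q * (2 * ‖w q‖ₑ ^ 2 + 2 * ‖w' q‖ₑ ^ 2)) := by
        gcongr
    _ = _ := by ring

lemma fullEnergy_congr {Ω : Set Plane} {m : ℤ} {w a b w' a' b' : Plane → ℂ}
    (h : ∀ᵐ q ∂mer Ω, w q = w' q ∧ a q = a' q ∧ b q = b' q) :
    fullEnergy Ω m w a b = fullEnergy Ω m w' a' b' := by
  refine lintegral_congr_ae ?_
  filter_upwards [h] with q hq
  rw [hq.1, hq.2.1, hq.2.2]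

/-! ### Cut-off functions near the axis -/

/-- Logarithmic cut-off functions that vanish near the axis. -/
def cut (n : ℕ) (r : ℝ) : ℝ :=
  if r ≤ 0 then 0 else Real.smoothTransition (2 + Real.log r / (n + 1))

lemma cut_eq_zero {n : ℕ} {r : ℝ} (h : r ≤ Real.exp (-(2 * (n + 1)))) : cut n r = 0 := by
  by_cases hr : r ≤ 0
  · simp [cut, hr]
  · rw [cut, if_neg hr]
    apply Real.smoothTransition.zero_of_nonpos
    have h1 := Real.log_le_log (not_le.1 hr) h
    rw [Real.log_exp] at h1
    have h2 : Real.log r / (n + 1) ≤ -2 := by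
      rw [div_le_iff₀ (by positivity)]; linarith
    linarith

lemma cut_eq_of_pos {n : ℕ} {r : ℝ} (h : 0 < r) :
    cut n r = Real.smoothTransition (2 + Real.log r / (n + 1)) := by
  rw [cut, if_neg h.not_ge]

lemma cut_eventuallyEq {n : ℕ} {r : ℝ} (h : 0 < r) :
    cut n =ᶠ[𝓝 r] fun r => Real.smoothTransition (2 + Real.log r / (n + 1)) := by
  filter_upwards [lt_mem_nhds h] with r hr using cut_eq_of_pos hr

lemma contDiff_cut (n : ℕ) : ContDiff ℝ (⊤ : ℕ∞) (cut n) := by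
  rw [contDiff_iff_contDiffAt]
  intro r
  by_cases hr : r < Real.exp (-(2 * (n + 1)))
  · have : cut n =ᶠ[𝓝 r] fun _ => 0 := by
      filter_upwards [gt_mem_nhds hr] with r hr using cut_eq_zero hr.le
    exact contDiffAt_const.congr_of_eventuallyEq this
  · have h0 : 0 < r := (Real.exp_pos _).trans_le (not_lt.1 hr)
    refine ContDiffAt.congr_of_eventuallyEq ?_ (cut_eventuallyEq h0)
    exact Real.smoothTransition.contDiff.contDiffAt.comp r
      (contDiffAt_const.add ((Real.contDiffAt_log.2 h0.ne').div_const _))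

lemma cut_mem_Icc (n : ℕ) (r : ℝ) : cut n r ∈ Icc (0 : ℝ) 1 := by
  by_cases hr : r ≤ 0
  · simp [cut, hr]
  · rw [cut, if_neg hr]
    exact ⟨Real.smoothTransition.nonneg _, Real.smoothTransition.le_one _⟩

lemma tendsto_cut {r : ℝ} (h : 0 < r) : Tendsto (fun n => cut n r) atTop (𝓝 1) := by
  refine tendsto_const_nhds.congr' ?_
  filter_upwards [eventually_ge_atTop ⌈-Real.log r⌉₊] with n hn
  rw [cut_eq_of_pos h, eq_comm]
  apply Real.smoothTransition.one_of_one_le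
  have h1 : -Real.log r ≤ n := (Nat.le_ceil _).trans (by exact_mod_cast hn)
  have h2 : -1 ≤ Real.log r / (n + 1) := by
    rw [le_div_iff₀ (by positivity)]; linarith
  linarith

lemma deriv_smoothTransition_eq_zero {x : ℝ} (hx : x ∉ Icc (0 : ℝ) 1) :
    deriv Real.smoothTransition x = 0 := by
  rw [mem_Icc, not_and_or, not_le, not_le] at hx
  rcases hx with hx | hx
  · have : Real.smoothTransition =ᶠ[𝓝 x] fun _ => 0 := by
      filter_upwards [gt_mem_nhds hx] with y hy using Real.smoothTransition.zero_of_nonpos hy.le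
    rw [this.deriv_eq, deriv_const]
  · have : Real.smoothTransition =ᶠ[𝓝 x] fun _ => 1 := by
      filter_upwards [lt_mem_nhds hx] with y hy using Real.smoothTransition.one_of_one_le hy.le
    rw [this.deriv_eq, deriv_const]

lemma exists_bound_deriv_smoothTransition : ∃ C : ℝ, ∀ x, |deriv Real.smoothTransition x| ≤ C := by
  have h1 : HasCompactSupport (deriv Real.smoothTransition) :=
    HasCompactSupport.intro isCompact_Icc fun x hx => deriv_smoothTransition_eq_zero hx
  have h2 : Continuous (deriv Real.smoothTransition) :=
    (Real.smoothTransition.contDiff (n := 1)).continuous_deriv (by norm_num)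
  obtain ⟨C, hC⟩ := h1.exists_bound_of_continuous h2
  exact ⟨C, fun x => hC x⟩

lemma deriv_cut {n : ℕ} {r : ℝ} (h : 0 < r) : deriv (cut n) r =
    deriv Real.smoothTransition (2 + Real.log r / (n + 1)) * (r⁻¹ / (n + 1)) := by
  rw [(cut_eventuallyEq h).deriv_eq]
  have h1 : HasDerivAt (fun r => 2 + Real.log r / (n + 1)) (r⁻¹ / (n + 1)) r :=
    ((Real.hasDerivAt_log h.ne').div_const _).const_add _
  have h2 : DifferentiableAt ℝ Real.smoothTransition (2 + Real.log r / (n + 1)) :=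
    (Real.smoothTransition.contDiff (n := 1)).differentiable (by norm_num) _
  exact (h2.hasDerivAt.comp r h1).deriv

/-- The derivative is of size 1/((n+1) r), with a constant independent of n. For frequencies m ≠ 0
its square is therefore a small multiple of the weight m²/r² already present in the energy. -/
lemma exists_deriv_cut_le : ∃ C : ℝ, 0 ≤ C ∧ ∀ n : ℕ, ∀ r : ℝ, 0 < r →
    (deriv (cut n) r) ^ 2 ≤ C / (n + 1) ^ 2 * (1 / r ^ 2) := by
  obtain ⟨C, hC⟩ := exists_bound_deriv_smoothTransition
  refine ⟨C ^ 2, by positivity, fun n r hr => ?_⟩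
  rw [deriv_cut hr, mul_pow]
  have h1 : deriv Real.smoothTransition (2 + Real.log r / (n + 1)) ^ 2 ≤ C ^ 2 := by
    rw [← sq_abs]
    exact pow_le_pow_left₀ (abs_nonneg _) (hC _) 2
  have h2 : C ^ 2 / (n + 1) ^ 2 * (1 / r ^ 2) = C ^ 2 * (r⁻¹ / (n + 1)) ^ 2 := by
    field_simp
  rw [h2]
  gcongr

lemma deriv_cut_eq_zero {n : ℕ} {r : ℝ} (h : 0 < r)
    (h' : r ∉ Icc (Real.exp (-(2 * (n + 1)))) (Real.exp (-(n + 1)))) : deriv (cut n) r = 0 := by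
  rw [deriv_cut h, deriv_smoothTransition_eq_zero, zero_mul]
  intro h1
  apply h'
  have hn : (0:ℝ) < n + 1 := by positivity
  constructor
  · rw [← Real.le_log_iff_exp_le h]
    have := (le_div_iff₀ hn).1 (by linarith [h1.1] : -2 ≤ Real.log r / (n + 1))
    linarith
  · rw [← Real.log_le_iff_le_exp h]
    have := (div_le_iff₀ hn).1 (by linarith [h1.2] : Real.log r / (n + 1) ≤ -1)
    linarith

/-- The cut-off varies only where -2(n+1) ≤ log r ≤ -(n+1). There the integrand is at most C/((n+1)²
r), and the logarithmic length n+1 leaves C/(n+1). This is the zero capacity of a point in the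
plane. -/
lemma lintegral_deriv_cut_le : ∃ C : ℝ, ∀ n : ℕ,
    ∫⁻ r in Ioi (0 : ℝ), ENNReal.ofReal ((deriv (cut n) r) ^ 2) * ENNReal.ofReal r ≤
      ENNReal.ofReal (C / (n + 1)) := by
  obtain ⟨C, hC0, hC⟩ := exists_deriv_cut_le
  refine ⟨C, fun n => ?_⟩
  set a := Real.exp (-(2 * ((n : ℝ) + 1))) with ha
  set b := Real.exp (-((n : ℝ) + 1)) with hb
  have ha0 : 0 < a := Real.exp_pos _
  have hab : a ≤ b := Real.exp_le_exp.2 (by linarith [n.cast_nonneg (α := ℝ)])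
  have h1 : ∀ r ∈ Ioi (0 : ℝ), ENNReal.ofReal ((deriv (cut n) r) ^ 2) * ENNReal.ofReal r ≤
      (Icc a b).indicator (fun r => ENNReal.ofReal (C / (n + 1) ^ 2 * r⁻¹)) r := by
    intro r hr
    have hr : 0 < r := hr
    by_cases hrab : r ∈ Icc a b
    · rw [indicator_of_mem hrab, ← ENNReal.ofReal_mul (by positivity)]
      refine ENNReal.ofReal_le_ofReal ((mul_le_mul_of_nonneg_right (hC n r hr) hr.le).trans_eq ?_)
      field_simp
    · rw [deriv_cut_eq_zero hr hrab]
      simp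
  refine (setLIntegral_mono' measurableSet_Ioi h1).trans ((setLIntegral_le_lintegral _ _).trans ?_)
  rw [lintegral_indicator measurableSet_Icc]
  have hint : IntegrableOn (fun r : ℝ => C / (n + 1) ^ 2 * r⁻¹) (Icc a b) := by
    refine ContinuousOn.integrableOn_Icc (continuousOn_const.mul (continuousOn_inv₀.mono ?_))
    intro r hr
    exact (ha0.trans_le hr.1).ne'
  rw [← ofReal_integral_eq_lintegral_ofReal hint]
  · refine ENNReal.ofReal_le_ofReal (le_of_eq ?_)
    rw [integral_const_mul, integral_Icc_eq_integral_Ioc, ← intervalIntegral.integral_of_le hab,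
      integral_inv_of_pos ha0 (ha0.trans_le hab), ha, hb, ← Real.exp_sub, Real.log_exp]
    field_simp
    ring
  · filter_upwards [ae_restrict_mem measurableSet_Icc] with r hr
    have : 0 < r := ha0.trans_le hr.1
    positivity

section Domain

variable {D : Set Space} (hD : IsAxisymmetricDomain D)

include hD

lemma exists_bound_snd : ∃ R : ℝ, ∀ q ∈ halfSection D, q.2 ∈ Icc (-R) R := by
  obtain ⟨R, hR⟩ := hD.isBounded.exists_norm_le
  refine ⟨R, fun q hq => ?_⟩
  have h := (norm_snd_le _).trans (hR _ hq.2)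
  exact abs_le.1 h

lemma tendsto_lintegral_deriv_cut :
    Tendsto (fun n => ∫⁻ q, ENNReal.ofReal ((deriv (cut n) q.1) ^ 2) ∂mer (halfSection D))
      atTop (𝓝 0) := by
  obtain ⟨R, hR⟩ := exists_bound_snd hD
  obtain ⟨C, hC⟩ := lintegral_deriv_cut_le
  have hle : ∀ n, ∫⁻ q, ENNReal.ofReal ((deriv (cut n) q.1) ^ 2) ∂mer (halfSection D) ≤
      ENNReal.ofReal (C / (n + 1)) * volume (Icc (-R) R) := by
    intro n
    rw [lintegral_mer]
    have hsub : halfSection D ⊆ Ioi (0:ℝ) ×ˢ Icc (-R) R := fun q hq => ⟨hq.1, hR q hq⟩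
    refine (lintegral_mono_set hsub).trans ?_
    have hm : Measurable fun r : ℝ => ENNReal.ofReal ((deriv (cut n) r) ^ 2) * ENNReal.ofReal r := by
      have := measurable_deriv (cut n)
      fun_prop
    rw [Measure.volume_eq_prod, ← Measure.prod_restrict]
    have := lintegral_prod_mul (μ := volume.restrict (Ioi (0:ℝ))) (ν := volume.restrict (Icc (-R) R))
      hm.aemeasurable (aemeasurable_const (b := (1 : ℝ≥0∞)))
    simp only [mul_one, lintegral_const, one_mul, Measure.restrict_apply_univ] at this
    rw [this]
    gcongr
    exact hC n
  refine tendsto_of_tendsto_of_tendsto_of_le_of_le tendsto_const_nhds ?_ (fun _ => zero_le) hle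
  have h1 : Tendsto (fun n : ℕ => ENNReal.ofReal (C / (n + 1))) atTop (𝓝 0) := by
    rw [← ENNReal.ofReal_zero]
    refine (ENNReal.continuous_ofReal.tendsto 0).comp ?_
    have := (tendsto_const_div_atTop_nhds_zero_nat C).comp (tendsto_add_atTop_nat 1)
    simpa [Function.comp_def] using this
  have h2 := ENNReal.Tendsto.mul_const (b := volume (Icc (-R) R)) h1 (Or.inr (by simp))
  rwa [zero_mul] at h2

end Domain

/-! ### Approximation of scalar modes by test functions -/

/-- The partial derivative `∂_r`. -/
def dr (φ : Plane → ℂ) (q : Plane) : ℂ := fderiv ℝ φ q (1, 0)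

/-- The partial derivative `∂_z`. -/
def dz (φ : Plane → ℂ) (q : Plane) : ℂ := fderiv ℝ φ q (0, 1)

/-- Multiplication by the cut-off function. -/
def cutMul (n : ℕ) (w : Plane → ℂ) (q : Plane) : ℂ := (cut n q.1 : ℂ) * w q

/-- The derivative `∂_r` of the product with the cut-off function. -/
def cutDeriv (n : ℕ) (w a : Plane → ℂ) (q : Plane) : ℂ :=
  (cut n q.1 : ℂ) * a q + ((deriv (cut n) q.1 : ℝ) : ℂ) * w q

lemma measurable_cut_fst (n : ℕ) : Measurable fun q : Plane => (cut n q.1 : ℂ) := by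
  have := (contDiff_cut n).continuous.measurable
  fun_prop

lemma measurable_deriv_cut_fst (n : ℕ) : Measurable fun q : Plane => ((deriv (cut n) q.1 : ℝ) : ℂ) := by
  have := measurable_deriv (cut n)
  fun_prop

lemma MeasTriple.cut {Ω : Set Plane} {w a b : Plane → ℂ} (h : MeasTriple Ω w a b) (n : ℕ) :
    MeasTriple Ω (cutMul n w) (cutDeriv n w a) (cutMul n b) :=
  ⟨(measurable_cut_fst n).aestronglyMeasurable.mul h.fst,
    ((measurable_cut_fst n).aestronglyMeasurable.mul h.snd).add
      ((measurable_deriv_cut_fst n).aestronglyMeasurable.mul h.fst),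
    (measurable_cut_fst n).aestronglyMeasurable.mul h.trd⟩

lemma MeasTriple.sub {Ω : Set Plane} {w a b w' a' b' : Plane → ℂ} (h : MeasTriple Ω w a b)
    (h' : MeasTriple Ω w' a' b') : MeasTriple Ω (w - w') (a - a') (b - b') :=
  ⟨h.fst.sub h'.fst, h.snd.sub h'.snd, h.trd.sub h'.trd⟩

lemma IsTest.measTriple {U Ω : Set Plane} {φ : Plane → ℂ} (hφ : IsTest U φ) :
    MeasTriple Ω φ (dr φ) (dz φ) :=
  ⟨hφ.smooth.continuous.aestronglyMeasurable,
    (hφ.fderiv_apply _).smooth.continuous.aestronglyMeasurable,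
    (hφ.fderiv_apply _).smooth.continuous.aestronglyMeasurable⟩

section Domain

variable {D : Set Space} (hD : IsAxisymmetricDomain D) {w a b : Plane → ℂ} {m : ℤ}

include hD

/-- Dominated convergence handles the energy multiplied by (1 - cut)². The only other contribution
is the product of w with the derivative of the cut-off, which is assumed to tend to zero because the
reason depends on m. -/
lemma tendsto_fullEnergy_sub_cut (h : MeasTriple (halfSection D) w a b)
    (hE : fullEnergy (halfSection D) m w a b < ⊤)
    (hd : Tendsto (fun n => ∫⁻ q, ENNReal.ofReal ((deriv (cut n) q.1) ^ 2) * ‖w q‖ₑ ^ 2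
      ∂mer (halfSection D)) atTop (𝓝 0)) :
    Tendsto (fun n => fullEnergy (halfSection D) m (w - cutMul n w) (a - cutDeriv n w a)
      (b - cutMul n b)) atTop (𝓝 0) := by
  set F : Plane → ℝ≥0∞ := fun q => ‖w q‖ₑ ^ 2 + (‖a q‖ₑ ^ 2 + ‖b q‖ₑ ^ 2 + wt m q * ‖w q‖ₑ ^ 2)
    with hF
  have hFm : AEMeasurable F (mer (halfSection D)) := h.aemeasurable m
  have hcm : ∀ n, Measurable fun q : Plane => ENNReal.ofReal ((1 - cut n q.1) ^ 2) := by
    intro n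
    have := (contDiff_cut n).continuous.measurable
    fun_prop
  have h1 : Tendsto (fun n => ∫⁻ q, ENNReal.ofReal ((1 - cut n q.1) ^ 2) * F q ∂mer (halfSection D))
      atTop (𝓝 (∫⁻ q, 0 ∂mer (halfSection D))) := by
    refine tendsto_lintegral_of_dominated_convergence' F
      (fun n => (hcm n).aemeasurable.mul hFm) (fun n => ae_of_all _ fun q => ?_) hE.ne ?_
    · have h2 := cut_mem_Icc n q.1
      have h3 : ENNReal.ofReal ((1 - cut n q.1) ^ 2) ≤ 1 := by
        rw [← ENNReal.ofReal_one]
        refine ENNReal.ofReal_le_ofReal ?_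
        nlinarith [h2.1, h2.2]
      change ENNReal.ofReal _ * F q ≤ F q
      calc _ ≤ 1 * F q := by gcongr
        _ = F q := one_mul _
    · filter_upwards [ae_mer_mem hD.isOpen_halfSection.measurableSet (fun _ h => h.1),
        ae_lt_top' hFm hE.ne] with q hq hq2
      have h2 : Tendsto (fun n => ENNReal.ofReal ((1 - cut n q.1) ^ 2)) atTop (𝓝 0) := by
        have h3 := ((tendsto_const_nhds (x := (1:ℝ))).sub (tendsto_cut hq.1)).pow 2
        have h4 := (ENNReal.continuous_ofReal.tendsto _).comp h3
        simpa [Function.comp_def] using h4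
      have := ENNReal.Tendsto.mul_const (b := F q) h2 (Or.inr hq2.ne)
      rwa [zero_mul] at this
  rw [lintegral_zero] at h1
  have h2 := (ENNReal.Tendsto.const_mul (a := 2) h1 (Or.inr (by simp))).add
    (ENNReal.Tendsto.const_mul (a := 2) hd (Or.inr (by simp)))
  simp only [mul_zero, add_zero] at h2
  refine tendsto_of_tendsto_of_tendsto_of_le_of_le tendsto_const_nhds h2 (fun _ => zero_le) fun n => ?_
  simp only
  have hcF : AEMeasurable (fun q => 2 * (ENNReal.ofReal ((1 - cut n q.1) ^ 2) * F q))
      (mer (halfSection D)) := ((hcm n).aemeasurable.mul hFm).const_mul 2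
  rw [← lintegral_const_mul' _ _ (by simp), ← lintegral_const_mul' _ _ (by simp),
    ← lintegral_add_left' hcF]
  refine lintegral_mono fun q => ?_
  have e1 : (w - cutMul n w) q = ((1 - cut n q.1 : ℝ) : ℂ) * w q := by
    simp [cutMul]; ring
  have e2 : (a - cutDeriv n w a) q =
      ((1 - cut n q.1 : ℝ) : ℂ) * a q - ((deriv (cut n) q.1 : ℝ) : ℂ) * w q := by
    simp [cutDeriv]; ring
  have e3 : (b - cutMul n b) q = ((1 - cut n q.1 : ℝ) : ℂ) * b q := by
    simp [cutMul]; ring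
  have h4 := enorm_sub_sq_le (((1 - cut n q.1 : ℝ) : ℂ) * a q) (((deriv (cut n) q.1 : ℝ) : ℂ) * w q)
  rw [e1, e2, e3]
  rw [enorm_ofReal_mul_sq, enorm_ofReal_mul_sq] at h4
  rw [enorm_ofReal_mul_sq, enorm_ofReal_mul_sq]
  set t := ENNReal.ofReal ((1 - cut n q.1) ^ 2)
  set d := ENNReal.ofReal (deriv (cut n) q.1 ^ 2)
  calc _ ≤ t * ‖w q‖ₑ ^ 2 + (2 * (t * ‖a q‖ₑ ^ 2) + 2 * (d * ‖w q‖ₑ ^ 2) + t * ‖b q‖ₑ ^ 2 +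
        wt m q * (t * ‖w q‖ₑ ^ 2)) := by gcongr
    _ ≤ 2 * (t * ‖w q‖ₑ ^ 2) + (2 * (t * ‖a q‖ₑ ^ 2) + 2 * (d * ‖w q‖ₑ ^ 2) +
        2 * (t * ‖b q‖ₑ ^ 2) + 2 * (wt m q * (t * ‖w q‖ₑ ^ 2))) := by
        have two : ∀ x : ℝ≥0∞, x ≤ 2 * x := fun x => by rw [two_mul]; exact le_self_add
        exact add_le_add (two _) (add_le_add (add_le_add le_rfl (two _)) (two _))
    _ = _ := by rw [hF]; ring

/-- For fixed n the cut-off vanishes for r ≤ δ, so m²/r² and the derivative of the cut-off are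
bounded on its support. Approximation in the energy of frequency 0 then controls the energy of every
frequency. -/
lemma exists_fullEnergy_cut_le (n : ℕ) (m : ℤ) : ∃ K : ℝ≥0∞, K < ⊤ ∧ ∀ w a b : Plane → ℂ,
    fullEnergy (halfSection D) m (cutMul n w) (cutDeriv n w a) (cutMul n b) ≤
      K * fullEnergy (halfSection D) 0 w a b := by
  obtain ⟨C, hC0, hC⟩ := exists_deriv_cut_le
  set δ := Real.exp (-(2 * ((n : ℝ) + 1))) with hδ
  have hδ0 : 0 < δ := Real.exp_pos _
  set M := ENNReal.ofReal ((m : ℝ) ^ 2 / δ ^ 2)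
  set M' := ENNReal.ofReal (C / (n + 1) ^ 2 * (1 / δ ^ 2))
  have hK : 2 + M + 2 * M' < ⊤ := by
    refine ENNReal.add_lt_top.2 ⟨ENNReal.add_lt_top.2 ⟨by simp, ENNReal.ofReal_lt_top⟩,
      ENNReal.mul_lt_top (by simp) ENNReal.ofReal_lt_top⟩
  refine ⟨2 + M + 2 * M', hK, fun w a b => ?_⟩
  rw [fullEnergy, fullEnergy, ← lintegral_const_mul' _ _ hK.ne]
  refine lintegral_mono_ae ?_
  filter_upwards [ae_mer_mem hD.isOpen_halfSection.measurableSet (fun _ h => h.1)] with q hq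
  have hc := cut_mem_Icc n q.1
  set t := ENNReal.ofReal (cut n q.1 ^ 2) with ht
  set d := ENNReal.ofReal (deriv (cut n) q.1 ^ 2) with hd
  have ht1 : t ≤ 1 := by
    rw [← ENNReal.ofReal_one]
    refine ENNReal.ofReal_le_ofReal ?_
    nlinarith [hc.1, hc.2]
  have hd1 : d ≤ M' := by
    refine ENNReal.ofReal_le_ofReal ?_
    by_cases h : q.1 ∈ Icc (Real.exp (-(2 * ((n : ℝ) + 1)))) (Real.exp (-((n : ℝ) + 1)))
    · refine (hC n q.1 hq.1).trans ?_
      have : δ ≤ q.1 := h.1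
      gcongr
    · rw [deriv_cut_eq_zero hq.1 h, zero_pow two_ne_zero]
      positivity
  have hwt : wt m q * t ≤ M := by
    by_cases h : q.1 ≤ δ
    · have : t = 0 := by rw [ht, cut_eq_zero h]; simp
      rw [this, mul_zero]; exact zero_le
    · calc wt m q * t ≤ wt m q * 1 := by gcongr
        _ = wt m q := mul_one _
        _ ≤ M := by
          refine ENNReal.ofReal_le_ofReal ?_
          have := not_le.1 h
          gcongr
  have h4 := enorm_add_sq_le ((cut n q.1 : ℂ) * a q) (((deriv (cut n) q.1 : ℝ) : ℂ) * w q)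
  rw [enorm_ofReal_mul_sq, enorm_ofReal_mul_sq] at h4
  rw [wt_zero, zero_mul, add_zero]
  simp only [cutMul, cutDeriv]
  rw [enorm_ofReal_mul_sq, enorm_ofReal_mul_sq]
  set W := ‖w q‖ₑ ^ 2
  set A := ‖a q‖ₑ ^ 2
  set B := ‖b q‖ₑ ^ 2
  calc _ ≤ t * W + (2 * (t * A) + 2 * (d * W) + t * B + wt m q * (t * W)) := by gcongr
    _ = t * W + (2 * (t * A) + 2 * (d * W) + t * B + (wt m q * t) * W) := by ring
    _ ≤ 1 * W + (2 * (1 * A) + 2 * (M' * W) + 1 * B + M * W) := by gcongr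
    -- Nonnegative slack is added so that the sum factors as the constant times the energy density.
    _ ≤ 1 * W + (2 * (1 * A) + 2 * (M' * W) + 1 * B + M * W) +
        (W + B + (M + 2 * M') * (A + B)) := le_self_add
    _ = (2 + M + 2 * M') * (W + (A + B)) := by ring

lemma mem_halfSection_of_mem_closure {q : Plane} (hq : q ∈ closure (halfSection D)) (h0 : 0 < q.1)
    (hΓ : q ∉ meridianBoundary D) : q ∈ halfSection D := by
  refine ⟨h0, by_contra fun h => hΓ ⟨h0.le, ?_⟩⟩
  have hcont : Continuous fun q : Plane => (((q.1, 0), q.2) : Space) := by fun_prop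
  have h1 : (((q.1, 0), q.2) : Space) ∈ closure D :=
    map_mem_closure (f := fun q : Plane => (((q.1, 0), q.2) : Space)) hcont hq fun q hq => hq.2
  rw [hD.isOpen.frontier_eq]
  exact ⟨h1, h⟩

/-- A test function that avoids Γ becomes one on Ω once it is cut off near the axis: within the
closure of Ω, points with r ≥ δ that are not in Γ belong to Ω. The truncation to Ω thus creates no
jump. -/
lemma exists_isTest_cut {φ : Plane → ℂ} (hφ : IsTest (meridianBoundary D)ᶜ φ) (n : ℕ) :
    ∃ ψ, IsTest (halfSection D) ψ ∧ ∀ q ∈ halfSection D, ψ q = cutMul n φ q ∧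
      dr ψ q = cutDeriv n φ (dr φ) q ∧ dz ψ q = cutMul n (dz φ) q := by
  classical
  set δ := Real.exp (-(2 * ((n : ℝ) + 1))) with hδ
  have hδ0 : 0 < δ := Real.exp_pos _
  have hΩ := hD.isOpen_halfSection
  set ψ : Plane → ℂ := (halfSection D).indicator (cutMul n φ) with hψ
  have hcut : ContDiff ℝ (⊤ : ℕ∞) fun q : Plane => (cut n q.1 : ℂ) :=
    Complex.ofRealCLM.contDiff.comp ((contDiff_cut n).comp contDiff_fst)
  have heq : ∀ q ∈ halfSection D, ψ =ᶠ[𝓝 q] cutMul n φ := by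
    intro q hq
    filter_upwards [hΩ.mem_nhds hq] with q' hq' using indicator_of_mem hq' _
  set K := tsupport φ ∩ (closure (halfSection D) ∩ {q : Plane | δ ≤ q.1}) with hK
  have hKc : IsCompact K := hφ.compact.isCompact.inter_right
    (isClosed_closure.inter (isClosed_le continuous_const continuous_fst))
  have hKΩ : K ⊆ halfSection D := fun q hq =>
    mem_halfSection_of_mem_closure hD hq.2.1 (hδ0.trans_le hq.2.2) (hφ.support_subset hq.1)
  refine ⟨ψ, IsTest.of_eventually hKc hKΩ (fun q hq => ?_) (fun q hq => ?_), fun q hq => ?_⟩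
  · by_cases h1 : q ∈ halfSection D
    · rw [hψ, indicator_of_mem h1, cutMul]
      by_cases h2 : q ∈ tsupport φ
      · have h3 : q.1 ≤ δ := by
          by_contra h3
          exact hq ⟨h2, subset_closure h1, (not_le.1 h3).le⟩
        rw [cut_eq_zero h3, Complex.ofReal_zero, zero_mul]
      · rw [image_eq_zero_of_notMem_tsupport h2, mul_zero]
    · exact indicator_of_notMem h1 _
  · refine ContDiffAt.congr_of_eventuallyEq ?_ (heq q (hKΩ hq))
    exact (hcut.mul hφ.smooth).contDiffAt
  · have h1 : HasFDerivAt (fun q : Plane => (cut n q.1 : ℂ))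
        (Complex.ofRealCLM.comp ((ContinuousLinearMap.smulRight (1 : ℝ →L[ℝ] ℝ)
          (deriv (cut n) q.1)).comp (ContinuousLinearMap.fst ℝ ℝ ℝ))) q := by
      have g : HasFDerivAt (fun q : Plane => cut n q.1)
          ((ContinuousLinearMap.smulRight (1 : ℝ →L[ℝ] ℝ) (deriv (cut n) q.1)).comp
            (ContinuousLinearMap.fst ℝ ℝ ℝ)) q :=
        HasFDerivAt.comp (g := cut n) q
          ((contDiff_cut n).differentiable (by simp) q.1).hasDerivAt.hasFDerivAt hasFDerivAt_fst
      exact Complex.ofRealCLM.hasFDerivAt.comp q g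
    have h2 := h1.fun_mul (hφ.smooth.differentiable (by simp) q).hasFDerivAt
    refine ⟨(heq q hq).eq_of_nhds, ?_, ?_⟩
    · rw [dr, (heq q hq).fderiv_eq]
      change fderiv ℝ (fun q => (cut n q.1 : ℂ) * φ q) q (1, 0) = _
      rw [h2.fderiv]
      simp [cutDeriv, dr, mul_comm]
    · rw [dz, (heq q hq).fderiv_eq]
      change fderiv ℝ (fun q => (cut n q.1 : ℂ) * φ q) q (0, 1) = _
      rw [h2.fderiv]
      simp [cutMul, dz]

/-- Density up to the axis, by two different orders of approximation and cut-off. For m = 0 the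
function is first replaced by a smooth, hence bounded one, whose cut-off error tends to zero by zero
capacity. For m ≠ 0 the approximants φ may have infinite energy of frequency m, as they need not
vanish on the axis; so w is cut off first, its error being controlled by (m²/r²)|w|². -/
theorem exists_isTest_fullEnergy_sub_lt (h : MeasTriple (halfSection D) w a b)
    (hE : fullEnergy (halfSection D) m w a b < ⊤)
    (happ : ∀ ε : ℝ≥0∞, 0 < ε → ∃ φ, IsTest (meridianBoundary D)ᶜ φ ∧
      fullEnergy (halfSection D) 0 (w - φ) (a - dr φ) (b - dz φ) < ε)
    {ε : ℝ≥0∞} (hε : 0 < ε) : ∃ ψ, IsTest (halfSection D) ψ ∧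
      fullEnergy (halfSection D) m (w - ψ) (a - dr ψ) (b - dz ψ) ≤ ε := by
  have h4 : 0 < ε / 4 := ENNReal.div_pos hε.ne' (by simp)
  have hε4 : 2 * (ε / 4) + 2 * (ε / 4) = ε := by
    rw [← add_mul, show (2 : ℝ≥0∞) + 2 = 4 by norm_num]
    exact ENNReal.mul_div_cancel (by simp) (by simp)
  have hmem := ae_mer_mem hD.isOpen_halfSection.measurableSet (fun _ h => h.1)
  have split : ∀ {x y z : Plane → ℂ}, x - z = (x - y) + (y - z) := fun {x y z} => by ring
  rcases eq_or_ne m 0 with rfl | hm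
  · obtain ⟨φ, hφ, hlt⟩ := happ _ h4
    have hφm : MeasTriple (halfSection D) φ (dr φ) (dz φ) := hφ.measTriple
    have hφE : fullEnergy (halfSection D) 0 φ (dr φ) (dz φ) < ⊤ := by
      have h5 := fullEnergy_add_le (m := 0) (w' := φ - w) (a' := dr φ - a) (b' := dz φ - b) h
      simp only [add_sub_cancel] at h5
      refine h5.trans_lt (ENNReal.add_lt_top.2 ⟨ENNReal.mul_lt_top (by simp) hE,
        ENNReal.mul_lt_top (by simp) ?_⟩)
      have : fullEnergy (halfSection D) 0 (φ - w) (dr φ - a) (dz φ - b) =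
          fullEnergy (halfSection D) 0 (w - φ) (a - dr φ) (b - dz φ) := by
        refine lintegral_congr fun q => ?_
        simp only [Pi.sub_apply, enorm_sub_rev]
      rw [this]
      by_contra hcon
      rw [not_lt_top_iff.1 hcon] at hlt
      exact not_top_lt hlt
    -- Boundedness is the gain from passing to φ: the integral of the squared derivative of the
    -- cut-off against |φ|² is at most B² times a null sequence.
    obtain ⟨B, hB⟩ := hφ.compact.exists_bound_of_continuous hφ.smooth.continuous
    have hd : Tendsto (fun n => ∫⁻ q, ENNReal.ofReal ((deriv (cut n) q.1) ^ 2) * ‖φ q‖ₑ ^ 2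
        ∂mer (halfSection D)) atTop (𝓝 0) := by
      have h6 := ENNReal.Tendsto.mul_const (b := ENNReal.ofReal (B ^ 2))
        (tendsto_lintegral_deriv_cut hD) (Or.inr (by simp))
      rw [zero_mul] at h6
      refine tendsto_of_tendsto_of_tendsto_of_le_of_le tendsto_const_nhds h6 (fun _ => zero_le)
        fun n => ?_
      simp only
      rw [← lintegral_mul_const' _ _ (by simp)]
      refine lintegral_mono fun q => ?_
      gcongr
      rw [← ofReal_norm_sq]
      exact ENNReal.ofReal_le_ofReal (pow_le_pow_left₀ (norm_nonneg _) (hB q) 2)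
    obtain ⟨n, hn⟩ := ((tendsto_fullEnergy_sub_cut hD hφm hφE hd).eventually_lt_const h4).exists
    obtain ⟨ψ, hψ, hψe⟩ := exists_isTest_cut hD hφ n
    refine ⟨ψ, hψ, ?_⟩
    have h7 : fullEnergy (halfSection D) 0 (φ - ψ) (dr φ - dr ψ) (dz φ - dz ψ) =
        fullEnergy (halfSection D) 0 (φ - cutMul n φ) (dr φ - cutDeriv n φ (dr φ))
          (dz φ - cutMul n (dz φ)) := by
      refine fullEnergy_congr ?_
      filter_upwards [hmem] with q hq
      obtain ⟨g1, g2, g3⟩ := hψe q hq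
      simp only [Pi.sub_apply, g1, g2, g3, and_self]
    rw [split (x := w) (y := φ), split (x := a) (y := dr φ), split (x := b) (y := dz φ), ← hε4]
    refine (fullEnergy_add_le (h.sub hφm)).trans ?_
    rw [h7]
    gcongr
  · have hd : Tendsto (fun n => ∫⁻ q, ENNReal.ofReal ((deriv (cut n) q.1) ^ 2) * ‖w q‖ₑ ^ 2
        ∂mer (halfSection D)) atTop (𝓝 0) := by
      obtain ⟨C, hC0, hC⟩ := exists_deriv_cut_le
      have h6 : Tendsto (fun n : ℕ => ENNReal.ofReal (C / (n + 1) ^ 2) *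
          fullEnergy (halfSection D) m w a b) atTop (𝓝 0) := by
        have h1 : Tendsto (fun n : ℕ => ENNReal.ofReal (C / (n + 1) ^ 2)) atTop (𝓝 0) := by
          rw [← ENNReal.ofReal_zero]
          refine (ENNReal.continuous_ofReal.tendsto 0).comp ?_
          have := (tendsto_const_div_pow C 2 (by norm_num)).comp (tendsto_add_atTop_nat 1)
          simpa [Function.comp_def] using this
        have := ENNReal.Tendsto.mul_const (b := fullEnergy (halfSection D) m w a b) h1 (Or.inr hE.ne)
        rwa [zero_mul] at this
      refine tendsto_of_tendsto_of_tendsto_of_le_of_le tendsto_const_nhds h6 (fun _ => zero_le)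
        fun n => ?_
      simp only
      rw [fullEnergy, ← lintegral_const_mul' _ _ (by simp)]
      refine lintegral_mono_ae ?_
      filter_upwards [hmem] with q hq
      have h1 : ENNReal.ofReal ((deriv (cut n) q.1) ^ 2) ≤ ENNReal.ofReal (C / (n + 1) ^ 2) * wt m q := by
        rw [wt, ← ENNReal.ofReal_mul (by positivity)]
        refine ENNReal.ofReal_le_ofReal ((hC n q.1 hq.1).trans ?_)
        have : (1:ℝ) ≤ (m : ℝ) ^ 2 := by
          have : 0 < m ^ 2 := by positivity
          exact_mod_cast this
        gcongr
      calc _ ≤ (ENNReal.ofReal (C / (n + 1) ^ 2) * wt m q) * ‖w q‖ₑ ^ 2 := by gcongr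
        _ = ENNReal.ofReal (C / (n + 1) ^ 2) * (wt m q * ‖w q‖ₑ ^ 2) := by ring
        _ ≤ _ := by
          gcongr
          exact (le_add_self).trans le_add_self
    obtain ⟨n, hn⟩ := ((tendsto_fullEnergy_sub_cut hD h hE hd).eventually_lt_const h4).exists
    obtain ⟨K, hK, hKle⟩ := exists_fullEnergy_cut_le hD n m
    -- The constant K depends on n, so φ is chosen only after n is fixed; the summand 1 avoids
    -- division by zero.
    obtain ⟨φ, hφ, hlt⟩ := happ (ε / 4 / (K + 1))
      (ENNReal.div_pos h4.ne' (ENNReal.add_lt_top.2 ⟨hK, by simp⟩).ne)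
    obtain ⟨ψ, hψ, hψe⟩ := exists_isTest_cut hD hφ n
    refine ⟨ψ, hψ, ?_⟩
    have h7 : fullEnergy (halfSection D) m (cutMul n w - ψ) (cutDeriv n w a - dr ψ)
        (cutMul n b - dz ψ) = fullEnergy (halfSection D) m (cutMul n (w - φ))
          (cutDeriv n (w - φ) (a - dr φ)) (cutMul n (b - dz φ)) := by
      refine fullEnergy_congr ?_
      filter_upwards [hmem] with q hq
      obtain ⟨g1, g2, g3⟩ := hψe q hq
      simp only [Pi.sub_apply, g1, g2, g3, cutMul, cutDeriv]
      refine ⟨by ring, by ring, by ring⟩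
    rw [split (x := w) (y := cutMul n w), split (x := a) (y := cutDeriv n w a),
      split (x := b) (y := cutMul n b), ← hε4]
    refine (fullEnergy_add_le (h.sub (h.cut n))).trans ?_
    rw [h7]
    gcongr
    refine (hKle _ _ _).trans ?_
    calc K * fullEnergy (halfSection D) 0 (w - φ) (a - dr φ) (b - dz φ)
        ≤ (K + 1) * (ε / 4 / (K + 1)) := by gcongr; exact le_self_add
      _ = ε / 4 := ENNReal.mul_div_cancel (by simp) (ENNReal.add_lt_top.2 ⟨hK, by simp⟩).ne

end Domain

/-! ### Weak gradients of single scalar modes -/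

/-- The gradient of `slift m w`, where `a = ∂_r w` and `b = ∂_z w`. -/
def sgrad (m : ℤ) (w a b : Plane → ℂ) : Fin 3 → Space → ℂ :=
  ![fun p => (p.1.1 / (meridian p).1 : ℝ) * slift m a p -
      (p.1.2 / (meridian p).1 : ℝ) * slift m (fun q => Complex.I * m / q.1 * w q) p,
    fun p => (p.1.2 / (meridian p).1 : ℝ) * slift m a p +
      (p.1.1 / (meridian p).1 : ℝ) * slift m (fun q => Complex.I * m / q.1 * w q) p,
    slift m b]

lemma slift_sub (m : ℤ) (w w' : Plane → ℂ) (p : Space) :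
    slift m (w - w') p = slift m w p - slift m w' p := by
  simp only [slift, Pi.sub_apply]; ring

lemma sgrad_sub (m : ℤ) (w a b w' a' b' : Plane → ℂ) (j : Fin 3) (p : Space) :
    sgrad m (w - w') (a - a') (b - b') j p = sgrad m w a b j p - sgrad m w' a' b' j p := by
  fin_cases j <;> simp [sgrad, slift] <;> ring

/-- `sgrad m w a b` is the weak gradient of `slift m w` on `D`. -/
def HasLift (D : Set Space) (m : ℤ) (w a b : Plane → ℂ) : Prop :=
  ∀ d, IsWeakDeriv D (dir d) (slift m w) (sgrad m w a b d)

lemma HasLift.sub {D : Set Space} {m : ℤ} {w a b w' a' b' : Plane → ℂ} (h : HasLift D m w a b)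
    (h' : HasLift D m w' a' b') : HasLift D m (w - w') (a - a') (b - b') := by
  intro d
  have h1 := (h d).add ((h' d).const_mul (-1))
  convert h1 using 1
  · funext p; rw [slift_sub]; ring
  · funext p; rw [sgrad_sub]; ring

lemma isWeakDeriv_of_contDiff {E : Type*} [NormedAddCommGroup E] [NormedSpace ℝ E]
    [MeasureSpace E] [BorelSpace E] [FiniteDimensional ℝ E]
    [(volume : Measure E).IsAddHaarMeasure] {U : Set E} {e : E} {f : E → ℂ}
    (hf : ContDiff ℝ (⊤ : ℕ∞) f) : IsWeakDeriv U e f fun x => fderiv ℝ f x e := by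
  have hf' : Continuous fun x => fderiv ℝ f x e :=
    (hf.continuous_fderiv (by simp)).clm_apply continuous_const
  refine ⟨hf.continuous.locallyIntegrable.locallyIntegrableOn _,
    hf'.locallyIntegrable.locallyIntegrableOn _, fun φ hφ => ?_⟩
  have hd := hφ.fderiv_apply e
  have full : ∀ {g χ : E → ℂ}, Continuous g → IsTest U χ →
      Integrable (fun x => g x * χ x) ∧ ∫ x in U, g x * χ x = ∫ x, g x * χ x := by
    intro g χ hg hχ
    refine ⟨(hg.mul hχ.smooth.continuous).integrable_of_hasCompactSupport hχ.compact.mul_left,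
      setIntegral_eq_integral_of_forall_compl_eq_zero fun x hx => ?_⟩
    rw [image_eq_zero_of_notMem_tsupport fun h => hx (hχ.support_subset h), mul_zero]
  rw [(full hf' hφ).2, (full hf.continuous hd).2,
    integral_mul_fderiv_eq_neg_fderiv_mul_of_integrable (full hf' hφ).1 (full hf.continuous hd).1
      (full hf.continuous hφ).1 (fun x _ => hf.differentiable (by simp) x)
      (fun x _ => hφ.smooth.differentiable (by simp) x), neg_neg]

instance isAddHaarMeasure_plane : (volume : Measure Plane).IsAddHaarMeasure :=
  Measure.prod.instIsAddHaarMeasure volume volume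

instance isAddHaarMeasure_space : (volume : Measure Space).IsAddHaarMeasure :=
  Measure.prod.instIsAddHaarMeasure volume volume

section Domain

variable {D : Set Space} (hD : IsAxisymmetricDomain D) {w a b : Plane → ℂ} {m : ℤ}

include hD

/-- Seen through `cyl`, the map `meridian` is the projection of a product, and preimages of null
sets are null. Almost everywhere measurable functions on the half section therefore lift to D. -/
lemma quasiMeasurePreserving_meridian :
    Measure.QuasiMeasurePreserving meridian (volume.restrict D) (mer (halfSection D)) := by
  have h := measurePreserving_cyl hD
  refine ⟨continuous_meridian.measurable, Measure.AbsolutelyContinuous.mk fun s hs h0 => ?_⟩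
  rw [Measure.map_apply continuous_meridian.measurable hs, ← h.map_eq,
    Measure.map_apply h.measurable (continuous_meridian.measurable hs), measure_eq_zero_iff_ae_notMem]
  have h1 := ae_mer_mem hD.isOpen_halfSection.measurableSet (fun q hq => hq.1)
  filter_upwards [Measure.quasiMeasurePreserving_fst.ae h1,
    Measure.quasiMeasurePreserving_fst.ae (measure_eq_zero_iff_ae_notMem.1 h0)] with x hx hx2
  change meridian (cyl (x.1, x.2)) ∉ s
  rwa [meridian_cyl hx.1.le]

lemma aesm_slift (hw : AEStronglyMeasurable w (mer (halfSection D))) (m : ℤ) :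
    AEStronglyMeasurable (slift m w) (volume.restrict D) :=
  ((measurable_const.mul (measurable_harm m)).aestronglyMeasurable).mul
    (hw.comp_quasiMeasurePreserving (quasiMeasurePreserving_meridian hD))

lemma aesm_sgrad (h : MeasTriple (halfSection D) w a b) (m : ℤ) (d : Fin 3) :
    AEStronglyMeasurable (sgrad m w a b d) (volume.restrict D) := by
  have hc : Measurable fun q : Plane => Complex.I * m / (q.1 : ℂ) := by fun_prop
  have h1 := aesm_slift hD (hc.aestronglyMeasurable.mul h.fst) m
  have h2 := aesm_slift hD h.snd m
  have ux := (measurable_unit (fun p => p.1.1) (by fun_prop)).aestronglyMeasurable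
    (μ := volume.restrict D)
  have uy := (measurable_unit (fun p => p.1.2) (by fun_prop)).aestronglyMeasurable
    (μ := volume.restrict D)
  fin_cases d
  · exact (ux.mul h2).sub (uy.mul h1)
  · exact (uy.mul h2).add (ux.mul h1)
  · exact aesm_slift hD h.trd m

lemma lintegral_of_cyl {f : Space → ℝ≥0∞} (hf : AEMeasurable f (volume.restrict D))
    {F : Plane → ℝ≥0∞} (h : ∀ q : Plane, 0 < q.1 → ∀ θ, f (cyl (q, θ)) = ‖nrm‖ₑ ^ 2 * F q) :
    ∫⁻ p in D, f p = ∫⁻ q, F q ∂mer (halfSection D) := by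
  rw [← lintegral_cyl hD hf]
  refine lintegral_congr_ae ?_
  filter_upwards [ae_mer_mem hD.isOpen_halfSection.measurableSet (fun q hq => hq.1)] with q hq
  simp only [h q hq.1]
  rw [lintegral_const, mul_right_comm, enorm_nrm_sq, one_mul]

lemma enorm_slift_cyl (m : ℤ) (w : Plane → ℂ) {q : Plane} (hq : 0 < q.1) (θ : ℝ) :
    ‖slift m w (cyl (q, θ))‖ₑ ^ 2 = ‖nrm‖ₑ ^ 2 * ‖w q‖ₑ ^ 2 := by
  have : ‖Complex.exp (Complex.I * m * θ)‖ₑ = 1 := by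
    rw [← ofReal_norm, norm_exp_I, ENNReal.ofReal_one]
  rw [slift_cyl _ _ hq, enorm_mul, enorm_mul, this, mul_one, mul_pow]

lemma lintegral_slift (hw : AEStronglyMeasurable w (mer (halfSection D))) (m : ℤ) :
    ∫⁻ p in D, ‖slift m w p‖ₑ ^ 2 = ∫⁻ q, ‖w q‖ₑ ^ 2 ∂mer (halfSection D) :=
  lintegral_of_cyl hD ((aesm_slift hD hw m).enorm.pow_const 2) fun _ hq θ =>
    enorm_slift_cyl hD m w hq θ

omit hD in
lemma sgrad_cyl (m : ℤ) (w a b : Plane → ℂ) {q : Plane} (hq : 0 < q.1) (θ : ℝ) :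
    sgrad m w a b 0 (cyl (q, θ)) = Real.cos θ * (nrm * Complex.exp (Complex.I * m * θ) * a q) -
      Real.sin θ * (nrm * Complex.exp (Complex.I * m * θ) * (Complex.I * m / q.1 * w q)) ∧
    sgrad m w a b 1 (cyl (q, θ)) = Real.sin θ * (nrm * Complex.exp (Complex.I * m * θ) * a q) +
      Real.cos θ * (nrm * Complex.exp (Complex.I * m * θ) * (Complex.I * m / q.1 * w q)) ∧
    sgrad m w a b 2 (cyl (q, θ)) = nrm * Complex.exp (Complex.I * m * θ) * b q := by
  have h1 : (cyl (q, θ)).1.1 / (meridian (cyl (q, θ))).1 = Real.cos θ := by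
    rw [meridian_cyl hq.le]; exact mul_div_cancel_left₀ _ hq.ne'
  have h2 : (cyl (q, θ)).1.2 / (meridian (cyl (q, θ))).1 = Real.sin θ := by
    rw [meridian_cyl hq.le]; exact mul_div_cancel_left₀ _ hq.ne'
  refine ⟨?_, ?_, slift_cyl _ _ hq θ⟩
  · change ((_ / _ : ℝ) : ℂ) * _ - ((_ / _ : ℝ) : ℂ) * _ = _
    rw [h1, h2, slift_cyl _ _ hq, slift_cyl _ _ hq]
  · change ((_ / _ : ℝ) : ℂ) * _ + ((_ / _ : ℝ) : ℂ) * _ = _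
    rw [h1, h2, slift_cyl _ _ hq, slift_cyl _ _ hq]

lemma enorm_sgrad_cyl (m : ℤ) (w a b : Plane → ℂ) {q : Plane} (hq : 0 < q.1) (θ : ℝ) :
    ∑ d, ‖sgrad m w a b d (cyl (q, θ))‖ₑ ^ 2 = ‖nrm‖ₑ ^ 2 * (‖a q‖ₑ ^ 2 + ‖b q‖ₑ ^ 2 +
      ENNReal.ofReal ((m : ℝ) ^ 2 / q.1 ^ 2) * ‖w q‖ₑ ^ 2) := by
  obtain ⟨h0, h1, h2⟩ := sgrad_cyl m w a b hq θ
  have key := enorm_rotate_sq (Real.cos θ) (-Real.sin θ) (by rw [neg_sq]; exact Real.cos_sq_add_sin_sq θ)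
    (nrm * Complex.exp (Complex.I * m * θ) * a q)
    (nrm * Complex.exp (Complex.I * m * θ) * (Complex.I * m / q.1 * w q))
  have he : ‖Complex.exp (Complex.I * m * θ)‖ₑ = 1 := by
    rw [← ofReal_norm, norm_exp_I, ENNReal.ofReal_one]
  have hm : ‖Complex.I * m / q.1‖ₑ ^ 2 = ENNReal.ofReal ((m : ℝ) ^ 2 / q.1 ^ 2) := by
    rw [← ofReal_norm_sq, norm_div, norm_mul, Complex.norm_I, one_mul, Complex.norm_intCast,
      Complex.norm_real, Real.norm_eq_abs, div_pow, sq_abs, sq_abs]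
  rw [Fin.sum_univ_three, h2]
  have e0 : sgrad m w a b 0 (cyl (q, θ)) = (Real.cos θ : ℂ) * (nrm * Complex.exp (Complex.I * m * θ) * a q)
      + ((-Real.sin θ : ℝ) : ℂ) * (nrm * Complex.exp (Complex.I * m * θ) * (Complex.I * m / q.1 * w q)) := by
    rw [h0]; push_cast; ring
  have e1 : sgrad m w a b 1 (cyl (q, θ)) = (Real.cos θ : ℂ) *
      (nrm * Complex.exp (Complex.I * m * θ) * (Complex.I * m / q.1 * w q))
      - ((-Real.sin θ : ℝ) : ℂ) * (nrm * Complex.exp (Complex.I * m * θ) * a q) := by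
    rw [h1]; push_cast; ring
  rw [e0, e1, key]
  simp only [enorm_mul, mul_pow, he, ← hm]
  ring

lemma lintegral_sgrad (h : MeasTriple (halfSection D) w a b) (m : ℤ) :
    ∑ d, ∫⁻ p in D, ‖sgrad m w a b d p‖ₑ ^ 2 = modeEnergy (halfSection D) m w a b := by
  rw [← lintegral_finsetSum' _ fun d _ => (aesm_sgrad hD h m d).enorm.pow_const 2]
  exact lintegral_of_cyl hD (Finset.aemeasurable_fun_sum _ fun d _ =>
    (aesm_sgrad hD h m d).enorm.pow_const 2) fun _ hq θ => enorm_sgrad_cyl hD m w a b hq θ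

/-- The radial and angular derivatives are a rotation of the Cartesian ones; inverting it by cos² +
sin² = 1 recovers `sgrad` off the axis, that is, almost everywhere. -/
lemma hasLift_of_isTest {ψ : Plane → ℂ} (hψ : IsTest (halfSection D) ψ) (m : ℤ) :
    HasLift D m ψ (dr ψ) (dz ψ) := by
  intro d
  have hs := isTest_slift hD hψ m
  refine (isWeakDeriv_of_contDiff hs.smooth).congr (ae_eq_refl _) ?_
  filter_upwards [ae_exists_cyl hD] with p hp
  obtain ⟨q, hq, θ, rfl⟩ := hp
  have hdψ := hψ.smooth.differentiable (by simp) q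
  have hdg := hs.smooth.differentiable (by simp) (cyl (q, θ))
  have h1 := fderiv_radial m hq.1 hdψ hdg
  have h2 := fderiv_angular m hq.1 hdg
  have h3 := fderiv_vertical m hq.1 hdψ hdg
  obtain ⟨g0, g1, g2⟩ := sgrad_cyl m ψ (dr ψ) (dz ψ) hq.1 θ
  have hne : (q.1 : ℂ) ≠ 0 := by exact_mod_cast hq.1.ne'
  have hcs : (Real.cos θ : ℂ) ^ 2 + (Real.sin θ : ℂ) ^ 2 = 1 := by
    exact_mod_cast Real.cos_sq_add_sin_sq θ
  have h2' : (Real.cos θ : ℂ) * fderiv ℝ (slift m ψ) (cyl (q, θ)) (dir 1)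
      - Real.sin θ * fderiv ℝ (slift m ψ) (cyl (q, θ)) (dir 0) =
      nrm * Complex.exp (Complex.I * m * θ) * (Complex.I * m / q.1 * ψ q) := by
    field_simp
    linear_combination h2
  fin_cases d
  · change fderiv ℝ (slift m ψ) (cyl (q, θ)) (dir 0) = sgrad m ψ (dr ψ) (dz ψ) 0 (cyl (q, θ))
    rw [g0, dr, ← h1, ← h2']
    linear_combination (-fderiv ℝ (slift m ψ) (cyl (q, θ)) (dir 0)) * hcs
  · change fderiv ℝ (slift m ψ) (cyl (q, θ)) (dir 1) = sgrad m ψ (dr ψ) (dz ψ) 1 (cyl (q, θ))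
    rw [g1, dr, ← h1, ← h2']
    linear_combination (-fderiv ℝ (slift m ψ) (cyl (q, θ)) (dir 1)) * hcs
  · exact h3.trans g2.symm

lemma locallyIntegrableOn_of_sq {u : Space → ℂ} (hu : AEStronglyMeasurable u (volume.restrict D))
    (h : ∫⁻ p in D, ‖u p‖ₑ ^ 2 < ⊤) : LocallyIntegrableOn u D :=
  IntegrableOn.locallyIntegrableOn (μ := volume) (integrable_of_sq hD hu h)

lemma lintegral_slift_le (h : MeasTriple (halfSection D) w a b) (m : ℤ) :
    ∫⁻ p in D, ‖slift m w p‖ₑ ^ 2 ≤ fullEnergy (halfSection D) m w a b := by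
  rw [lintegral_slift hD h.fst, fullEnergy_eq h.fst]
  exact le_self_add

lemma lintegral_sgrad_le (h : MeasTriple (halfSection D) w a b) (m : ℤ) (d : Fin 3) :
    ∫⁻ p in D, ‖sgrad m w a b d p‖ₑ ^ 2 ≤ fullEnergy (halfSection D) m w a b := by
  rw [fullEnergy_eq h.fst, ← lintegral_sgrad hD h]
  exact (Finset.single_le_sum (f := fun d => ∫⁻ p in D, ‖sgrad m w a b d p‖ₑ ^ 2)
    (fun _ _ => zero_le) (Finset.mem_univ d)).trans le_add_self

/-- A weak derivative on the half section says nothing across the axis, where its lift might acquire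
a singular part. Approximation by test functions supported off the axis excludes this, because weak
derivatives are closed under L² limits. -/
theorem hasLift_of_approx (h : MeasTriple (halfSection D) w a b)
    (hE : fullEnergy (halfSection D) m w a b < ⊤)
    (happ : ∀ ε : ℝ≥0∞, 0 < ε → ∃ ψ, IsTest (halfSection D) ψ ∧
      fullEnergy (halfSection D) m (w - ψ) (a - dr ψ) (b - dz ψ) ≤ ε) : HasLift D m w a b := by
  intro d
  refine isWeakDeriv_of_approx
    (locallyIntegrableOn_of_sq hD (aesm_slift hD h.fst m) ((lintegral_slift_le hD h m).trans_lt hE))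
    (locallyIntegrableOn_of_sq hD (aesm_sgrad hD h m d) ((lintegral_sgrad_le hD h m d).trans_lt hE))
    fun ε hε => ?_
  obtain ⟨ψ, hψ, hle⟩ := happ ε hε
  refine ⟨_, _, hasLift_of_isTest hD hψ m d, ?_, ?_⟩
  · simp only [← slift_sub]
    exact (lintegral_slift_le hD (h.sub hψ.measTriple) m).trans hle
  · simp only [← sgrad_sub]
    exact (lintegral_sgrad_le hD (h.sub hψ.measTriple) m d).trans hle

end Domain

/-! ### Single vector modes -/

lemma eigComp_mode (k : ℤ) (v : Triple) (j : Fin 3) :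
    eigComp j (mode k v) = slift (k + shift j) (eigComp j v) := by
  funext p
  change (diagMat *ᵥ ((nrm * Complex.exp (Complex.I * k * ((polarCoord p.1).2 : ℝ))) •
    (rotMat (polarCoord p.1).2 *ᵥ v (meridian p)))) j = _
  rw [Matrix.mulVec_smul, Pi.smul_apply, diagMat_mulVec_rotMat, slift, harm, smul_eq_mul]
  have : Complex.I * ((k + shift j : ℤ) : ℂ) * ((polarCoord p.1).2 : ℝ) =
      Complex.I * k * ((polarCoord p.1).2 : ℝ) + Complex.I * shift j * ((polarCoord p.1).2 : ℝ) := by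
    push_cast; ring
  rw [this, Complex.exp_add]
  simp only [eigComp]
  ring

lemma mode_eq (k : ℤ) (v : Triple) :
    mode k v = ofEigComp fun j => slift (k + shift j) (eigComp j v) := by
  rw [← ofEigComp_eigComp (mode k v)]
  simp only [eigComp_mode]

lemma mode_sub (k : ℤ) (v v' : Triple) : mode k (v - v') = mode k v - mode k v' := by
  funext p
  simp only [mode, Pi.sub_apply, Matrix.mulVec_sub, smul_sub]

lemma mode_smul (k : ℤ) (c : ℂ) (v : Triple) : mode k (c • v) = c • mode k v := by
  funext p
  simp only [mode, Pi.smul_apply, Matrix.mulVec_smul]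
  rw [smul_comm]

lemma ext_eigComp {X : Type*} {v v' : X → Fin 3 → ℂ} (x : X)
    (h : ∀ j, eigComp j v x = eigComp j v' x) : v x = v' x := by
  rw [← ofEigComp_eigComp v, ← ofEigComp_eigComp v']
  simp only [ofEigComp, h]

lemma lintegral_sum_ofEigComp {X : Type*} [MeasurableSpace X] {μ : Measure X} {w : Fin 3 → X → ℂ}
    (h : ∀ j, AEStronglyMeasurable (w j) μ) :
    ∑ i, ∫⁻ x, ‖ofEigComp w x i‖ₑ ^ 2 ∂μ = ∑ j, ∫⁻ x, ‖w j x‖ₑ ^ 2 ∂μ := by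
  rw [← lintegral_sum_eigComp (v := ofEigComp w)]
  · simp only [eigComp_ofEigComp]
  · intro i
    simp only [ofEigComp_apply]
    exact Finset.aestronglyMeasurable_fun_sum _ fun j _ => (h j).const_mul _

lemma IsTest.sum_const_mul {E : Type*} [NormedAddCommGroup E] [NormedSpace ℝ E]
    [MeasureSpace E] [BorelSpace E] {U : Set E} {φ : Fin 3 → E → ℂ} (h : ∀ i, IsTest U (φ i)) (c : Fin 3 → ℂ) :
    IsTest U fun x => ∑ i, c i * φ i x := by
  have h1 := fun i => (h i).mul_left (h := fun _ => c i) fun _ _ => contDiffAt_const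
  simp only [Fin.sum_univ_three]
  exact ((h1 0).add (h1 1)).add (h1 2)

lemma IsTest.eigComp {U : Set Plane} {φ : Fin 3 → Plane → ℂ} (h : ∀ i, IsTest U (φ i)) (j : Fin 3) :
    IsTest U (eigComp j fun q i => φ i q) :=
  IsTest.sum_const_mul h (diagMat j)

lemma fderiv_eigComp {U : Set Plane} {φ : Fin 3 → Plane → ℂ} (h : ∀ i, IsTest U (φ i)) (j : Fin 3)
    (e : Plane) : (fun q => fderiv ℝ (eigComp j fun q i => φ i q) q e) =
      eigComp j fun q i => fderiv ℝ (φ i) q e := by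
  funext q
  have h1 : HasFDerivAt (eigComp j fun q i => φ i q) (∑ i, diagMat j i • fderiv ℝ (φ i) q) q := by
    change HasFDerivAt (fun q => ∑ i, diagMat j i * φ i q) _ q
    exact HasFDerivAt.fun_sum fun i _ =>
      ((h i).smooth.differentiable (by simp) q).hasFDerivAt.const_mul _
  rw [h1.fderiv, eigComp_apply, sum_apply]
  rfl

lemma ennreal_eq_of_sq_eq_sq {x y : ℝ≥0∞} (h : x ^ 2 = y ^ 2) : x = y :=
  le_antisymm (le_of_sq_le_sq h.le) (le_of_sq_le_sq h.ge)

/-- The eigencomponents of `v` lift to `D` with gradients given by `a = ∂_r v` and `b = ∂_z v`. -/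
structure TripleLift (D : Set Space) (k : ℤ) (v a b : Triple) : Prop where
  meas : ∀ j, MeasTriple (halfSection D) (eigComp j v) (eigComp j a) (eigComp j b)
  lift : ∀ j, HasLift D (k + shift j) (eigComp j v) (eigComp j a) (eigComp j b)

lemma TripleLift.sub {D : Set Space} {k : ℤ} {v a b v' a' b' : Triple} (h : TripleLift D k v a b)
    (h' : TripleLift D k v' a' b') : TripleLift D k (v - v') (a - a') (b - b') := by
  constructor <;> intro j <;> rw [eigComp_sub, eigComp_sub, eigComp_sub]
  · exact (h.meas j).sub (h'.meas j)
  · exact (h.lift j).sub (h'.lift j)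

section Domain

variable {D : Set Space} (hD : IsAxisymmetricDomain D) {k : ℤ} {v a b : Triple}

lemma TripleLift.isWeakGrad (h : TripleLift D k v a b) : IsWeakGrad D (mode k v) fun i d p =>
    ofEigComp (fun j => sgrad (k + shift j) (eigComp j v) (eigComp j a) (eigComp j b) d) p i := by
  intro i d
  rw [mode_eq]
  simp only [ofEigComp_apply]
  exact IsWeakDeriv.sum fun j _ => (h.lift j d).const_mul _

include hD

lemma TripleLift.h1Seminorm_sq (h : TripleLift D k v a b) : h1Seminorm D (mode k v) ^ 2 =
    ∑ j, modeEnergy (halfSection D) (k + shift j) (eigComp j v) (eigComp j a) (eigComp j b) := by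
  rw [h1Seminorm_sq_eq hD.isOpen h.isWeakGrad, Finset.sum_comm]
  simp only [← lintegral_sgrad hD (h.meas _)]
  rw [Finset.sum_comm (s := Finset.univ (α := Fin 3)) (t := Finset.univ (α := Fin 3))
    (f := fun j d => ∫⁻ p in D, ‖sgrad _ _ _ _ d p‖ₑ ^ 2)]
  exact Finset.sum_congr rfl fun d _ => lintegral_sum_ofEigComp fun j => aesm_sgrad hD (h.meas j) _ d

lemma TripleLift.h1Norm_sq (h : TripleLift D k v a b) : h1Norm D (mode k v) ^ 2 =
    ∑ j, fullEnergy (halfSection D) (k + shift j) (eigComp j v) (eigComp j a) (eigComp j b) := by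
  rw [h1Norm_sq_eq hD.isOpen h.isWeakGrad, ← h1Seminorm_sq_eq hD.isOpen h.isWeakGrad,
    h.h1Seminorm_sq hD, mode_eq, lintegral_sum_ofEigComp fun j => aesm_slift hD (h.meas j).fst _,
    ← Finset.sum_add_distrib]
  exact Finset.sum_congr rfl fun j _ => by
    rw [fullEnergy_eq (h.meas j).fst, lintegral_slift hD (h.meas j).fst]

omit hD in
lemma isTest_mode (hD : IsAxisymmetricDomain D) {ψ : Fin 3 → Plane → ℂ}
    (hψ : ∀ j, IsTest (halfSection D) (ψ j)) (k : ℤ) : IsTest D (mode k (ofEigComp ψ)) := by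
  have h1 := fun j => isTest_smul_const (isTest_slift hD (hψ j) (k + shift j)) fun i => diagInv i j
  have h2 : mode k (ofEigComp ψ) = (fun p => slift (k + shift 0) (ψ 0) p • fun i => diagInv i 0) +
      (fun p => slift (k + shift 1) (ψ 1) p • fun i => diagInv i 1) +
      fun p => slift (k + shift 2) (ψ 2) p • fun i => diagInv i 2 := by
    rw [mode_eq]
    funext p i
    simp only [eigComp_ofEigComp, ofEigComp_apply, Fin.sum_univ_three, Pi.add_apply, Pi.smul_apply,
      smul_eq_mul, mul_comm]
  rw [h2]
  exact ((h1 0).add (h1 1)).add (h1 2)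

omit hD in
lemma rotDeriv_mode {ψ : Fin 3 → Plane → ℂ} (hψ : ∀ j, IsTest (halfSection D) (ψ j)) (k : ℤ)
    (l : ℕ) : rotDeriv l (mode k (ofEigComp ψ)) = (Complex.I * k) ^ l • mode k (ofEigComp ψ) := by
  funext p
  refine rotDeriv_eq_of_equivariant (fun α => ?_) l
  refine ext_eigComp (v := fun p => rotMat (-α) *ᵥ mode k (ofEigComp ψ) (rot α p))
    (v' := fun p => Complex.exp (Complex.I * k * α) • mode k (ofEigComp ψ) p) p fun j => ?_
  have h0 : ∀ q : Plane, q.1 = 0 → ψ j q = 0 := fun q hq =>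
    image_eq_zero_of_notMem_tsupport fun h => ((hψ j).support_subset h).1.ne' hq
  have h1 := slift_rot_of_zero (k + shift j) h0 p α
  have h2 := congrFun (eigComp_mode k (ofEigComp ψ) j)
  have e1 : eigComp j (fun p => rotMat (-α) *ᵥ mode k (ofEigComp ψ) (rot α p)) p =
      Complex.exp (Complex.I * shift j * (-α : ℝ)) * eigComp j (mode k (ofEigComp ψ)) (rot α p) :=
    diagMat_mulVec_rotMat (-α) _ j
  have e2 : eigComp j (fun p => Complex.exp (Complex.I * k * α) • mode k (ofEigComp ψ) p) p =
      Complex.exp (Complex.I * k * α) * eigComp j (mode k (ofEigComp ψ)) p := by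
    rw [show (fun p => Complex.exp (Complex.I * k * α) • mode k (ofEigComp ψ) p) =
      Complex.exp (Complex.I * k * α) • mode k (ofEigComp ψ) from rfl, eigComp_smul]
    rfl
  rw [e1, e2, h2, h2, eigComp_ofEigComp, h1, ← mul_assoc, ← Complex.exp_add]
  congr 2
  push_cast
  ring

lemma tripleLift_of_isTest {ψ : Fin 3 → Plane → ℂ} (hψ : ∀ j, IsTest (halfSection D) (ψ j)) (k : ℤ) :
    TripleLift D k (ofEigComp ψ) (ofEigComp fun j => dr (ψ j)) (ofEigComp fun j => dz (ψ j)) := by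
  constructor <;> intro j <;> simp only [eigComp_ofEigComp]
  · exact (hψ j).measTriple
  · exact hasLift_of_isTest hD (hψ j) _

lemma measTriple_of_isWeakPartials (h : IsWeakPartials (halfSection D) v a b) (i : Fin 3) :
    MeasTriple (halfSection D) (fun q => v q i) (fun q => a q i) (fun q => b q i) := by
  obtain ⟨h1, h2, h3⟩ := h.aesm hD.isOpen_halfSection fun q hq => hq.1
  exact ⟨h1 i, h2 i, h3 i⟩

omit hD in
lemma measTriple_eigComp (h : ∀ i, MeasTriple (halfSection D) (fun q => v q i) (fun q => a q i)
    fun q => b q i) (j : Fin 3) :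
    MeasTriple (halfSection D) (eigComp j v) (eigComp j a) (eigComp j b) :=
  ⟨aesm_eigComp (fun i => (h i).fst) j, aesm_eigComp (fun i => (h i).snd) j,
    aesm_eigComp (fun i => (h i).trd) j⟩

omit hD in
lemma fullEnergy_eigComp_le (h : ∀ i, MeasTriple (halfSection D) (fun q => v q i) (fun q => a q i)
    fun q => b q i) (j : Fin 3) :
    fullEnergy (halfSection D) 0 (eigComp j v) (eigComp j a) (eigComp j b) ≤
      ∑ i, fullEnergy (halfSection D) 0 (fun q => v q i) (fun q => a q i) (fun q => b q i) := by
  have key : ∀ (v : Triple) q, ‖eigComp j v q‖ₑ ^ 2 ≤ ∑ i, ‖v q i‖ₑ ^ 2 := fun v q => by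
    rw [← sum_enorm_eigComp]
    exact Finset.single_le_sum (f := fun j => ‖eigComp j v q‖ₑ ^ 2) (fun _ _ => zero_le)
      (Finset.mem_univ j)
  simp only [fullEnergy, wt_zero, zero_mul, add_zero]
  have hm : ∀ i, AEMeasurable (fun q => ‖v q i‖ₑ ^ 2 + (‖a q i‖ₑ ^ 2 + ‖b q i‖ₑ ^ 2))
      (mer (halfSection D)) := fun i =>
    ((h i).fst.enorm.pow_const 2).add (((h i).snd.enorm.pow_const 2).add ((h i).trd.enorm.pow_const 2))
  rw [← lintegral_finsetSum' _ fun i _ => hm i]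
  refine lintegral_mono fun q => ?_
  rw [Finset.sum_add_distrib, Finset.sum_add_distrib]
  exact add_le_add (key v q) (add_le_add (key a q) (key b q))

lemma h11Norm_sq_eq_fullEnergy {u a b : Plane → ℂ}
    (ha : IsWeakDeriv (halfSection D) (1, 0) u a) (hb : IsWeakDeriv (halfSection D) (0, 1) u b) :
    h11Norm (halfSection D) u ^ 2 = fullEnergy (halfSection D) 0 u a b := by
  rw [h11Norm_sq_eq hD.isOpen_halfSection ha hb]
  refine lintegral_congr fun q => ?_
  rw [wt_zero, zero_mul, add_zero, add_assoc]

lemma exists_isTest_eigComp (h : IsWeakPartials (halfSection D) v a b)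
    (hv : ∀ i, (fun q => v q i) ∈ H11Diamond D) {ε : ℝ≥0∞} (hε : 0 < ε) (j : Fin 3) :
    ∃ φ, IsTest (meridianBoundary D)ᶜ φ ∧
      fullEnergy (halfSection D) 0 (eigComp j v - φ) (eigComp j a - dr φ) (eigComp j b - dz φ) < ε := by
  -- The norm is the square root of the energy, and the errors of all three components enter each
  -- eigencomponent, for a total below 3ε/4.
  have h4 : 0 < (ε / 4) ^ (1 / 2 : ℝ) := by
    refine ENNReal.rpow_pos_of_nonneg (ENNReal.div_pos hε.ne' (by simp)) (by norm_num)
  choose φ hφ hlt using fun i => (hv i).2 _ h4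
  have hE : ∀ i, fullEnergy (halfSection D) 0 (fun q => v q i - φ i q) (fun q => a q i - dr (φ i) q)
      (fun q => b q i - dz (φ i) q) < ε / 4 := by
    intro i
    have e1 := (h i).1.add ((isWeakDeriv_of_contDiff (U := halfSection D) (e := ((1, 0) : Plane))
      (hφ i).smooth).const_mul (-1))
    have e2 := (h i).2.add ((isWeakDeriv_of_contDiff (U := halfSection D) (e := ((0, 1) : Plane))
      (hφ i).smooth).const_mul (-1))
    simp only [neg_one_mul, ← sub_eq_add_neg] at e1 e2
    rw [← rpow_half_sq (ε / 4)]
    refine (h11Norm_sq_eq_fullEnergy hD e1 e2).symm.trans_lt ?_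
    exact ENNReal.pow_lt_pow_left two_ne_zero (hlt i)
  refine ⟨eigComp j fun q i => φ i q, IsTest.eigComp hφ j, ?_⟩
  have e1 : dr (eigComp j fun q i => φ i q) = eigComp j fun q i => dr (φ i) q :=
    fderiv_eigComp hφ j _
  have e2 : dz (eigComp j fun q i => φ i q) = eigComp j fun q i => dz (φ i) q :=
    fderiv_eigComp hφ j _
  rw [e1, e2, ← eigComp_sub, ← eigComp_sub, ← eigComp_sub]
  refine (fullEnergy_eigComp_le (fun i => ?_) j).trans_lt ?_
  · exact (measTriple_of_isWeakPartials hD h i).sub (hφ i).measTriple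
  · rw [Fin.sum_univ_three]
    refine (ENNReal.add_lt_add (ENNReal.add_lt_add (hE 0) (hE 1)) (hE 2)).trans_le ?_
    calc ε / 4 + ε / 4 + ε / 4 ≤ ε / 4 + ε / 4 + ε / 4 + ε / 4 := le_self_add
      _ = 4 * (ε / 4) := by ring
      _ = ε := ENNReal.mul_div_cancel (by simp) (by simp)

lemma h1kNorm_sq_eq_sum_fullEnergy (h : IsWeakPartials (halfSection D) v a b) :
    h1kNorm (halfSection D) k v ^ 2 =
      ∑ j, fullEnergy (halfSection D) (k + shift j) (eigComp j v) (eigComp j a) (eigComp j b) := by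
  rw [h1kNorm_sq_eq hD.isOpen_halfSection (fun q hq => hq.1) h, ← Finset.sum_add_distrib]
  exact Finset.sum_congr rfl fun j _ => (fullEnergy_eq
    (measTriple_eigComp (fun i => measTriple_of_isWeakPartials hD h i) j).fst).symm

lemma exists_isTest_eigComp_halfSection (h : IsWeakPartials (halfSection D) v a b)
    (hv : v ∈ H1kDiamond D k) {ε : ℝ≥0∞} (hε : 0 < ε) (j : Fin 3) :
    ∃ ψ, IsTest (halfSection D) ψ ∧ fullEnergy (halfSection D) (k + shift j) (eigComp j v - ψ)
      (eigComp j a - dr ψ) (eigComp j b - dz ψ) ≤ ε := by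
  refine exists_isTest_fullEnergy_sub_lt hD
    (measTriple_eigComp (fun i => measTriple_of_isWeakPartials hD h i) j) ?_
    (fun ε hε => exists_isTest_eigComp hD h hv.2 hε j) hε
  have h1 := h1kNorm_sq_eq_sum_fullEnergy hD (k := k) h
  have h2 : h1kNorm (halfSection D) k v ^ 2 < ⊤ := ENNReal.pow_lt_top hv.1
  rw [h1] at h2
  exact (ENNReal.sum_lt_top.1 h2) j (Finset.mem_univ j)

lemma tripleLift_of_mem (h : IsWeakPartials (halfSection D) v a b) (hv : v ∈ H1kDiamond D k) :
    TripleLift D k v a b := by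
  have hm := fun j => measTriple_eigComp (fun i => measTriple_of_isWeakPartials hD h i) j
  refine ⟨hm, fun j => hasLift_of_approx hD (hm j) ?_ fun ε hε =>
    exists_isTest_eigComp_halfSection hD h hv hε j⟩
  have h1 := h1kNorm_sq_eq_sum_fullEnergy hD (k := k) h
  have h2 : h1kNorm (halfSection D) k v ^ 2 < ⊤ := ENNReal.pow_lt_top hv.1
  rw [h1] at h2
  exact (ENNReal.sum_lt_top.1 h2) j (Finset.mem_univ j)

/-- Both sides are the same sum of three scalar energies: the one on D through `lintegral_sgrad`,
the one on the half section through `modeDensity_eq`. -/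
theorem h1Seminorm_mode (hv : v ∈ H1kDiamond D k) :
    h1Seminorm D (mode k v) = h1kSeminorm (halfSection D) k v := by
  obtain ⟨a, b, h⟩ := exists_isWeakPartials_of_h1kNorm_lt_top hv.1
  refine ennreal_eq_of_sq_eq_sq ?_
  rw [(tripleLift_of_mem hD h hv).h1Seminorm_sq hD,
    h1kSeminorm_sq_eq hD.isOpen_halfSection (fun q hq => hq.1) h]

theorem h1Norm_mode (hv : v ∈ H1kDiamond D k) :
    h1Norm D (mode k v) = h1kNorm (halfSection D) k v := by
  obtain ⟨a, b, h⟩ := exists_isWeakPartials_of_h1kNorm_lt_top hv.1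
  refine ennreal_eq_of_sq_eq_sq ?_
  rw [(tripleLift_of_mem hD h hv).h1Norm_sq hD, h1kNorm_sq_eq_sum_fullEnergy hD h]

/-- The approximants are modes of the same frequency, so the rotational derivatives act on them as
scalars. This matters for functionals, whose rotational derivatives are prescribed on test fields
only. -/
theorem exists_isTest_mode_sub (hv : v ∈ H1kDiamond D k) {ε : ℝ≥0∞} (hε : 0 < ε) :
    ∃ Φ : Field3, IsTest D Φ ∧ (∀ l, rotDeriv l Φ = (Complex.I * k) ^ l • Φ) ∧
      h1Norm D (mode k v - Φ) < ε := by
  obtain ⟨a, b, h⟩ := exists_isWeakPartials_of_h1kNorm_lt_top hv.1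
  obtain ⟨δ, hδ0, hδ⟩ := exists_between hε
  have h4 : 0 < δ ^ 2 / 3 := ENNReal.div_pos (pow_ne_zero _ hδ0.ne') (by simp)
  choose ψ hψ hle using fun j => exists_isTest_eigComp_halfSection hD h hv h4 j
  refine ⟨mode k (ofEigComp ψ), isTest_mode hD hψ k, fun l => rotDeriv_mode hψ k l, ?_⟩
  rw [← mode_sub]
  refine lt_of_le_of_lt (le_of_sq_le_sq ?_) hδ
  rw [((tripleLift_of_mem hD h hv).sub (tripleLift_of_isTest hD hψ k)).h1Norm_sq hD]
  simp only [eigComp_sub, eigComp_ofEigComp]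
  refine (Finset.sum_le_sum fun j _ => hle j).trans ?_
  rw [Finset.sum_const, Finset.card_univ, Fintype.card_fin, nsmul_eq_mul]
  exact (ENNReal.mul_div_cancel (by simp) (by simp)).le

theorem mode_mem_H10 (hv : v ∈ H1kDiamond D k) : mode k v ∈ H10 D := by
  refine ⟨?_, fun ε hε => ?_⟩
  · change h1Norm D (mode k v) < ⊤
    rw [h1Norm_mode hD hv]
    exact hv.1
  · obtain ⟨Φ, h1, -, h2⟩ := exists_isTest_mode_sub hD hv hε
    exact ⟨Φ, h1, h2⟩

end Domain

/-! ### Fourier coefficients of test fields -/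

/-- The integral is the convolution, evaluated at 0, of the indicator of the interval with the
reflected integrand. The reflected integrand is made compactly supported by a bump that equals 1 on
[-b, -a], so smoothness of convolutions with a parameter applies. -/
lemma contDiff_integral_param {F : Plane × ℝ → ℂ} (hF : ContDiff ℝ (⊤ : ℕ∞) F) (a b : ℝ)
    (hab : a ≤ b) : ContDiff ℝ (⊤ : ℕ∞) fun q => ∫ θ in a..b, F (q, θ) := by
  let χ : ContDiffBump (0 : ℝ) := ⟨|a| + |b| + 1, |a| + |b| + 2, by positivity, by linarith⟩
  let g : Plane → ℝ → ℂ := fun q t => (χ t : ℂ) * F (q, -t)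
  let f : ℝ → ℂ := (Ioc a b).indicator fun _ => 1
  have hg : ContDiff ℝ (⊤ : ℕ∞) ↿g :=
    (Complex.ofRealCLM.contDiff.comp (χ.contDiff.comp contDiff_snd)).mul
      (hF.comp (contDiff_fst.prodMk contDiff_snd.neg))
  have hf : LocallyIntegrable f volume := by
    refine Integrable.locallyIntegrable ?_
    rw [integrable_indicator_iff measurableSet_Ioc]
    exact integrableOn_const (by simp)
  have h1 := contDiffOn_convolution_right_with_param (𝕜 := ℝ) (n := (⊤ : ℕ∞)) (s := univ)
    (k := Metric.closedBall (0 : ℝ) (|a| + |b| + 2)) (g := g) (f := f) (μ := volume)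
    (ContinuousLinearMap.mul ℝ ℂ) isOpen_univ (isCompact_closedBall _ _)
    (fun q x _ hx => by
      have : χ x = 0 := by
        refine Function.notMem_support.1 fun h => hx ?_
        rw [χ.support_eq] at h
        exact Metric.ball_subset_closedBall h
      simp [g, this]) hf hg.contDiffOn
  rw [univ_prod_univ, contDiffOn_univ] at h1
  have h2 := h1.comp (contDiff_id.prodMk (contDiff_const (c := (0 : ℝ))))
  convert h2 using 1
  funext q
  simp only [Function.comp, convolution, ContinuousLinearMap.mul_apply', id, zero_sub]
  rw [intervalIntegral.integral_of_le hab, ← integral_indicator measurableSet_Ioc]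
  refine integral_congr_ae (ae_of_all _ fun t => ?_)
  simp only [f, g]
  by_cases ht : t ∈ Ioc a b
  · have hχ : χ (-t) = 1 := by
      refine χ.one_of_mem_closedBall ?_
      rw [Metric.mem_closedBall, dist_zero_right, norm_neg, Real.norm_eq_abs]
      change |t| ≤ |a| + |b| + 1
      rw [abs_le]
      have := neg_abs_le a
      have := le_abs_self b
      have := abs_nonneg a
      have := abs_nonneg b
      constructor <;> linarith [ht.1, ht.2]
    rw [indicator_of_mem ht, indicator_of_mem ht, hχ]
    simp
  · rw [indicator_of_notMem ht, indicator_of_notMem ht, zero_mul]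

lemma contDiff_cyl : ContDiff ℝ (⊤ : ℕ∞) cyl := by unfold cyl; fun_prop

lemma isTest_component {D : Set Space} {φ : Field3} (hφ : IsTest D φ) (i : Fin 3) :
    IsTest D fun p => φ p i := by
  refine IsTest.of_eventually hφ.compact.isCompact hφ.support_subset (fun p hp => ?_) fun p _ => ?_
  · rw [image_eq_zero_of_notMem_tsupport hp, Pi.zero_apply]
  · exact (contDiff_pi.1 hφ.smooth i).contDiffAt

section Domain

variable {D : Set Space} (hD : IsAxisymmetricDomain D)

include hD

/-- The coefficients of a test field may be nonzero on the axis, but their support comes from points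
of D, and the open set D is disjoint from its boundary. Hence the support avoids Γ. -/
theorem isTest_coeff {φ : Field3} (hφ : IsTest D φ) (k : ℤ) (i : Fin 3) :
    IsTest (meridianBoundary D)ᶜ fun q => coeff k φ q i := by
  set S : Set (Plane × ℝ) := cyl ⁻¹' tsupport φ ∩ univ ×ˢ Icc (-Real.pi) Real.pi with hS
  have hSc : IsCompact S := by
    obtain ⟨R, hR⟩ := hφ.compact.isCompact.isBounded.subset_closedBall (0 : Space)
    -- Since `coeff` is defined for negative r too, the radius ranges over a symmetric interval; r²
    -- = x² + y² ≤ 2R² gives |r| ≤ 2R.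
    refine IsCompact.of_isClosed_subset ((isCompact_Icc (a := -(2 * R)) (b := 2 * R)).prod
      (isCompact_Icc (a := -R) (b := R)) |>.prod
        (isCompact_Icc (a := -Real.pi) (b := Real.pi)))
      (((isClosed_tsupport φ).preimage continuous_cyl).inter (isClosed_univ.prod isClosed_Icc))
      fun x hx => ?_
    have h1 := hR hx.1
    rw [mem_closedBall_zero_iff, Prod.norm_def, Prod.norm_def] at h1
    simp only [max_le_iff, Real.norm_eq_abs, cyl] at h1
    obtain ⟨⟨h2, h3⟩, h4⟩ := h1
    refine ⟨⟨abs_le.1 (abs_le_of_sq_le_sq ?_ ?_), abs_le.1 h4⟩, hx.2.2⟩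
    · have h5 := sq_le_sq' (abs_le.1 h2).1 (abs_le.1 h2).2
      have h6 := sq_le_sq' (abs_le.1 h3).1 (abs_le.1 h3).2
      have h7 := Real.cos_sq_add_sin_sq x.2
      nlinarith [sq_nonneg R]
    · linarith [(abs_nonneg _).trans h2]
  refine IsTest.of_eventually (hSc.image continuous_fst) ?_ ?_ ?_
  · rintro _ ⟨⟨q, θ⟩, ⟨hx, -⟩, rfl⟩ ⟨-, hq⟩
    rw [hD.isOpen.frontier_eq] at hq
    refine hq.2 ?_
    have := hφ.support_subset hx
    rw [cyl_eq_rot, hD.rot_mem_iff] at this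
    exact this
  · intro q hq
    have h0 : ∀ θ ∈ uIcc (-Real.pi) Real.pi, φ (cyl (q, θ)) = 0 := fun θ hθ => by
      rw [uIcc_of_le (by linarith [Real.pi_pos])] at hθ
      exact image_eq_zero_of_notMem_tsupport fun h => hq ⟨(q, θ), ⟨h, trivial, hθ⟩, rfl⟩
    have h1 : ∫ θ in (-Real.pi)..Real.pi, (rotMat (-θ) *ᵥ φ (cyl (q, θ))) i
        * Complex.exp (-(Complex.I * k * θ)) = ∫ θ in (-Real.pi)..Real.pi, 0 := by
      refine intervalIntegral.integral_congr fun θ hθ => ?_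
      simp only [h0 θ hθ, Matrix.mulVec_zero, Pi.zero_apply, zero_mul]
    rw [intervalIntegral.integral_zero] at h1
    change nrm * _ = 0
    exact mul_eq_zero_of_right _ h1
  · intro q _
    refine ContDiff.contDiffAt ?_
    have hR : ∀ i i', ContDiff ℝ (⊤ : ℕ∞) fun x : Plane × ℝ => rotMat (-x.2) i i' := by
      have hc : ContDiff ℝ (⊤ : ℕ∞) fun x : Plane × ℝ => (Real.cos (-x.2) : ℂ) :=
        Complex.ofRealCLM.contDiff.comp (Real.contDiff_cos.comp contDiff_snd.neg)
      have hs : ContDiff ℝ (⊤ : ℕ∞) fun x : Plane × ℝ => (Real.sin (-x.2) : ℂ) :=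
        Complex.ofRealCLM.contDiff.comp (Real.contDiff_sin.comp contDiff_snd.neg)
      intro i i'
      fin_cases i <;> fin_cases i' <;>
        first | exact hc | exact hs | exact hs.neg | exact contDiff_const
    have hF : ContDiff ℝ (⊤ : ℕ∞) fun x : Plane × ℝ => (rotMat (-x.2) *ᵥ φ (cyl x)) i
        * Complex.exp (-(Complex.I * k * x.2)) := by
      refine ContDiff.mul ?_ ?_
      · change ContDiff ℝ (⊤ : ℕ∞) fun x : Plane × ℝ => ∑ i', rotMat (-x.2) i i' * φ (cyl x) i'
        exact ContDiff.sum fun i' _ => (hR i i').mul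
          ((isTest_component hφ i').smooth.comp contDiff_cyl)
      · have h1 : ContDiff ℝ (⊤ : ℕ∞) fun x : Plane × ℝ => (x.2 : ℂ) :=
          Complex.ofRealCLM.contDiff.comp contDiff_snd
        exact (contDiff_const.mul h1).neg.cexp
    exact contDiff_const.mul (contDiff_integral_param hF _ _ (by linarith [Real.pi_pos]))

/-! ### Linearity of the Fourier coefficients -/

omit hD in
lemma coeff_smul (k : ℤ) (c : ℂ) (v : Field3) : coeff k (c • v) = c • coeff k v := by
  funext q i
  simp only [coeff, Pi.smul_apply, Matrix.mulVec_smul, smul_eq_mul, mul_assoc]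
  rw [intervalIntegral.integral_const_mul]
  ring

omit hD in
lemma scoeff_add_of_integrable {u u' : Space → ℂ} {q : Plane}
    (hu : Integrable (fun θ => u (cyl (q, θ))) ang) (hu' : Integrable (fun θ => u' (cyl (q, θ))) ang)
    (m : ℤ) : scoeff m (u + u') q = scoeff m u q + scoeff m u' q := by
  have h : ∀ {u : Space → ℂ}, Integrable (fun θ => u (cyl (q, θ))) ang →
      Integrable (fun θ : ℝ => u (cyl (q, θ)) * Complex.exp (-(Complex.I * m * θ))) ang := fun hu =>
    hu.mul_bdd (c := 1) (continuous_exp_neg m).aestronglyMeasurable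
      (ae_of_all _ fun θ => (norm_exp_neg_I m θ).le)
  simp only [scoeff, angCoeff, Pi.add_apply, add_mul]
  rw [integral_add (h hu) (h hu'), mul_add]

/-- Only almost everywhere: on circles without integrability the integral takes the default value 0
and is not additive. -/
lemma coeff_add {v w : Field3} (hv : ∀ i, Integrable (fun p => v p i) (volume.restrict D))
    (hw : ∀ i, Integrable (fun p => w p i) (volume.restrict D)) (k : ℤ) :
    coeff k (v + w) =ᵐ[volume.restrict (halfSection D)] coeff k v + coeff k w := by
  rw [EventuallyEq, ← ae_mer_iff hD.isOpen_halfSection.measurableSet (fun _ h => h.1)]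
  filter_upwards [ae_all_iff.2 fun i => ae_integrable_comp_cyl hD (hv i),
    ae_all_iff.2 fun i => ae_integrable_comp_cyl hD (hw i)] with q h1 h2
  refine ext_eigComp q fun j => ?_
  have comp : ∀ {v : Field3}, (∀ i, Integrable (fun θ => v (cyl (q, θ)) i) ang) →
      Integrable (fun θ => eigComp j v (cyl (q, θ))) ang := fun h => by
    simp only [eigComp_apply]
    exact integrable_finsetSum _ fun i _ => (h i).const_mul _
  rw [eigComp_coeff_of_integrable hD (fun i => (h1 i).add (h2 i)), eigComp_add, eigComp_add,
    scoeff_add_of_integrable (comp h1) (comp h2), Pi.add_apply, eigComp_coeff_of_integrable hD h1,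
    eigComp_coeff_of_integrable hD h2]

/-! ### Linear structure of the Sobolev spaces on `D` -/

omit hD in
lemma IsWeakGrad.add {v w : Field3} {G H : Fin 3 → Fin 3 → Space → ℂ} (h : IsWeakGrad D v G)
    (h' : IsWeakGrad D w H) : IsWeakGrad D (v + w) (G + H) := fun i j => (h i j).add (h' i j)

omit hD in
lemma IsWeakGrad.const_smul {v : Field3} {G : Fin 3 → Fin 3 → Space → ℂ} (h : IsWeakGrad D v G)
    (c : ℂ) : IsWeakGrad D (c • v) (c • G) := fun i j => (h i j).const_mul c

omit hD in
lemma lintegral_enorm_add_sq_le {X : Type*} [MeasurableSpace X] {μ : Measure X} {f g : X → ℂ}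
    (hf : AEStronglyMeasurable f μ) : ∫⁻ x, ‖f x + g x‖ₑ ^ 2 ∂μ ≤
      2 * ∫⁻ x, ‖f x‖ₑ ^ 2 ∂μ + 2 * ∫⁻ x, ‖g x‖ₑ ^ 2 ∂μ := by
  rw [← lintegral_const_mul' _ _ (by simp), ← lintegral_const_mul' _ _ (by simp),
    ← lintegral_add_left' ((hf.enorm.pow_const 2).const_mul 2)]
  exact lintegral_mono fun x => enorm_add_sq_le _ _

omit hD in
lemma h1Norm_add_sq_le (hO : IsOpen D) {v w : Field3} (hv : v ∈ H1 D) (hw : w ∈ H1 D) :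
    h1Norm D (v + w) ^ 2 ≤ 2 * h1Norm D v ^ 2 + 2 * h1Norm D w ^ 2 := by
  obtain ⟨G, hG, -⟩ := (mem_H1_iff hO).1 hv
  obtain ⟨H, hH, -⟩ := (mem_H1_iff hO).1 hw
  rw [h1Norm_sq_eq hO hG, h1Norm_sq_eq hO hH, h1Norm_sq_eq hO (hG.add hH)]
  have e1 : ∑ i, ∫⁻ p in D, ‖(v + w) p i‖ₑ ^ 2 ≤
      2 * (∑ i, ∫⁻ p in D, ‖v p i‖ₑ ^ 2) + 2 * ∑ i, ∫⁻ p in D, ‖w p i‖ₑ ^ 2 := by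
    rw [Finset.mul_sum, Finset.mul_sum, ← Finset.sum_add_distrib]
    exact Finset.sum_le_sum fun i _ => lintegral_enorm_add_sq_le (hG.aesm.1 i)
  have e2 : ∑ i, ∑ j, ∫⁻ p in D, ‖(G + H) i j p‖ₑ ^ 2 ≤ 2 * (∑ i, ∑ j, ∫⁻ p in D, ‖G i j p‖ₑ ^ 2) +
      2 * ∑ i, ∑ j, ∫⁻ p in D, ‖H i j p‖ₑ ^ 2 := by
    simp only [Finset.mul_sum]
    simp only [← Finset.sum_add_distrib]
    exact Finset.sum_le_sum fun i _ => Finset.sum_le_sum fun j _ =>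
      lintegral_enorm_add_sq_le (hG.aesm.2 i j)
  refine (add_le_add e1 e2).trans (le_of_eq ?_)
  ring

omit hD in
lemma lintegral_enorm_const_mul_sq {X : Type*} [MeasurableSpace X] {μ : Measure X} (c : ℂ)
    (f : X → ℂ) : ∫⁻ x, ‖c * f x‖ₑ ^ 2 ∂μ = ‖c‖ₑ ^ 2 * ∫⁻ x, ‖f x‖ₑ ^ 2 ∂μ := by
  rw [← lintegral_const_mul' _ _ (by simp)]
  simp only [enorm_mul, mul_pow]

omit hD in
lemma h1Norm_smul_sq (hO : IsOpen D) {v : Field3} (hv : v ∈ H1 D) (c : ℂ) :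
    h1Norm D (c • v) ^ 2 = ‖c‖ₑ ^ 2 * h1Norm D v ^ 2 ∧
      h1Seminorm D (c • v) ^ 2 = ‖c‖ₑ ^ 2 * h1Seminorm D v ^ 2 := by
  obtain ⟨G, hG, -⟩ := (mem_H1_iff hO).1 hv
  have e1 : ∑ i, ∑ j, ∫⁻ p in D, ‖(c • G) i j p‖ₑ ^ 2 =
      ‖c‖ₑ ^ 2 * ∑ i, ∑ j, ∫⁻ p in D, ‖G i j p‖ₑ ^ 2 := by
    simp only [Finset.mul_sum, ← lintegral_enorm_const_mul_sq]
    rfl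
  have e2 : ∑ i, ∫⁻ p in D, ‖(c • v) p i‖ₑ ^ 2 = ‖c‖ₑ ^ 2 * ∑ i, ∫⁻ p in D, ‖v p i‖ₑ ^ 2 := by
    simp only [Finset.mul_sum, ← lintegral_enorm_const_mul_sq]
    rfl
  rw [h1Norm_sq_eq hO hG, h1Norm_sq_eq hO (hG.const_smul c), h1Seminorm_sq_eq hO hG,
    h1Seminorm_sq_eq hO (hG.const_smul c), e1, e2, mul_add]
  exact ⟨rfl, rfl⟩

omit hD in
lemma h1Norm_smul (hO : IsOpen D) {v : Field3} (hv : v ∈ H1 D) (c : ℂ) :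
    h1Norm D (c • v) = ‖c‖ₑ * h1Norm D v := by
  refine ennreal_eq_of_sq_eq_sq ?_
  rw [(h1Norm_smul_sq hO hv c).1, mul_pow]

omit hD in
lemma h1Seminorm_smul (hO : IsOpen D) {v : Field3} (hv : v ∈ H1 D) (c : ℂ) :
    h1Seminorm D (c • v) = ‖c‖ₑ * h1Seminorm D v := by
  refine ennreal_eq_of_sq_eq_sq ?_
  rw [(h1Norm_smul_sq hO hv c).2, mul_pow]

omit hD in
lemma h1Seminorm_le_h1Norm (hO : IsOpen D) {v : Field3} (hv : v ∈ H1 D) :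
    h1Seminorm D v ≤ h1Norm D v := by
  obtain ⟨G, hG, -⟩ := (mem_H1_iff hO).1 hv
  refine le_of_sq_le_sq ?_
  rw [h1Norm_sq_eq hO hG, h1Seminorm_sq_eq hO hG]
  exact le_add_self

omit hD in
lemma H1_smul (hO : IsOpen D) {v : Field3} (hv : v ∈ H1 D) (c : ℂ) : c • v ∈ H1 D := by
  change h1Norm D (c • v) < ⊤
  rw [h1Norm_smul hO hv]
  exact ENNReal.mul_lt_top (by simp) hv

omit hD in
lemma H1_add (hO : IsOpen D) {v w : Field3} (hv : v ∈ H1 D) (hw : w ∈ H1 D) : v + w ∈ H1 D := by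
  have h : h1Norm D (v + w) ^ 2 < ⊤ := (h1Norm_add_sq_le hO hv hw).trans_lt
    (ENNReal.add_lt_top.2 ⟨ENNReal.mul_lt_top (by simp) (ENNReal.pow_lt_top hv),
      ENNReal.mul_lt_top (by simp) (ENNReal.pow_lt_top hw)⟩)
  exact (ENNReal.pow_lt_top_iff.1 h).resolve_right (by norm_num)

omit hD in
lemma IsTest.mem_H1 (hO : IsOpen D) {φ : Field3} (hφ : IsTest D φ) : φ ∈ H1 D :=
  (mem_H1_iff hO).2 ⟨fun i j p => fderiv ℝ (fun p => φ p i) p (dir j),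
    fun i _ => isWeakDeriv_of_contDiff (isTest_component hφ i).smooth,
    fun i => (isTest_component hφ i).lintegral_sq_lt_top,
    fun i j => ((isTest_component hφ i).fderiv_apply (dir j)).lintegral_sq_lt_top⟩

omit hD in
lemma IsTest.smul {φ : Field3} (hφ : IsTest D φ) (c : ℂ) : IsTest D (c • φ) := by
  refine IsTest.of_eventually hφ.compact.isCompact hφ.support_subset (fun p hp => ?_) fun p _ => ?_
  · rw [Pi.smul_apply, image_eq_zero_of_notMem_tsupport hp, smul_zero]
  · exact (contDiff_const.smul hφ.smooth).contDiffAt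

omit hD in
lemma isTest_zero : IsTest D (0 : Field3) :=
  IsTest.of_eventually isCompact_empty (empty_subset _) (fun _ _ => rfl) fun _ h => h.elim

omit hD in
lemma h1Norm_zero (hO : IsOpen D) : h1Norm D (0 : Field3) = 0 := by
  have h := h1Norm_smul hO (isTest_zero.mem_H1 hO) 0
  rwa [zero_smul, enorm_zero, zero_mul] at h

end Domain

/-! ### Fourier coefficients of single modes -/

lemma integral_exp_ang (n : ℤ) : ∫ θ, Complex.exp (Complex.I * n * θ) ∂ang =
    if n = 0 then ((2 * Real.pi : ℝ) : ℂ) else 0 := by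
  rw [ang, ← intervalIntegral.integral_of_le (by linarith [Real.pi_pos])]
  split_ifs with h
  · simp only [h, Int.cast_zero, mul_zero, zero_mul, Complex.exp_zero]
    rw [intervalIntegral.integral_const, Complex.real_smul, mul_one]
    congr 1
    ring
  · have hc : Complex.I * n ≠ 0 := mul_ne_zero Complex.I_ne_zero (by exact_mod_cast h)
    rw [integral_exp_mul_complex hc]
    have : Complex.exp (Complex.I * n * (Real.pi : ℝ)) =
        Complex.exp (Complex.I * n * ((-Real.pi : ℝ) : ℂ)) := by
      refine Complex.exp_eq_exp_iff_exists_int.2 ⟨n, ?_⟩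
      push_cast
      ring
    rw [this, sub_self, zero_div]

lemma scoeff_slift (m n : ℤ) (w : Plane → ℂ) {q : Plane} (hq : 0 < q.1) :
    scoeff m (slift n w) q = if m = n then w q else 0 := by
  have h1 : ∀ θ : ℝ, slift n w (cyl (q, θ)) * Complex.exp (-(Complex.I * m * θ)) =
      nrm * w q * Complex.exp (Complex.I * (n - m : ℤ) * θ) := by
    intro θ
    rw [slift_cyl _ _ hq]
    have : Complex.I * ((n - m : ℤ) : ℂ) * θ = Complex.I * n * θ + -(Complex.I * m * θ) := by
      push_cast; ring
    rw [this, Complex.exp_add]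
    ring
  simp only [scoeff, angCoeff, h1]
  rw [integral_const_mul, integral_exp_ang]
  by_cases h : m = n
  · rw [if_pos (by rw [h, sub_self]), if_pos h]
    linear_combination (w q) * nrm_sq
  · rw [if_neg (fun h' => h (sub_eq_zero.1 h').symm), if_neg h, mul_zero, mul_zero]

section Domain

variable {D : Set Space} (hD : IsAxisymmetricDomain D)

include hD

/-- Orthogonality of the exponentials. Equal eigencomponents carry equal shifts, so k + shift j = n
+ shift j only if k = n. -/
lemma coeff_mode (k n : ℤ) (v : Triple) {q : Plane} (hq : 0 < q.1) :
    coeff k (mode n v) q = if k = n then v q else 0 := by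
  have h1 : ∀ i, Integrable (fun θ => mode n v (cyl (q, θ)) i) ang := by
    intro i
    rw [mode_eq]
    simp only [ofEigComp_apply, slift_cyl _ _ hq]
    refine Continuous.integrableOn_Ioc ?_
    fun_prop
  refine ext_eigComp (v' := fun q => if k = n then v q else 0) q fun j => ?_
  rw [eigComp_coeff_of_integrable hD h1, eigComp_mode, scoeff_slift _ _ _ hq]
  by_cases h : k = n
  · simp [h, eigComp]
  · rw [if_neg (by omega)]
    simp [h, eigComp]

/-! ### The space of fields vanishing on the boundary -/

omit hD in
lemma IsTest.mem_H10 (hO : IsOpen D) {φ : Field3} (hφ : IsTest D φ) : φ ∈ H10 D :=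
  ⟨hφ.mem_H1 hO, fun ε hε => ⟨φ, hφ, by rwa [sub_self, h1Norm_zero hO]⟩⟩

omit hD in
lemma H1_sub (hO : IsOpen D) {v w : Field3} (hv : v ∈ H1 D) (hw : w ∈ H1 D) : v - w ∈ H1 D := by
  have := H1_add hO hv (H1_smul hO hw (-1))
  rwa [neg_one_smul, ← sub_eq_add_neg] at this

omit hD in
lemma H10_add (hO : IsOpen D) {v w : Field3} (hv : v ∈ H10 D) (hw : w ∈ H10 D) : v + w ∈ H10 D := by
  refine ⟨H1_add hO hv.1 hw.1, fun ε hε => ?_⟩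
  obtain ⟨δ, hδ0, hδ⟩ := exists_between hε
  have hδ2 : 0 < δ / 2 := ENNReal.div_pos hδ0.ne' (by simp)
  obtain ⟨φ, hφ, h1⟩ := hv.2 _ hδ2
  obtain ⟨ψ, hψ, h2⟩ := hw.2 _ hδ2
  refine ⟨φ + ψ, hφ.add hψ, lt_of_le_of_lt (le_of_sq_le_sq ?_) hδ⟩
  rw [add_sub_add_comm]
  refine (h1Norm_add_sq_le hO (H1_sub hO hv.1 (hφ.mem_H1 hO)) (H1_sub hO hw.1 (hψ.mem_H1 hO))).trans ?_
  calc 2 * h1Norm D (v - φ) ^ 2 + 2 * h1Norm D (w - ψ) ^ 2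
      ≤ 2 * (δ / 2) ^ 2 + 2 * (δ / 2) ^ 2 := by gcongr
    _ = (2 * (δ / 2)) ^ 2 := by ring
    _ = δ ^ 2 := by rw [ENNReal.mul_div_cancel (by simp) (by simp)]

omit hD in
lemma H10_smul (hO : IsOpen D) {v : Field3} (hv : v ∈ H10 D) (c : ℂ) : c • v ∈ H10 D := by
  refine ⟨H1_smul hO hv.1 c, fun ε hε => ?_⟩
  have hpos : 0 < ε / (‖c‖ₑ + 1) :=
    ENNReal.div_pos hε.ne' (ENNReal.add_lt_top.2 ⟨by simp, by simp⟩).ne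
  obtain ⟨δ, hδ0, hδ⟩ := exists_between hpos
  obtain ⟨φ, hφ, h1⟩ := hv.2 _ hδ0
  refine ⟨c • φ, hφ.smul c, ?_⟩
  rw [← smul_sub, h1Norm_smul hO (H1_sub hO hv.1 (hφ.mem_H1 hO))]
  calc ‖c‖ₑ * h1Norm D (v - φ) ≤ (‖c‖ₑ + 1) * δ := by gcongr; exact le_self_add
    _ < ε := by
      rw [mul_comm]
      exact ENNReal.mul_lt_of_lt_div hδ

omit hD in
lemma H10_sub (hO : IsOpen D) {v w : Field3} (hv : v ∈ H10 D) (hw : w ∈ H10 D) : v - w ∈ H10 D := by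
  have := H10_add hO hv (H10_smul hO hw (-1))
  rwa [neg_one_smul, ← sub_eq_add_neg] at this

omit hD in
lemma H10_sum (hO : IsOpen D) {ι : Type*} (K : Finset ι) {v : ι → Field3}
    (hv : ∀ i ∈ K, v i ∈ H10 D) : ∑ i ∈ K, v i ∈ H10 D := by
  classical
  induction K using Finset.induction_on with
  | empty => exact isTest_zero.mem_H10 hO
  | insert a s ha ih =>
    rw [Finset.sum_insert ha]
    exact H10_add hO (hv a (Finset.mem_insert_self _ _))
      (ih fun i hi => hv i (Finset.mem_insert_of_mem hi))

lemma coeff_sub {v w : Field3} (hv : v ∈ H1 D) (hw : w ∈ H1 D) (k : ℤ) :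
    coeff k (v - w) =ᵐ[volume.restrict (halfSection D)] coeff k v - coeff k w := by
  have h := coeff_add hD (integrable_of_mem_H1 hD hv)
    (integrable_of_mem_H1 hD (H1_smul hD.isOpen hw (-1))) k
  rwa [coeff_smul, neg_one_smul, neg_one_smul, ← sub_eq_add_neg, ← sub_eq_add_neg] at h

lemma coeff_sum_mode {W : ℤ → Triple} (K : Finset ℤ) (hW : ∀ k ∈ K, mode k (W k) ∈ H10 D) (k : ℤ) :
    coeff k (∑ n ∈ K, mode n (W n)) =ᵐ[volume.restrict (halfSection D)]
      if k ∈ K then W k else 0 := by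
  classical
  have hmem : ∀ᵐ q ∂volume.restrict (halfSection D), q ∈ halfSection D :=
    ae_restrict_mem hD.isOpen_halfSection.measurableSet
  induction K using Finset.induction_on with
  | empty =>
    refine ae_of_all _ fun q => ?_
    simp only [Finset.sum_empty, Finset.notMem_empty, if_false]
    have h := coeff_smul k 0 (0 : Field3)
    rw [zero_smul, zero_smul] at h
    rw [h]
  | insert a s ha ih =>
    rw [Finset.sum_insert ha]
    have h1 := hW a (Finset.mem_insert_self _ _)
    have h2 : ∀ i ∈ s, mode i (W i) ∈ H10 D := fun i hi => hW i (Finset.mem_insert_of_mem hi)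
    have h3 := coeff_add hD (integrable_of_mem_H1 hD h1.1)
      (integrable_of_mem_H1 hD (H10_sum hD.isOpen s h2).1) k
    filter_upwards [h3, ih h2, hmem] with q e1 e2 hq
    rw [e1, Pi.add_apply, e2, coeff_mode hD k a _ hq.1]
    by_cases hka : k = a
    · subst hka
      simp [ha]
    · simp [hka]

/-! ### Fourier coefficients of fields vanishing on the boundary -/

/-- Unitarity bounds one component by the sum over the eigencomponents, and dropping the weights
m²/r² only decreases the energy. -/
lemma h11Norm_le_h1kNorm {k : ℤ} {v a b : Triple} (h : IsWeakPartials (halfSection D) v a b)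
    (i : Fin 3) : h11Norm (halfSection D) (fun q => v q i) ≤ h1kNorm (halfSection D) k v := by
  have hm := measTriple_of_isWeakPartials hD h
  refine le_of_sq_le_sq ?_
  rw [h11Norm_sq_eq_fullEnergy hD (h i).1 (h i).2, h1kNorm_sq_eq_sum_fullEnergy hD h]
  simp only [fullEnergy]
  rw [← lintegral_finsetSum' _ fun j _ => (measTriple_eigComp hm j).aemeasurable (k + shift j)]
  refine lintegral_mono fun q => ?_
  rw [wt_zero, zero_mul, add_zero]
  have key : ∀ v : Triple, ‖v q i‖ₑ ^ 2 ≤ ∑ j, ‖eigComp j v q‖ₑ ^ 2 := fun v => by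
    rw [sum_enorm_eigComp]
    exact Finset.single_le_sum (f := fun i => ‖v q i‖ₑ ^ 2) (fun _ _ => zero_le) (Finset.mem_univ i)
  calc _ ≤ (∑ j, ‖eigComp j v q‖ₑ ^ 2) + ((∑ j, ‖eigComp j a q‖ₑ ^ 2) + ∑ j, ‖eigComp j b q‖ₑ ^ 2) :=
        add_le_add (key v) (add_le_add (key a) (key b))
    _ = ∑ j, (‖eigComp j v q‖ₑ ^ 2 + (‖eigComp j a q‖ₑ ^ 2 + ‖eigComp j b q‖ₑ ^ 2)) := by
        rw [Finset.sum_add_distrib, Finset.sum_add_distrib]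
    _ ≤ _ := Finset.sum_le_sum fun j _ => add_le_add le_rfl le_self_add

lemma h1kNorm_coeff_le {v : Field3} (hv : v ∈ H1 D) (k : ℤ) :
    h1kNorm (halfSection D) k (coeff k v) ≤ h1Norm D v := by
  refine le_of_sq_le_sq ?_
  rw [← parseval_norm hD hv]
  exact ENNReal.le_tsum k

/-- If φ is a test field close to v, its coefficients are admissible approximants. Parseval bounds
each coefficient of v - φ by the norm of v - φ. -/
theorem coeff_mem_H1kDiamond {v : Field3} (hv : v ∈ H10 D) (k : ℤ) : coeff k v ∈ H1kDiamond D k := by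
  have h1 : h1kNorm (halfSection D) k (coeff k v) < ⊤ := (h1kNorm_coeff_le hD hv.1 k).trans_lt hv.1
  obtain ⟨a, b, hab⟩ := exists_isWeakPartials_coeff hD hv.1 k
  refine ⟨h1, fun i => ⟨(h11Norm_le_h1kNorm hD hab i).trans_lt h1, fun ε hε => ?_⟩⟩
  obtain ⟨φ, hφ, hlt⟩ := hv.2 ε hε
  have hφ1 := hφ.mem_H1 hD.isOpen
  have hs := H1_sub hD.isOpen hv.1 hφ1
  have hae := coeff_sub hD hv.1 hφ1 k
  obtain ⟨a', b', hab'⟩ := exists_isWeakPartials_coeff hD hs k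
  refine ⟨fun q => coeff k φ q i, isTest_coeff hD hφ k i, lt_of_le_of_lt ?_ hlt⟩
  refine (h11Norm_le_h1kNorm (k := k) hD (hab'.congr hae) i).trans ?_
  rw [← h1kNorm_congr hD.isOpen_halfSection hae]
  exact h1kNorm_coeff_le hD hs k

end Domain

/-! ### Bounds for functionals -/

/-- Scaling passes from the unit ball to arbitrary arguments. If the semi-norm S is 0, all multiples
of the argument are admissible and finiteness of N forces x = 0, so no Poincaré inequality is
needed. -/
lemma dual_bound {N S x : ℝ≥0∞} (hN : N < ⊤) (hS : S < ⊤)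
    (h : ∀ c : ℂ, ‖c‖ₑ * S ≤ 1 → ‖c‖ₑ * x ≤ N) : x ≤ N * S := by
  rcases eq_or_ne S 0 with rfl | hS0
  · rw [mul_zero]
    by_contra hx
    obtain ⟨n, hn⟩ := ENNReal.exists_nat_mul_gt (ne_of_not_le hx) hN.ne
    have h1 := h (n : ℂ) (by simp)
    rw [show ‖(n : ℂ)‖ₑ = n by simp [← ofReal_norm]] at h1
    exact absurd hn (not_lt.2 h1)
  · have hc : ‖((S.toReal⁻¹ : ℝ) : ℂ)‖ₑ = S⁻¹ := by
      rw [← ofReal_norm, Complex.norm_real, Real.norm_eq_abs, abs_of_nonneg (by positivity),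
        ENNReal.ofReal_inv_of_pos (ENNReal.toReal_pos hS0 hS.ne), ENNReal.ofReal_toReal hS.ne]
    have h1 := h _ (by rw [hc, ENNReal.inv_mul_cancel hS0 hS.ne])
    rw [hc] at h1
    calc x = S * (S⁻¹ * x) := by rw [← mul_assoc, ENNReal.mul_inv_cancel hS0 hS.ne, one_mul]
      _ ≤ S * N := by gcongr
      _ = N * S := mul_comm _ _

/-- Independent choices: a finite sum of suprema is approached by choosing each argument separately.
The induction carries along the sum A of the terms already chosen. -/
lemma sum_iSup_le {ι : Type*} {X : ι → Type*} [∀ i, Nonempty (X i)] (K : Finset ι)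
    (x : ∀ i, X i → ℝ≥0∞) (B : ℝ≥0∞) (h : ∀ c : ∀ i, X i, ∑ i ∈ K, x i (c i) ≤ B) :
    ∑ i ∈ K, ⨆ c, x i c ≤ B := by
  classical
  have key : ∀ A : ℝ≥0∞, (∀ c : ∀ i, X i, A + ∑ i ∈ K, x i (c i) ≤ B) →
      A + ∑ i ∈ K, ⨆ c, x i c ≤ B := by
    clear h
    induction K using Finset.induction_on with
    | empty => intro A h; simpa using h fun i => Classical.arbitrary _
    | insert a s ha ih =>
      intro A h
      rw [Finset.sum_insert ha, ← add_assoc, ENNReal.add_iSup, ENNReal.iSup_add]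
      refine iSup_le fun y => ih _ fun c => ?_
      refine le_trans (le_of_eq ?_) (h (Function.update c a y))
      rw [Finset.sum_insert ha, ← add_assoc, Function.update_self]
      congr 1
      refine Finset.sum_congr rfl fun i hi => ?_
      rw [Function.update_of_ne (fun h : i = a => ha (h ▸ hi))]
  simpa using key 0 (by simpa using h)

section Domain

variable {D : Set Space} (hD : IsAxisymmetricDomain D) {f g : Field3 → ℂ}

lemma IsHm1.le_hm1Norm {v : Field3} (hv : v ∈ H10 D) (h1 : h1Seminorm D v ≤ 1) :
    ‖f v‖ₑ ≤ hm1Norm D f :=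
  le_iSup_of_le v (le_iSup₂_of_le hv h1 le_rfl)

lemma le_hm1kNorm {F : Triple → ℂ} {k : ℤ} {v : Triple} (hv : v ∈ H1kDiamond D k)
    (h1 : h1kSeminorm (halfSection D) k v ≤ 1) : ‖F v‖ₑ ≤ hm1kNorm D k F :=
  le_iSup_of_le v (le_iSup₂_of_le hv h1 le_rfl)

lemma H10.h1Seminorm_lt_top (hO : IsOpen D) {v : Field3} (hv : v ∈ H10 D) : h1Seminorm D v < ⊤ :=
  (h1Seminorm_le_h1Norm hO hv.1).trans_lt hv.1

lemma IsHm1.enorm_le (hO : IsOpen D) (hf : IsHm1 D f) {v : Field3} (hv : v ∈ H10 D) :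
    ‖f v‖ₑ ≤ hm1Norm D f * h1Seminorm D v := by
  refine dual_bound hf.bounded (H10.h1Seminorm_lt_top hO hv) fun c hc => ?_
  rw [← h1Seminorm_smul hO hv.1] at hc
  have h1 : ‖f (c • v)‖ₑ = ‖c‖ₑ * ‖f v‖ₑ := by
    rw [hf.map_smul c v hv, enorm_mul]
    congr 1
    rw [← ofReal_norm, RCLike.norm_conj, ofReal_norm]
  rw [← h1]
  exact IsHm1.le_hm1Norm (H10_smul hO hv c) hc

lemma IsHm1.map_sub (hO : IsOpen D) (hf : IsHm1 D f) {v w : Field3} (hv : v ∈ H10 D)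
    (hw : w ∈ H10 D) : f (v - w) = f v - f w := by
  have h1 := hf.map_add v hv _ (H10_smul hO hw (-1))
  rw [hf.map_smul _ _ hw, neg_one_smul, ← sub_eq_add_neg] at h1
  rw [h1]
  simp [sub_eq_add_neg]

lemma IsHm1.map_sum (hO : IsOpen D) (hf : IsHm1 D f) {ι : Type*} (K : Finset ι) {v : ι → Field3}
    (hv : ∀ i ∈ K, v i ∈ H10 D) : f (∑ i ∈ K, v i) = ∑ i ∈ K, f (v i) := by
  classical
  induction K using Finset.induction_on with
  | empty =>
    have h := hf.map_smul 0 0 (isTest_zero.mem_H10 hO)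
    rw [zero_smul] at h
    simpa using h
  | insert a s ha ih =>
    have h2 : ∀ i ∈ s, v i ∈ H10 D := fun i hi => hv i (Finset.mem_insert_of_mem hi)
    rw [Finset.sum_insert ha, Finset.sum_insert ha, hf.map_add _ (hv a (Finset.mem_insert_self _ _))
      _ (H10_sum hO s h2), ih h2]

include hD

/-! ### Parseval's identity for functionals -/

lemma h1kSeminorm_zero (k : ℤ) : h1kSeminorm (halfSection D) k 0 = 0 := by
  have hz : (0 : Field3) ∈ H1 D := isTest_zero.mem_H1 hD.isOpen
  have h1 : h1Seminorm D (0 : Field3) ^ 2 = 0 := by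
    have h := h1Seminorm_le_h1Norm hD.isOpen hz
    rw [h1Norm_zero hD.isOpen] at h
    rw [le_antisymm h zero_le, zero_pow two_ne_zero]
  have h2 : coeff k (0 : Field3) = 0 := by
    have h := coeff_smul k 0 (0 : Field3)
    rwa [zero_smul, zero_smul] at h
  have h3 : h1kSeminorm (halfSection D) k (coeff k 0) ^ 2 ≤ 0 := by
    rw [← h1, ← parseval_seminorm hD hz]
    exact ENNReal.le_tsum k
  rw [h2] at h3
  exact pow_eq_zero_iff two_ne_zero |>.1 (le_antisymm h3 zero_le)

lemma zero_mem_H1kDiamond (k : ℤ) : (0 : Triple) ∈ H1kDiamond D k := by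
  have h := coeff_mem_H1kDiamond hD (isTest_zero.mem_H10 hD.isOpen) k
  have h2 := coeff_smul k 0 (0 : Field3)
  rw [zero_smul, zero_smul] at h2
  rwa [h2] at h

lemma h1Seminorm_sum_mode_sq {W : ℤ → Triple} (K : Finset ℤ) (hW : ∀ k ∈ K, mode k (W k) ∈ H10 D) :
    h1Seminorm D (∑ k ∈ K, mode k (W k)) ^ 2 = ∑ k ∈ K, h1kSeminorm (halfSection D) k (W k) ^ 2 := by
  rw [← parseval_seminorm hD (H10_sum hD.isOpen K hW).1, tsum_eq_sum (s := K)]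
  · refine Finset.sum_congr rfl fun k hk => ?_
    have h := coeff_sum_mode hD K hW k
    rw [if_pos hk] at h
    rw [h1kSeminorm_congr hD.isOpen_halfSection h]
  · intro k hk
    have h := coeff_sum_mode hD K hW k
    rw [if_neg hk] at h
    rw [h1kSeminorm_congr hD.isOpen_halfSection h, h1kSeminorm_zero hD, zero_pow two_ne_zero]

/-- By antilinearity, testing f on the combination of the modes with coefficients c_k = f(mode k
v_k) yields exactly T = Σ|c_k|². Orthogonality bounds its squared semi-norm by T, so T² ≤ ‖f‖² T. -/
lemma sum_enorm_mode_le (hf : IsHm1 D f) (K : Finset ℤ) {v : ℤ → Triple}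
    (hv : ∀ k, v k ∈ H1kDiamond D k) (h1 : ∀ k, h1kSeminorm (halfSection D) k (v k) ≤ 1) :
    ∑ k ∈ K, ‖f (mode k (v k))‖ₑ ^ 2 ≤ hm1Norm D f ^ 2 := by
  set c : ℤ → ℂ := fun k => f (mode k (v k)) with hc
  set T := ∑ k ∈ K, ‖c k‖ₑ ^ 2 with hT
  have hTtop : T < ⊤ := ENNReal.sum_lt_top.2 fun k _ => ENNReal.pow_lt_top (by simp)
  have hW : ∀ k ∈ K, mode k (c k • v k) ∈ H10 D := fun k _ => by
    rw [mode_smul]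
    exact H10_smul hD.isOpen (mode_mem_H10 hD (hv k)) _
  have e1 : ‖f (∑ k ∈ K, mode k (c k • v k))‖ₑ = T := by
    have : f (∑ k ∈ K, mode k (c k • v k)) = ((∑ k ∈ K, ‖c k‖ ^ 2 : ℝ) : ℂ) := by
      rw [hf.map_sum hD.isOpen K hW, Complex.ofReal_sum]
      refine Finset.sum_congr rfl fun k _ => ?_
      rw [mode_smul, hf.map_smul _ _ (mode_mem_H10 hD (hv k)), mul_comm, Complex.mul_conj,
        Complex.normSq_eq_norm_sq]
    rw [this, ← ofReal_norm, Complex.norm_real, Real.norm_eq_abs, abs_of_nonneg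
      (Finset.sum_nonneg fun _ _ => by positivity), ENNReal.ofReal_sum_of_nonneg
      (fun _ _ => by positivity)]
    exact Finset.sum_congr rfl fun k _ => ofReal_norm_sq _
  have e2 : h1Seminorm D (∑ k ∈ K, mode k (c k • v k)) ^ 2 ≤ T := by
    rw [h1Seminorm_sum_mode_sq hD K hW]
    refine Finset.sum_le_sum fun k _ => ?_
    obtain ⟨a, b, hab⟩ := exists_isWeakPartials_of_h1kNorm_lt_top (hv k).1
    rw [h1kSeminorm_const_smul hD.isOpen_halfSection (fun _ h => h.1) hab]
    exact mul_le_of_le_one_right zero_le (pow_le_one₀ zero_le (h1 k))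
  have e3 := hf.enorm_le hD.isOpen (H10_sum hD.isOpen K hW)
  rw [e1] at e3
  rcases eq_or_ne T 0 with h0 | h0
  · rw [h0]; exact zero_le
  · have e4 : T * T ≤ hm1Norm D f ^ 2 * T := by
      calc T * T ≤ (hm1Norm D f * h1Seminorm D (∑ k ∈ K, mode k (c k • v k))) ^ 2 := by
            rw [← sq]; gcongr
        _ = hm1Norm D f ^ 2 * h1Seminorm D (∑ k ∈ K, mode k (c k • v k)) ^ 2 := mul_pow _ _ _
        _ ≤ hm1Norm D f ^ 2 * T := by gcongr
    exact (ENNReal.mul_le_mul_iff_left h0 hTtop.ne).1 e4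

lemma tsum_hm1kNorm_sq_le (hf : IsHm1 D f) :
    ∑' k, hm1kNorm D k (coeffDual k f) ^ 2 ≤ hm1Norm D f ^ 2 := by
  rw [ENNReal.tsum_eq_iSup_sum]
  refine iSup_le fun K => ?_
  let X : ℤ → Type := fun k =>
    {v : Triple // v ∈ H1kDiamond D k ∧ h1kSeminorm (halfSection D) k v ≤ 1}
  have hX : ∀ k, Nonempty (X k) := fun k =>
    ⟨⟨0, zero_mem_H1kDiamond hD k, by rw [h1kSeminorm_zero hD]; exact zero_le⟩⟩
  have h1 : ∀ k, hm1kNorm D k (coeffDual k f) ^ 2 = ⨆ v : X k, ‖f (mode k v.1)‖ₑ ^ 2 := by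
    intro k
    have : hm1kNorm D k (coeffDual k f) = ⨆ v : X k, ‖f (mode k v.1)‖ₑ := by
      rw [iSup_subtype]
      simp only [hm1kNorm, coeffDual, iSup_and]
    rw [this, ENNReal.iSup_pow_of_ne_zero two_ne_zero]
  simp only [h1]
  exact sum_iSup_le K _ _ fun c => sum_enorm_mode_le hD hf K (fun k => (c k).2.1) fun k => (c k).2.2

lemma enorm_mode_coeff_le (hf : IsHm1 D f) {v : Field3} (hv : v ∈ H10 D) (k : ℤ) :
    ‖f (mode k (coeff k v))‖ₑ ≤
      hm1kNorm D k (coeffDual k f) * h1kSeminorm (halfSection D) k (coeff k v) := by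
  have hO := hD.isOpen
  have hN : hm1kNorm D k (coeffDual k f) < ⊤ := by
    have h1 : hm1kNorm D k (coeffDual k f) ^ 2 < ⊤ :=
      ((ENNReal.le_tsum k).trans (tsum_hm1kNorm_sq_le hD hf)).trans_lt (ENNReal.pow_lt_top hf.bounded)
    exact (ENNReal.pow_lt_top_iff.1 h1).resolve_right (by norm_num)
  have hm := coeff_mem_H1kDiamond hD hv k
  have hS : h1kSeminorm (halfSection D) k (coeff k v) < ⊤ := by
    rw [← h1Seminorm_mode hD hm]
    exact H10.h1Seminorm_lt_top hO (mode_mem_H10 hD hm)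
  refine dual_bound hN hS fun c hc => ?_
  have hcm := coeff_mem_H1kDiamond hD (H10_smul hO hv c) k
  rw [coeff_smul] at hcm
  have h1 : ‖f (mode k (c • coeff k v))‖ₑ = ‖c‖ₑ * ‖f (mode k (coeff k v))‖ₑ := by
    rw [mode_smul, hf.map_smul c _ (mode_mem_H10 hD hm), enorm_mul]
    congr 1
    rw [← ofReal_norm, RCLike.norm_conj, ofReal_norm]
  rw [← h1]
  refine le_hm1kNorm (F := coeffDual k f) hcm ?_
  rwa [← h1Seminorm_mode hD hcm, mode_smul, h1Seminorm_smul hO (mode_mem_H10 hD hm).1,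
    h1Seminorm_mode hD hm]

/-- By Parseval the squared semi-norm of the remainder is the tail of a convergent series, since
subtracting the modes in K removes exactly the coefficients with k ∈ K. -/
lemma tendsto_h1Seminorm_sub_sum {v : Field3} (hv : v ∈ H10 D) :
    Tendsto (fun K : Finset ℤ => h1Seminorm D (v - ∑ k ∈ K, mode k (coeff k v)) ^ 2) atTop (𝓝 0) := by
  have hO := hD.isOpen
  have hW : ∀ K : Finset ℤ, ∀ k ∈ K, mode k (coeff k v) ∈ H10 D := fun K k _ =>
    mode_mem_H10 hD (coeff_mem_H1kDiamond hD hv k)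
  have hfin : ∑' k, h1kSeminorm (halfSection D) k (coeff k v) ^ 2 ≠ ⊤ := by
    rw [parseval_seminorm hD hv.1]
    exact (ENNReal.pow_lt_top (H10.h1Seminorm_lt_top hO hv)).ne
  refine (ENNReal.tendsto_tsum_compl_atTop_zero hfin).congr fun K => ?_
  rw [← parseval_seminorm hD (H10_sub hO hv (H10_sum hO K (hW K))).1]
  refine (tsum_subtype {x | x ∉ K} fun k => h1kSeminorm (halfSection D) k (coeff k v) ^ 2).trans ?_
  refine tsum_congr fun k => ?_
  have h1 := coeff_sub hD hv.1 (H10_sum hO K (hW K)).1 k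
  have h2 := coeff_sum_mode hD K (hW K) k
  by_cases hk : k ∈ K
  · rw [indicator_of_notMem (by simpa using hk)]
    have h3 : coeff k (v - ∑ n ∈ K, mode n (coeff n v)) =ᵐ[volume.restrict (halfSection D)] 0 := by
      rw [if_pos hk] at h2
      filter_upwards [h1, h2] with q e1 e2
      rw [e1, Pi.sub_apply, e2, sub_self, Pi.zero_apply]
    rw [h1kSeminorm_congr hD.isOpen_halfSection h3, h1kSeminorm_zero hD, zero_pow two_ne_zero]
  · rw [indicator_of_mem (by simpa using hk)]
    have h3 : coeff k (v - ∑ n ∈ K, mode n (coeff n v)) =ᵐ[volume.restrict (halfSection D)]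
        coeff k v := by
      rw [if_neg hk] at h2
      filter_upwards [h1, h2] with q e1 e2
      rw [e1, Pi.sub_apply, e2, Pi.zero_apply, sub_zero]
    rw [h1kSeminorm_congr hD.isOpen_halfSection h3]

/-- An argument v is expanded in its modes. Cauchy–Schwarz in k bounds f on each partial sum
uniformly, and the remainder tends to zero because f is bounded for the semi-norm. -/
lemma hm1Norm_sq_le_tsum (hf : IsHm1 D f) :
    hm1Norm D f ^ 2 ≤ ∑' k, hm1kNorm D k (coeffDual k f) ^ 2 := by
  have hO := hD.isOpen
  set A := ∑' k, hm1kNorm D k (coeffDual k f) ^ 2 with hA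
  suffices h : hm1Norm D f ≤ A ^ (1 / 2 : ℝ) by
    calc hm1Norm D f ^ 2 ≤ (A ^ (1 / 2 : ℝ)) ^ 2 := by gcongr
      _ = A := rpow_half_sq A
  refine iSup_le fun v => iSup₂_le fun hv h1 => ?_
  have hW : ∀ K : Finset ℤ, ∀ k ∈ K, mode k (coeff k v) ∈ H10 D := fun K k _ =>
    mode_mem_H10 hD (coeff_mem_H1kDiamond hD hv k)
  have hb : ∀ K : Finset ℤ, ‖f v‖ₑ ≤ hm1Norm D f *
      (h1Seminorm D (v - ∑ k ∈ K, mode k (coeff k v)) ^ 2) ^ (1 / 2 : ℝ) + A ^ (1 / 2 : ℝ) := by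
    intro K
    have hS := H10_sum hO K (hW K)
    have e1 : f v = f (v - ∑ k ∈ K, mode k (coeff k v)) + ∑ k ∈ K, f (mode k (coeff k v)) := by
      rw [hf.map_sub hO hv hS, hf.map_sum hO K (hW K)]
      ring
    rw [e1, sq_rpow_half]
    refine (enorm_add_le _ _).trans (add_le_add (hf.enorm_le hO (H10_sub hO hv hS)) ?_)
    calc ‖∑ k ∈ K, f (mode k (coeff k v))‖ₑ ≤ ∑ k ∈ K, ‖f (mode k (coeff k v))‖ₑ := enorm_sum_le _ _
      _ ≤ ∑ k ∈ K, hm1kNorm D k (coeffDual k f) * h1kSeminorm (halfSection D) k (coeff k v) :=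
        Finset.sum_le_sum fun k _ => enorm_mode_coeff_le hD hf hv k
      _ ≤ (∑ k ∈ K, hm1kNorm D k (coeffDual k f) ^ (2 : ℝ)) ^ (1 / 2 : ℝ) *
          (∑ k ∈ K, h1kSeminorm (halfSection D) k (coeff k v) ^ (2 : ℝ)) ^ (1 / 2 : ℝ) :=
        ENNReal.inner_le_Lp_mul_Lq K _ _ Real.HolderConjugate.two_two
      _ ≤ A ^ (1 / 2 : ℝ) * 1 := by
        simp only [ENNReal.rpow_two]
        gcongr
        · exact ENNReal.sum_le_tsum K
        · refine ENNReal.rpow_le_one ?_ (by norm_num)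
          refine (ENNReal.sum_le_tsum K).trans ?_
          rw [parseval_seminorm hD hv.1]
          exact pow_le_one₀ zero_le h1
      _ = A ^ (1 / 2 : ℝ) := mul_one _
  have ht : Tendsto (fun K : Finset ℤ => hm1Norm D f *
      (h1Seminorm D (v - ∑ k ∈ K, mode k (coeff k v)) ^ 2) ^ (1 / 2 : ℝ) + A ^ (1 / 2 : ℝ)) atTop
      (𝓝 (hm1Norm D f * 0 + A ^ (1 / 2 : ℝ))) := by
    have h2 := (ENNReal.continuous_rpow_const (y := 1 / 2)).tendsto 0 |>.comp
      (tendsto_h1Seminorm_sub_sum hD hv)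
    rw [ENNReal.zero_rpow_of_pos (by norm_num)] at h2
    exact (ENNReal.Tendsto.const_mul h2 (Or.inr hf.bounded.ne)).add tendsto_const_nhds
  rw [mul_zero, zero_add] at ht
  exact ge_of_tendsto' ht hb

theorem parseval_hm1Norm (hf : IsHm1 D f) :
    ∑' k, hm1kNorm D k (coeffDual k f) ^ 2 = hm1Norm D f ^ 2 :=
  le_antisymm (tsum_hm1kNorm_sq_le hD hf) (hm1Norm_sq_le_tsum hD hf)

/-! ### Rotational derivatives of functionals -/

/-- The relation between f and g is known on test fields only. It is evaluated on test fields of the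
same angular frequency and passes to the limit by continuity of both functionals. -/
lemma apply_mode_of_isRotDerivDual {l : ℕ} (hf : IsHm1 D f) (hg : IsHm1 D g)
    (h : IsRotDerivDual D l f g) {k : ℤ} {v : Triple} (hv : v ∈ H1kDiamond D k) :
    g (mode k v) = (Complex.I * k) ^ l * f (mode k v) := by
  have hO := hD.isOpen
  have hu := mode_mem_H10 hD hv
  set c := (Complex.I * (k : ℂ)) ^ l with hc
  -- As f is antilinear, the factor (ik)^l leaves f conjugated to (-ik)^l; the sign of the
  -- transposed operator restores it.
  have hconj : (-1) ^ l * conj c = c := by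
    rw [hc, map_pow, ← mul_pow, map_mul, Complex.conj_I, map_intCast]
    congr 1
    ring
  set B := hm1Norm D g + ‖c‖ₑ * hm1Norm D f with hB
  have hBtop : B < ⊤ := ENNReal.add_lt_top.2 ⟨hg.bounded, ENNReal.mul_lt_top (by simp) hf.bounded⟩
  have hle : ∀ ε : ℝ≥0∞, 0 < ε → ‖g (mode k v) - c * f (mode k v)‖ₑ ≤ B * ε := by
    intro ε hε
    obtain ⟨Φ, hΦ, hrot, hlt⟩ := exists_isTest_mode_sub hD hv hε
    have hΦ0 := hΦ.mem_H10 hO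
    have hs := H10_sub hO hu hΦ0
    have e1 : g Φ = c * f Φ := by
      rw [h Φ hΦ, hrot, hf.map_smul _ _ hΦ0, ← mul_assoc, hconj]
    have e2 : g (mode k v) - c * f (mode k v) = g (mode k v - Φ) - c * f (mode k v - Φ) := by
      rw [hg.map_sub hO hu hΦ0, hf.map_sub hO hu hΦ0, e1]
      ring
    have e3 : h1Seminorm D (mode k v - Φ) ≤ ε := (h1Seminorm_le_h1Norm hO hs.1).trans hlt.le
    rw [e2]
    refine (enorm_sub_le).trans ?_
    rw [enorm_mul, hB, add_mul, mul_assoc]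
    gcongr
    · exact (hg.enorm_le hO hs).trans (by gcongr)
    · exact (hf.enorm_le hO hs).trans (by gcongr)
  have h0 : ‖g (mode k v) - c * f (mode k v)‖ₑ ≤ 0 := by
    have ht : Tendsto (fun ε : ℝ≥0∞ => B * ε) (𝓝[>] 0) (𝓝 (B * 0)) :=
      (ENNReal.Tendsto.const_mul tendsto_id (Or.inr hBtop.ne)).mono_left nhdsWithin_le_nhds
    rw [mul_zero] at ht
    exact ge_of_tendsto ht (eventually_nhdsWithin_of_forall fun ε hε => hle ε hε)
  exact sub_eq_zero.1 (enorm_eq_zero.1 (le_antisymm h0 zero_le))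

lemma hm1Norm_rotDerivDual {l : ℕ} (hf : IsHm1 D f) (hg : IsHm1 D g) (h : IsRotDerivDual D l f g) :
    hm1Norm D g ^ 2 = ∑' k : ℤ, ENNReal.ofReal (((k : ℝ) ^ 2) ^ l) *
      hm1kNorm D k (coeffDual k f) ^ 2 := by
  rw [← parseval_hm1Norm hD hg]
  refine tsum_congr fun k => ?_
  have : hm1kNorm D k (coeffDual k g) = ‖(Complex.I * (k : ℂ)) ^ l‖ₑ * hm1kNorm D k (coeffDual k f) := by
    simp only [hm1kNorm, ENNReal.mul_iSup]
    refine iSup_congr fun v => iSup_congr fun hv => iSup_congr fun _ => ?_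
    rw [coeffDual, coeffDual, apply_mode_of_isRotDerivDual hD hf hg h hv, enorm_mul]
  rw [this, mul_pow, enorm_I_mul_pow_sq]

theorem fourierNormHm1_equivalence (s : ℕ) (hf : f ∈ AnisoHm1 D s) :
    ((1 : ℝ≥0) : ℝ≥0∞) * naturalNormHm1 D s f ≤ fourierNormHm1 D s f ∧
      fourierNormHm1 D s f ≤ ((2 ^ s : ℝ≥0) : ℝ≥0∞) * naturalNormHm1 D s f := by
  refine weighted_equivalence s (fun k => hm1kNorm D k (coeffDual k f)) _ fun l hl => ?_
  obtain ⟨g, hg, h⟩ := hf.2 l hl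
  have key : (⨅ (g : Field3 → ℂ) (_ : IsHm1 D g) (_ : IsRotDerivDual D l f g), hm1Norm D g) =
      hm1Norm D g := by
    -- All admissible g have the same norm, because it is expressed through the coefficients of f
    -- alone.
    refine le_antisymm (iInf_le_of_le g (iInf₂_le hg h)) (le_iInf fun g' => le_iInf₂ fun hg' h' => ?_)
    refine le_of_sq_le_sq (le_of_eq ?_)
    rw [hm1Norm_rotDerivDual hD hf.1 hg h, hm1Norm_rotDerivDual hD hf.1 hg' h']
  rw [key]
  exact hm1Norm_rotDerivDual hD hf.1 hg h

end Domain

end Axisym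

end

theorem mainTheorem8 (s : ℕ) :
    ∃ c C : ℝ≥0, 0 < c ∧ 0 < C ∧
      ∀ D : Set Axisym.Space, Axisym.IsAxisymmetricDomain D →
        (∀ v ∈ Axisym.AnisoH1 D s,
          (c : ℝ≥0∞) * Axisym.naturalNormH1 D s v ≤ Axisym.fourierNormH1 D s v ∧
          Axisym.fourierNormH1 D s v ≤ (C : ℝ≥0∞) * Axisym.naturalNormH1 D s v) ∧
        (∀ f ∈ Axisym.AnisoHm1 D s,
          (c : ℝ≥0∞) * Axisym.naturalNormHm1 D s f ≤ Axisym.fourierNormHm1 D s f ∧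
          Axisym.fourierNormHm1 D s f ≤ (C : ℝ≥0∞) * Axisym.naturalNormHm1 D s f) :=
  -- The constants come only from comparing the weights in k; the Parseval identities are exact, so
  -- nothing depends on the domain or the sign.
  ⟨1, 2 ^ s, one_pos, by positivity, fun _ hD =>
    ⟨fun _ hv => Axisym.fourierNormH1_equivalence hD s hv,
      fun _ hf => Axisym.fourierNormHm1_equivalence hD s hf⟩⟩
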